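/- **Setting.** Two particles $i=1,2$ of masses $m_i>0$ move in $\mathbb R^3$ (speed of light $1$); $j=3-i$. An *orbit of $X_{BV}$* is a function $\mathbf x$ on a compact time interval with $\mathbf x(t)=\mathbf x(t_0)+\int_{t_0}^t\dot{\mathbf x}$, where $\dot{\mathbf x}$ has bounded variation and $\sup|\dot{\mathbf x}|<1$. An *orbit of $T_{BV}\otimes X_{BV}$* is a function $Q(s)=(t(s),\mathbf x(s))$ on a compact interval, obtained by integration of derivatives $(t',\mathbf x')$ of bounded variation with $\inf t'>0$ and $|\mathbf x'|\le\kappa\,t'$ for some $\kappa<1$. It *reparametrises* the orbit $\hat{\mathbf x}$ of $X_{BV}$ if $\mathbf x(s)=\hat{\mathbf x}(t(s))$ and $\mathbf x'(s)=t'(s)\,\dot{\hat{\mathbf x}}(t(s))$, and $t(\cdot)$ maps end points to end points. (The derivatives are fixed representatives, defined everywhere.) For an event $(t,\mathbf y)$ and a sign $\pm$, let $t_j^\pm$ be the time on orbit $j$ with $t_j^\pm=t\pm|\mathbf y-\mathbf x_j(t_j^\pm)|$; put $\mathbf x_j^\pm=\mathbf x_j(t_j^\pm)$, $\dot{\mathbf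 x}_j^\pm=\dot{\mathbf x}_j(t_j^\pm)$, $r^\pm=|\mathbf y-\mathbf x_j^\pm|$, $\mathbf n^\pm=(\mathbf y-\mathbf x_j^\pm)/r^\pm$. With $$\mathcal M_i=m_i\bigl(1-\sqrt{1-\mathbf v^2}\bigr),\qquad \mathcal I_{ij}^\pm=\frac{1-\mathbf v\cdot\dot{\mathbf x}_j^\pm}{2r^\pm(1\pm\mathbf n^\pm\cdot\dot{\mathbf x}_j^\pm)},$$ the partial Lagrangian is $\mathcal L_i(\mathbf y,\mathbf v,t)=\mathcal M_i+\mathcal I^-_{ij}+\mathcal I^+_{ij}$; along orbit $i$ its momentum is $P_i=\partial\mathcal L_i/\partial\dot{\mathbf x}_i$ and its Legendre transform is $E_i=\dot{\mathbf x}_i\cdot P_i-\mathcal L_i$. On $T_{BV}\otimes X_{BV}$ the light-cone condition is $t_j(s_j^\pm)=t\pm|\mathbf y-\mathbf x_j(s_j^\pm)|$, and (the subscript $j\pm$ denoting evaluation at $s_j^\pm$) $$\widetilde M_i=m_i\bigl(t_i'-\sqrt{t_i'^2-\mathbf x_i'^2}\bigr),\qquad \widetilde I_{ij}^\pm=\frac{t_i't'_{j\pm}-\mathbf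 x_i'\cdot\mathbf x'_{j\pm}}{2r^\pm(t'_{j\pm}\pm\mathbf n^\pm\cdot\mathbf x'_{j\pm})},\qquad \widetilde L_i=\widetilde M_i+\widetilde I_{ij}^-+\widetilde I_{ij}^+ .$$ The extended momentum along $Q_i$ is $\widetilde P_i^0=\partial\widetilde L_i/\partial t_i'$, $\widetilde P_{\mathbf x_i}=\partial\widetilde L_i/\partial\mathbf x_i'$. *Boundary-value problem.* $Q_1$ is given on $[s_{O_1},s_{L_2^+}]$ and $Q_2$ on $[s_{O_1^-},s_{L_2}]$, with disjoint images (no collisions); $Q_2(s_{O_1^\pm})$ lies on the future/past light cone of $Q_1(s_{O_1})$, and $Q_1(s_{L_2^\pm})$ on the future/past light cone of $Q_2(s_{L_2})$; $s_{L_2^-}$ and $s_{O_1^+}$ are interior points of the two intervals. The free segments are $K_1=[s_{O_1},s_{L_2^-}]$ and $K_2=[s_{O_1^+},s_{L_2}]$. The extended action is $$\widetilde S=\int_{K_2}\widetilde M_2\,ds_2+\int_{K_1}\widetilde M_1\,ds_1+\int_{s_{O_1}}^{s_{L_2^+}}\widetilde I_{12}^-\,ds_1+\int_{K_1}\widetilde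 I_{12}^+\,ds_1 ,$$ or, taken along particle 2, $\int_{K_1}\widetilde M_1ds_1+\int_{K_2}\widetilde M_2ds_2+\int_{s_{O_1^-}}^{s_{L_2}}\widetilde I_{21}^+ds_2+\int_{K_2}\widetilde I_{21}^-ds_2$. The action $S$ on $X_{BV}$ is given by the same formulas with $\mathcal M,\mathcal I^\pm$ and the corresponding times. *First variation.* For a variation $\mathsf b=(b^0,\mathbf b)$ of $Q_i$, obtained on $K_i$ by integration of a derivative of bounded variation, zero at both ends of $K_i$ and extended by zero, put $$\delta\widetilde S_i(\mathsf b)=\int_{K_i}\Bigl[\tfrac{\partial\widetilde L_i}{\partial t_i}b^0+\tfrac{\partial\widetilde L_i}{\partial\mathbf x_i}\cdot\mathbf b+\widetilde P_i^0\,(b^0)'+\widetilde P_{\mathbf x_i}\cdot\mathbf b'\Bigr]ds ,$$ with the partial derivatives of $\widetilde L_i$ taken almost everywhere, $Q_j$ fixed. $Q_i$ is *critical* if $\delta\widetilde S_i(\mathsf b)=0$ for all such $\mathsf b$. **Theorem.** (a) If $\hat{\mathbf x}$ is an orbit of $X_{BV}$ and $t(\cdot)$ is an increasing function of a compact interval onto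 its time interval, obtained by integration of a derivative $t'$ of bounded variation with $\inf t'>0$, then $s\mapsto(t(s),\hat{\mathbf x}(t(s)))$ is an orbit of $T_{BV}\otimes X_{BV}$ reparametrising $\hat{\mathbf x}$; in particular $t(s)=s$ embeds $X_{BV}$. Every orbit of $T_{BV}\otimes X_{BV}$ reparametrises an orbit of $X_{BV}$. Now let $Q_1,Q_2$ be as in the boundary-value problem, reparametrising $\hat{\mathbf x}_1,\hat{\mathbf x}_2$; let $i\in\{1,2\}$, and let $\mathcal L_i$, $P_i$, $E_i$ be those of $\hat{\mathbf x}_1,\hat{\mathbf x}_2$. (b) The light-cone points needed in the action exist and are unique, all integrands of $\widetilde S$ are integrable, the two forms of $\widetilde S$ agree, and they equal $S[\hat{\mathbf x}_1,\hat{\mathbf x}_2]$ (either form). (c) On $K_i$, with $t=t_i(s)$: $\widetilde L_i=t_i'\,\mathcal L_i$; $\widetilde L_i$ is differentiable in $t_i'$ and in $\mathbf x_i'$; and $$\widetilde P_i^0(s)=-E_i(t),\qquad \widetilde P_{\mathbf x_i}(s)=P_i(t).$$ On $t_i(K_i)$, $\mathcal L_i$ is differentiable in $\dot{\mathbf x}_i$,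 and $$P_i=\frac{m_i\dot{\mathbf x}_i}{\sqrt{1-\dot{\mathbf x}_i^2}}-\sum_\pm\frac{\dot{\mathbf x}_j^\pm}{2r^\pm(1\pm\mathbf n^\pm\cdot\dot{\mathbf x}_j^\pm)},\qquad E_i=\frac{m_i}{\sqrt{1-\dot{\mathbf x}_i^2}}-m_i-\sum_\pm\frac1{2r^\pm(1\pm\mathbf n^\pm\cdot\dot{\mathbf x}_j^\pm)} .$$ (d) $\widetilde P_i^0$ and $\widetilde P_{\mathbf x_i}$ have bounded variation on $K_i$, and $E_i$ and $P_i$ have bounded variation on $t_i(K_i)$. (e) For almost every $s\in K_i$, $\widetilde L_i$ is differentiable in $(t_i,\mathbf x_i)$; these partial derivatives are integrable on $K_i$. If $Q_j'$ is Lipschitz, $\delta\widetilde S_i(\mathsf b)$ is the derivative at $\epsilon=0$ of the extended action (taken along particle $i$) under $Q_i\mapsto Q_i+\epsilon\,\mathsf b$ with $Q_j$ fixed. (f) If $Q_i$ is critical, then, up to their values on a countable set, $\widetilde P_i^0$ and $\widetilde P_{\mathbf x_i}$ are absolutely continuous on $K_i$, and $E_i$ and $P_i$ are absolutely continuous functions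 of $t$ on $t_i(K_i)$; and the extended Euler–Lagrange equations $\frac{d}{ds}\widetilde P_i^0=\frac{\partial\widetilde L_i}{\partial t_i}$, $\frac{d}{ds}\widetilde P_{\mathbf x_i}=\frac{\partial\widetilde L_i}{\partial\mathbf x_i}$ hold almost everywhere on $K_i$. (g) The time component of the extended Euler–Lagrange equations adds no new condition: for almost every $s\in K_i$, the spatial components hold at $s$ if and only if $\frac{d}{dt}P_i=\frac{\partial\mathcal L_i}{\partial\mathbf x_i}$ holds at $t_i(s)$, and in that case the time component holds at $s$. -/

import Mathlib

open MeasureTheory Set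

/-- Euclidean three-space. -/
abbrev E3 : Type := EuclideanSpace ℝ (Fin 3)

/-! ### Trajectories -/

/-- Data of a trajectory `x` over the time segment `[lo, hi]`, together with a representative `v`
of its velocity. -/
structure TimeOrbit where
  lo : ℝ
  hi : ℝ
  x : ℝ → E3
  v : ℝ → E3

/-- Data of a trajectory `s ↦ (t s, x s)` in `ℝ × ℝ³` over the parameter segment `[lo, hi]`,
together with representatives `dt`, `dx` of the `s`-derivatives. -/
structure FourOrbit where
  lo : ℝ
  hi : ℝ
  t : ℝ → ℝ
  x : ℝ → E3
  dt : ℝ → ℝ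
  dx : ℝ → E3

/-- Sub-luminal orbits of `X_BV`: `x` is obtained by integration of a velocity of bounded
variation, whose norm stays below the speed of light. -/
structure TimeOrbit.IsXBV (X : TimeOrbit) : Prop where
  lt : X.lo < X.hi
  bv : BoundedVariationOn X.v (Icc X.lo X.hi)
  x_eq : ∀ t ∈ Icc X.lo X.hi, X.x t = X.x X.lo + ∫ r in X.lo..t, X.v r
  subluminal : ∃ κ < 1, ∀ t ∈ Icc X.lo X.hi, ‖X.v t‖ ≤ κ

/-- `t` is an increasing time function on `[lo, hi]`, obtained by integration of a derivative `dt`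
of bounded variation. -/
structure IsTBV (lo hi : ℝ) (t dt : ℝ → ℝ) : Prop where
  lt : lo < hi
  bv : BoundedVariationOn dt (Icc lo hi)
  t_eq : ∀ s ∈ Icc lo hi, t s = t lo + ∫ r in lo..s, dt r
  pos : ∃ c > 0, ∀ s ∈ Icc lo hi, c ≤ dt s

/-- Sub-luminal orbits of `T_BV ⊗ X_BV`. -/
structure FourOrbit.IsTBVXBV (Q : FourOrbit) : Prop where
  time : IsTBV Q.lo Q.hi Q.t Q.dt
  bv : BoundedVariationOn Q.dx (Icc Q.lo Q.hi)
  x_eq : ∀ s ∈ Icc Q.lo Q.hi, Q.x s = Q.x Q.lo + ∫ r in Q.lo..s, Q.dx r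
  subluminal : ∃ κ < 1, ∀ s ∈ Icc Q.lo Q.hi, ‖Q.dx s‖ ≤ κ * Q.dt s

/-- `Q` is a reparametrisation of `X`: `x_Q(s) = x_X(t(s))`, with the chain rule
`x_Q' = t' • v_X(t(s))` for the derivatives. -/
structure IsReparam (Q : FourOrbit) (X : TimeOrbit) : Prop where
  lo_eq : Q.t Q.lo = X.lo
  hi_eq : Q.t Q.hi = X.hi
  x_eq : ∀ s ∈ Icc Q.lo Q.hi, Q.x s = X.x (Q.t s)
  dx_eq : ∀ s ∈ Icc Q.lo Q.hi, Q.dx s = Q.dt s • X.v (Q.t s)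

/-- The orbit `s ↦ (t s, x (t s))` over `[lo, hi]`. -/
noncomputable def TimeOrbit.reparam (X : TimeOrbit) (lo hi : ℝ) (t dt : ℝ → ℝ) : FourOrbit where
  lo := lo
  hi := hi
  t := t
  x := fun s => X.x (t s)
  dt := dt
  dx := fun s => dt s • X.v (t s)

/-- The unit vector `n` pointing from `z` to `y`. -/
noncomputable def unitVec (y z : E3) : E3 := (‖y - z‖)⁻¹ • (y - z)

/-! ### Light cones and Lagrangians over `X_BV`
The sign `σ` is `1` for the future light cone and `-1` for the past light cone. -/

/-- The time `τ` of `X` is in light-cone condition with the event `(t, y)`. -/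
def TimeOrbit.OnCone (X : TimeOrbit) (σ t : ℝ) (y : E3) (τ : ℝ) : Prop :=
  τ ∈ Icc X.lo X.hi ∧ τ = t + σ * ‖y - X.x τ‖

/-- The deviating argument `t_j^±(t, y)`. -/
noncomputable def TimeOrbit.coneTime (X : TimeOrbit) (σ t : ℝ) (y : E3) : ℝ :=
  Classical.epsilon (X.OnCone σ t y)

/-- The local term `m (1 - √(1 - v²))`. -/
noncomputable def localLag (m : ℝ) (v : E3) : ℝ := m * (1 - Real.sqrt (1 - ‖v‖ ^ 2))

/-- The denominator `2 r (1 ± n · ẋ_j)`, at the event `(t, y)`. -/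
noncomputable def coneDen (σ : ℝ) (X : TimeOrbit) (t : ℝ) (y : E3) : ℝ :=
  2 * ‖y - X.x (X.coneTime σ t y)‖ *
    (1 + σ * inner ℝ (unitVec y (X.x (X.coneTime σ t y))) (X.v (X.coneTime σ t y)))

/-- The interaction term `𝓘_ij^±` felt at `(t, y)` with velocity `v`, `X` being the orbit of the
other particle. -/
noncomputable def interLag (σ : ℝ) (X : TimeOrbit) (t : ℝ) (y v : E3) : ℝ :=
  (1 - inner ℝ v (X.v (X.coneTime σ t y))) / coneDen σ X t y

/-- The partial Lagrangian `𝓛_i (y, v, t)` of a particle of mass `m` in the field of `X`. -/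
noncomputable def partialLag (m : ℝ) (X : TimeOrbit) (y v : E3) (t : ℝ) : ℝ :=
  localLag m v + interLag (-1) X t y v + interLag 1 X t y v

/-- The vector potential `A_j (t, y)`. -/
noncomputable def vecPot (X : TimeOrbit) (t : ℝ) (y : E3) : E3 :=
  (coneDen (-1) X t y)⁻¹ • X.v (X.coneTime (-1) t y) +
    (coneDen 1 X t y)⁻¹ • X.v (X.coneTime 1 t y)

/-- The scalar potential `U_j (t, y)`. -/
noncomputable def scalPot (X : TimeOrbit) (t : ℝ) (y : E3) : ℝ :=
  (coneDen (-1) X t y)⁻¹ + (coneDen 1 X t y)⁻¹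

/-- The momentum `P_i(t) = ∂𝓛_i/∂ẋ_i` along `Xi`, in the field of `Xj`. -/
noncomputable def momentum (m : ℝ) (Xi Xj : TimeOrbit) (t : ℝ) : E3 :=
  gradient (fun v => partialLag m Xj (Xi.x t) v t) (Xi.v t)

/-- The partial derivative `∂𝓛_i/∂x_i` along `Xi`, in the field of `Xj`. -/
noncomputable def dxLag (m : ℝ) (Xi Xj : TimeOrbit) (t : ℝ) : E3 :=
  gradient (fun y => partialLag m Xj y (Xi.v t) t) (Xi.x t)

/-- The Legendre transform `ẋ_i · ∂𝓛_i/∂ẋ_i - 𝓛_i` along `Xi`, in the field of `Xj`. -/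
noncomputable def legendre (m : ℝ) (Xi Xj : TimeOrbit) (t : ℝ) : ℝ :=
  inner ℝ (Xi.v t) (momentum m Xi Xj t) - partialLag m Xj (Xi.x t) (Xi.v t) t

/-- The Euler–Lagrange equation of `𝓛_i` at the time `t`. -/
def EulerLagrangeAt (m : ℝ) (Xi Xj : TimeOrbit) (t : ℝ) : Prop :=
  HasDerivAt (momentum m Xi Xj) (dxLag m Xi Xj t) t

/-! ### Light cones and Lagrangians over `T_BV ⊗ X_BV` -/

/-- The parameter `s` of `Q` is in light-cone condition with the event `(T, y)`. -/
def FourOrbit.OnCone (Q : FourOrbit) (σ T : ℝ) (y : E3) (s : ℝ) : Prop :=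
  s ∈ Icc Q.lo Q.hi ∧ Q.t s = T + σ * ‖y - Q.x s‖

/-- The deviating argument `s_j^±(T, y)`. -/
noncomputable def FourOrbit.conePar (Q : FourOrbit) (σ T : ℝ) (y : E3) : ℝ :=
  Classical.epsilon (Q.OnCone σ T y)

/-- The local term `m (t' - √(t'² - x'²))`, with `τ = t'` and `u = x'`. -/
noncomputable def localLagExt (m τ : ℝ) (u : E3) : ℝ := m * (τ - Real.sqrt (τ ^ 2 - ‖u‖ ^ 2))

/-- The interaction term `Ĩ_ij^±` at the event `(T, y)` with derivatives `τ = t'`, `u = x'`, `Q`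
being the orbit of the other particle. -/
noncomputable def interLagExt (σ : ℝ) (Q : FourOrbit) (T : ℝ) (y : E3) (τ : ℝ) (u : E3) : ℝ :=
  (τ * Q.dt (Q.conePar σ T y) - inner ℝ u (Q.dx (Q.conePar σ T y))) /
    (2 * ‖y - Q.x (Q.conePar σ T y)‖ * (Q.dt (Q.conePar σ T y) +
      σ * inner ℝ (unitVec y (Q.x (Q.conePar σ T y))) (Q.dx (Q.conePar σ T y))))

/-- The extended partial Lagrangian `L̃_i (T, y, τ, u)`. -/
noncomputable def partialLagExt (m : ℝ) (Q : FourOrbit) (T : ℝ) (y : E3) (τ : ℝ) (u : E3) : ℝ :=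
  localLagExt m τ u + interLagExt (-1) Q T y τ u + interLagExt 1 Q T y τ u

/-- `∂L̃_i/∂t_i'` along `Qi`, the zeroth component of the extended momentum. -/
noncomputable def momentumExt0 (m : ℝ) (Qi Qj : FourOrbit) (s : ℝ) : ℝ :=
  deriv (fun τ => partialLagExt m Qj (Qi.t s) (Qi.x s) τ (Qi.dx s)) (Qi.dt s)

/-- `∂L̃_i/∂x_i'` along `Qi`, the spatial part of the extended momentum. -/
noncomputable def momentumExt (m : ℝ) (Qi Qj : FourOrbit) (s : ℝ) : E3 :=
  gradient (fun u => partialLagExt m Qj (Qi.t s) (Qi.x s) (Qi.dt s) u) (Qi.dx s)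

/-- `∂L̃_i/∂t_i` along `Qi`. -/
noncomputable def dtLagExt (m : ℝ) (Qi Qj : FourOrbit) (s : ℝ) : ℝ :=
  deriv (fun T => partialLagExt m Qj T (Qi.x s) (Qi.dt s) (Qi.dx s)) (Qi.t s)

/-- `∂L̃_i/∂x_i` along `Qi`. -/
noncomputable def dxLagExt (m : ℝ) (Qi Qj : FourOrbit) (s : ℝ) : E3 :=
  gradient (fun y => partialLagExt m Qj (Qi.t s) y (Qi.dt s) (Qi.dx s)) (Qi.x s)

/-- The time component of the extended Euler–Lagrange equations at `s`. -/
def EulerLagrangeExtTimeAt (m : ℝ) (Qi Qj : FourOrbit) (s : ℝ) : Prop :=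
  HasDerivAt (momentumExt0 m Qi Qj) (dtLagExt m Qi Qj s) s

/-- The spatial components of the extended Euler–Lagrange equations at `s`. -/
def EulerLagrangeExtSpaceAt (m : ℝ) (Qi Qj : FourOrbit) (s : ℝ) : Prop :=
  HasDerivAt (momentumExt m Qi Qj) (dxLagExt m Qi Qj s) s

/-! ### The boundary-value problem
Particle 1 has index `0` and particle 2 has index `1`; the other particle of `i` is `1 - i`.
The orbit of particle 1 runs from `O₁` to `L₂⁺` and that of particle 2 from `O₁⁻` to `L₂`. The
intermediate parameters are `k 0 = s_{L₂⁻}` and `k 1 = s_{O₁⁺}`, and the segments free to vary are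
`[s_{O₁}, s_{L₂⁻}]` and `[s_{O₁⁺}, s_{L₂}]`. -/

/-- Start of the segment of particle `i` that is free to vary. -/
def freeLo (lo k : Fin 2 → ℝ) : Fin 2 → ℝ
  | 0 => lo 0
  | 1 => k 1

/-- End of the segment of particle `i` that is free to vary. -/
def freeHi (hi k : Fin 2 → ℝ) : Fin 2 → ℝ
  | 0 => k 0
  | 1 => hi 1

/-- The sign of the light cone whose interaction term is integrated over the whole orbit of
particle `i`: past for particle 1, future for particle 2. -/
def outerSign : Fin 2 → ℝ
  | 0 => -1
  | 1 => 1

/-- A pair of sub-luminal orbits of `T_BV ⊗ X_BV` without collisions, with end points in the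
light-cone relations of the boundary-value problem. -/
structure IsBoundaryPair (Q : Fin 2 → FourOrbit) (k : Fin 2 → ℝ) : Prop where
  mem : ∀ i, (Q i).IsTBVXBV
  k_mem : ∀ i, k i ∈ Ioo (Q i).lo (Q i).hi
  noncollision : ∀ s ∈ Icc (Q 0).lo (Q 0).hi, ∀ s' ∈ Icc (Q 1).lo (Q 1).hi,
    ((Q 0).t s, (Q 0).x s) ≠ ((Q 1).t s', (Q 1).x s')
  O1_past : (Q 1).OnCone (-1) ((Q 0).t (Q 0).lo) ((Q 0).x (Q 0).lo) (Q 1).lo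
  O1_future : (Q 1).OnCone 1 ((Q 0).t (Q 0).lo) ((Q 0).x (Q 0).lo) (k 1)
  L2_past : (Q 0).OnCone (-1) ((Q 1).t (Q 1).hi) ((Q 1).x (Q 1).hi) (k 0)
  L2_future : (Q 0).OnCone 1 ((Q 1).t (Q 1).hi) ((Q 1).x (Q 1).hi) (Q 0).hi

/-- The action functional over `X_BV`, with the interaction integrals taken along particle `i`. -/
noncomputable def action (i : Fin 2) (m : Fin 2 → ℝ) (X : Fin 2 → TimeOrbit) (k : Fin 2 → ℝ) : ℝ :=
  let lo := fun j => (X j).lo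
  let hi := fun j => (X j).hi
  (∫ t in (freeLo lo k (1 - i))..(freeHi hi k (1 - i)), localLag (m (1 - i)) ((X (1 - i)).v t)) +
  (∫ t in (freeLo lo k i)..(freeHi hi k i), localLag (m i) ((X i).v t)) +
  (∫ t in (lo i)..(hi i), interLag (outerSign i) (X (1 - i)) t ((X i).x t) ((X i).v t)) +
  (∫ t in (freeLo lo k i)..(freeHi hi k i),
    interLag (-outerSign i) (X (1 - i)) t ((X i).x t) ((X i).v t))

/-- The integrand `M̃` along `Q`. -/
noncomputable def localAlong (m : ℝ) (Q : FourOrbit) (s : ℝ) : ℝ := localLagExt m (Q.dt s) (Q.dx s)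

/-- The integrand `Ĩ^±` along `Qi`, in the field of `Qj`. -/
noncomputable def interAlong (σ : ℝ) (Qi Qj : FourOrbit) (s : ℝ) : ℝ :=
  interLagExt σ Qj (Qi.t s) (Qi.x s) (Qi.dt s) (Qi.dx s)

/-- Start of the free parameter segment of particle `i`. -/
def parLo (Q : Fin 2 → FourOrbit) (k : Fin 2 → ℝ) (i : Fin 2) : ℝ :=
  freeLo (fun j => (Q j).lo) k i

/-- End of the free parameter segment of particle `i`. -/
def parHi (Q : Fin 2 → FourOrbit) (k : Fin 2 → ℝ) (i : Fin 2) : ℝ :=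
  freeHi (fun j => (Q j).hi) k i

/-- The extended action functional over `T_BV ⊗ X_BV`, with the interaction integrals taken along
particle `i`. -/
noncomputable def actionExt (i : Fin 2) (m : Fin 2 → ℝ) (Q : Fin 2 → FourOrbit) (k : Fin 2 → ℝ) :
    ℝ :=
  (∫ s in (parLo Q k (1 - i))..(parHi Q k (1 - i)), localAlong (m (1 - i)) (Q (1 - i)) s) +
  (∫ s in (parLo Q k i)..(parHi Q k i), localAlong (m i) (Q i) s) +
  (∫ s in (Q i).lo..(Q i).hi, interAlong (outerSign i) (Q i) (Q (1 - i)) s) +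
  (∫ s in (parLo Q k i)..(parHi Q k i), interAlong (-outerSign i) (Q i) (Q (1 - i)) s)

/-! ### Variations and critical points -/

/-- Data of a variation `(b⁰, b)` of an orbit, with representatives of the derivatives. -/
structure Variation where
  b0 : ℝ → ℝ
  b : ℝ → E3
  db0 : ℝ → ℝ
  db : ℝ → E3

/-- Admissible variations on `[lo, hi]`: obtained by integration of derivatives of bounded
variation, vanishing at both end points, and extended by zero. -/
structure Variation.IsAdmissible (w : Variation) (lo hi : ℝ) : Prop where
  bv0 : BoundedVariationOn w.db0 (Icc lo hi)
  bv : BoundedVariationOn w.db (Icc lo hi)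
  b0_eq : ∀ s ∈ Icc lo hi, w.b0 s = ∫ r in lo..s, w.db0 r
  b_eq : ∀ s ∈ Icc lo hi, w.b s = ∫ r in lo..s, w.db r
  b0_hi : w.b0 hi = 0
  b_hi : w.b hi = 0
  outside : ∀ s ∉ Icc lo hi, w.b0 s = 0 ∧ w.b s = 0 ∧ w.db0 s = 0 ∧ w.db s = 0

/-- The varied orbit `Q + ε w`. -/
noncomputable def FourOrbit.vary (Q : FourOrbit) (w : Variation) (ε : ℝ) : FourOrbit where
  lo := Q.lo
  hi := Q.hi
  t := fun s => Q.t s + ε * w.b0 s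
  x := fun s => Q.x s + ε • w.b s
  dt := fun s => Q.dt s + ε * w.db0 s
  dx := fun s => Q.dx s + ε • w.db s

/-- The first variation
`δS̃_i(w) = ∫ (∂L̃_i/∂t_i b⁰ + ∂L̃_i/∂x_i · b + ∂L̃_i/∂t_i' b⁰' + ∂L̃_i/∂x_i' · b') ds`
over `[lo, hi]`. -/
noncomputable def firstVariation (m : ℝ) (Qi Qj : FourOrbit) (lo hi : ℝ) (w : Variation) : ℝ :=
  ∫ s in lo..hi, (dtLagExt m Qi Qj s * w.b0 s + inner ℝ (dxLagExt m Qi Qj s) (w.b s) +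
    momentumExt0 m Qi Qj s * w.db0 s + inner ℝ (momentumExt m Qi Qj s) (w.db s))

/-- The orbit of particle `i` is critical: its first variation vanishes for all admissible
variations of its free segment. -/
def IsCriticalFor (m : Fin 2 → ℝ) (Q : Fin 2 → FourOrbit) (k : Fin 2 → ℝ) (i : Fin 2) : Prop :=
  ∀ w : Variation, w.IsAdmissible (parLo Q k i) (parHi Q k i) →
    firstVariation (m i) (Q i) (Q (1 - i)) (parLo Q k i) (parHi Q k i) w = 0

/-- `f` is absolutely continuous on `[a, b]`, up to its values on a countable set (where the values
of derivatives of bounded variation are a matter of convention). -/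
def IsACUpToCountable {F : Type*} [PseudoMetricSpace F] (f : ℝ → F) (a b : ℝ) : Prop :=
  ∃ g : ℝ → F, AbsolutelyContinuousOnInterval g a b ∧
    ∃ N : Set ℝ, N.Countable ∧ ∀ s ∈ Icc a b \ N, f s = g s

/-! Two observations carry the theorem. First, for an orbit of speed at most `κ < 1` the function `τ
- σ |y - x(τ)|` increases at a rate between `1 - κ` and `1 + κ`. The light-cone foot of an event is
therefore unique, and exists as soon as the level lies between the values at the end points. The
foot depends on the event in a Lipschitz way, and along a second sub-luminal orbit it moves forward
at a rate bounded below (`IsConeSeg.exists_isExpanding_coneTime`). Being monotone, the foot map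
preserves bounded variation under composition. Being expanding, it pulls null sets back to null sets
and countable sets back to countable sets, so what holds almost everywhere on orbit `j` holds at the
foot for almost every `s` on orbit `i`. Compactness and the absence of collisions keep the
denominators away from zero.

Second, the derivative of `t_j` at the foot cancels in the extended interaction
(`IsReparam.interLagExt_eq`), which becomes `t' Φ - x' · A` with potentials `Φ`, `A` that depend on
the event and the unparametrised orbit `j` only. The local term is homogeneous of degree one, so the
extended Lagrangian is `t'` times the original one. The action identity is then a change of
variable, and the momenta come from differentiating the square root plus a linear expression. The
two forms of the action agree because the light-cone relation is symmetric up to the sign, and the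
rate of the foot is `t'` times the quotient of the two opposite denominators.

The potentials are differentiable at an event as soon as the velocity of orbit `j` is differentiable
at the foot, hence almost everywhere along orbit `i`. Their derivatives are affine in the
acceleration at the foot with coefficients of bounded variation, hence integrable. When `Q_j'` is
Lipschitz the potentials are Lipschitz, and dominated convergence gives the derivative of the
action.

For critical orbits the du Bois-Reymond argument (`eq_const_add_primitive_of_forall_variation`)
makes each momentum a primitive almost everywhere; bounded variation improves this to all but
countably many points. The redundancy of the time component reflects the homogeneity in `(t', x')`:
the kinetic four-momentum has constant Minkowski square, so contracting the spatial equations with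
`x'` gives `t'` times the time equation. -/

/-! ### Bounded variation and primitives. -/

section RealAnalysis

open Filter
open scoped Topology NNReal ENNReal

/-! ### Functions of bounded variation -/

section BoundedVariation

variable {α E F G : Type*} [LinearOrder α] {s : Set α}

/-- The distance estimate passes to each variation sum term by term. All the closure properties
below that rest on a Lipschitz estimate are instances, with `D = 0` when only one function enters.
-/
theorem BoundedVariationOn.of_dist_le [PseudoMetricSpace E] [PseudoMetricSpace F]
    [PseudoMetricSpace G] {f : α → E} {g : α → F} {h : α → G}
    (hf : BoundedVariationOn f s) (hg : BoundedVariationOn g s) {C D : ℝ} (hC : 0 ≤ C) (hD : 0 ≤ D)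
    (H : ∀ x ∈ s, ∀ y ∈ s, dist (h x) (h y) ≤ C * dist (f x) (f y) + D * dist (g x) (g y)) :
    BoundedVariationOn h s := by
  have key : eVariationOn h s ≤
      ENNReal.ofReal C * eVariationOn f s + ENNReal.ofReal D * eVariationOn g s := by
    apply iSup_le
    rintro ⟨n, ⟨u, hu, us⟩⟩
    calc ∑ i ∈ Finset.range n, edist (h (u (i + 1))) (h (u i))
      _ ≤ ∑ i ∈ Finset.range n, (ENNReal.ofReal C * edist (f (u (i + 1))) (f (u i)) +
            ENNReal.ofReal D * edist (g (u (i + 1))) (g (u i))) := by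
          refine Finset.sum_le_sum fun i _ => ?_
          rw [edist_dist, edist_dist, edist_dist, ← ENNReal.ofReal_mul hC, ← ENNReal.ofReal_mul hD,
            ← ENNReal.ofReal_add (by positivity) (by positivity)]
          exact ENNReal.ofReal_le_ofReal (H _ (us _) _ (us _))
      _ ≤ _ := by
          rw [Finset.sum_add_distrib, ← Finset.mul_sum, ← Finset.mul_sum]
          gcongr
          · exact eVariationOn.sum_le hu us
          · exact eVariationOn.sum_le hu us
  refine ne_top_of_le_ne_top ?_ key
  exact ENNReal.add_ne_top.2 ⟨ENNReal.mul_ne_top ENNReal.ofReal_ne_top hf,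
    ENNReal.mul_ne_top ENNReal.ofReal_ne_top hg⟩

theorem boundedVariationOn_const [PseudoMetricSpace E] (c : E) :
    BoundedVariationOn (fun _ : α => c) s := by
  have : eVariationOn (fun _ : α => c) s = 0 :=
    eVariationOn.constant_on (by rintro _ ⟨_, _, rfl⟩ _ ⟨_, _, rfl⟩; rfl)
  simp [BoundedVariationOn, this]

theorem BoundedVariationOn.congr_on [PseudoMetricSpace E] {f g : α → E}
    (hf : BoundedVariationOn f s) (h : ∀ x ∈ s, g x = f x) : BoundedVariationOn g s := by
  rw [BoundedVariationOn, eVariationOn.congr (show EqOn g f s from h)]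
  exact hf

theorem BoundedVariationOn.fun_add [SeminormedAddCommGroup E] {f g : α → E}
    (hf : BoundedVariationOn f s) (hg : BoundedVariationOn g s) :
    BoundedVariationOn (fun x => f x + g x) s :=
  hf.of_dist_le hg zero_le_one zero_le_one fun x _ y _ => by
    simpa using dist_add_add_le (f x) (g x) (f y) (g y)

theorem BoundedVariationOn.fun_sub [SeminormedAddCommGroup E] {f g : α → E}
    (hf : BoundedVariationOn f s) (hg : BoundedVariationOn g s) :
    BoundedVariationOn (fun x => f x - g x) s :=
  hf.of_dist_le hg zero_le_one zero_le_one fun x _ y _ => by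
    simpa using dist_sub_sub_le (f x) (g x) (f y) (g y)

theorem BoundedVariationOn.fun_neg [SeminormedAddCommGroup E] {f : α → E}
    (hf : BoundedVariationOn f s) : BoundedVariationOn (fun x => -f x) s :=
  hf.of_dist_le hf zero_le_one le_rfl fun x _ y _ => by simp

theorem BoundedVariationOn.fun_norm [SeminormedAddCommGroup E] {f : α → E}
    (hf : BoundedVariationOn f s) : BoundedVariationOn (fun x => ‖f x‖) s :=
  hf.of_dist_le hf zero_le_one le_rfl fun x _ y _ => by
    simpa [dist_eq_norm] using abs_norm_sub_norm_le (f x) (f y)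

theorem BoundedVariationOn.fun_inner [NormedAddCommGroup E] [InnerProductSpace ℝ E] {f g : α → E}
    (hf : BoundedVariationOn f s) (hg : BoundedVariationOn g s) :
    BoundedVariationOn (fun x => inner ℝ (f x) (g x)) s :=
  hf.bilinear_comp hg (innerSL ℝ)

theorem BoundedVariationOn.fun_inv {f : α → ℝ} (hf : BoundedVariationOn f s) {c : ℝ} (hc : 0 < c)
    (h : ∀ x ∈ s, c ≤ f x) : BoundedVariationOn (fun x => (f x)⁻¹) s :=
  hf.of_dist_le hf (C := (c * c)⁻¹) (by positivity) le_rfl fun x hx y hy => by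
    have hx := h x hx
    have hy := h y hy
    have hx0 : 0 < f x := hc.trans_le hx
    have hy0 : 0 < f y := hc.trans_le hy
    rw [zero_mul, add_zero, Real.dist_eq, Real.dist_eq, inv_sub_inv hx0.ne' hy0.ne', abs_div,
      abs_of_pos (mul_pos hx0 hy0), abs_sub_comm, div_eq_inv_mul]
    gcongr

theorem BoundedVariationOn.fun_sqrt {f : α → ℝ} (hf : BoundedVariationOn f s) {c : ℝ} (hc : 0 < c)
    (h : ∀ x ∈ s, c ≤ f x) : BoundedVariationOn (fun x => Real.sqrt (f x)) s :=
  hf.of_dist_le hf (C := (Real.sqrt c)⁻¹) (by positivity) le_rfl fun x hx y hy => by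
    have hx := h x hx
    have hy := h y hy
    have hx0 : 0 < f x := hc.trans_le hx
    have hy0 : 0 < f y := hc.trans_le hy
    have h1 : Real.sqrt c ≤ Real.sqrt (f x) := Real.sqrt_le_sqrt hx
    have h2 : 0 < Real.sqrt c := Real.sqrt_pos.2 hc
    have h3 : 0 < Real.sqrt (f y) := Real.sqrt_pos.2 hy0
    have h4 : f x - f y = (Real.sqrt (f x) - Real.sqrt (f y)) *
        (Real.sqrt (f x) + Real.sqrt (f y)) := by
      ring_nf; rw [Real.sq_sqrt hx0.le, Real.sq_sqrt hy0.le]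
    rw [zero_mul, add_zero, Real.dist_eq, Real.dist_eq, h4, abs_mul,
      abs_of_pos (by linarith : 0 < Real.sqrt (f x) + Real.sqrt (f y)), inv_mul_eq_div,
      le_div_iff₀ h2]
    gcongr
    linarith

theorem BoundedVariationOn.comp_monotoneOn [PseudoMetricSpace E] {β : Type*} [LinearOrder β]
    {f : α → E} (hf : BoundedVariationOn f s) {φ : β → α} {t : Set β} (hφ : MonotoneOn φ t)
    (hst : MapsTo φ t s) : BoundedVariationOn (fun x => f (φ x)) t :=
  ne_top_of_le_ne_top hf (eVariationOn.comp_le_of_monotoneOn f φ hφ hst)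

theorem BoundedVariationOn.exists_norm_le [SeminormedAddCommGroup E] {f : α → E}
    (hf : BoundedVariationOn f s) : ∃ C, 0 < C ∧ ∀ x ∈ s, ‖f x‖ ≤ C := by
  rcases s.eq_empty_or_nonempty with rfl | ⟨x₀, hx₀⟩
  · exact ⟨1, one_pos, by simp⟩
  · refine ⟨‖f x₀‖ + (eVariationOn f s).toReal + 1, by positivity, fun x hx => ?_⟩
    have h1 := hf.dist_le hx hx₀
    have h2 := norm_sub_norm_le (f x) (f x₀)
    rw [dist_eq_norm] at h1
    linarith

end BoundedVariation

theorem LipschitzOnWith.boundedVariationOn_Icc {E : Type*} [PseudoMetricSpace E] {f : ℝ → E}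
    {C : ℝ≥0} {a b : ℝ} (h : LipschitzOnWith C f (Icc a b)) : BoundedVariationOn f (Icc a b) :=
  h.comp_boundedVariationOn (g := id) (fun _ hx => hx) (BoundedVariationOn.id_Icc a b)

/-- The variation function is monotone, so it has countably many discontinuities, and its increments
dominate those of `f`. -/
theorem BoundedVariationOn.countable_not_continuousAt {E : Type*} [PseudoMetricSpace E] {f : ℝ → E}
    {a b : ℝ} (hf : BoundedVariationOn f (Icc a b)) :
    {x ∈ Ioo a b | ¬ ContinuousAt f x}.Countable := by
  rcases lt_or_ge b a with hab | hab
  · simp [Ioo_eq_empty_of_le hab.le]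
  have ha : a ∈ Icc a b := ⟨le_rfl, hab⟩
  have hV := variationOnFromTo.monotoneOn hf.locallyBoundedVariationOn ha
  refine hV.countable_not_continuousWithinAt.mono ?_
  rintro x ⟨hx, hfx⟩
  refine ⟨Ioo_subset_Icc_self hx, fun hc => hfx ?_⟩
  have hc' := hc.continuousAt (Icc_mem_nhds hx.1 hx.2)
  rw [Metric.continuousAt_iff'] at hc' ⊢
  intro ε hε
  filter_upwards [hc' ε hε, Icc_mem_nhds hx.1 hx.2] with y hy hyI
  refine lt_of_le_of_lt ?_ hy
  have hxI := Ioo_subset_Icc_self hx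
  have hadd := variationOnFromTo.sub_right hf.locallyBoundedVariationOn ha hxI hyI
  rw [Real.dist_eq]
  have e1 : variationOnFromTo f (Icc a b) a y - variationOnFromTo f (Icc a b) a x =
      variationOnFromTo f (Icc a b) x y := by
    have := variationOnFromTo.add hf.locallyBoundedVariationOn ha hxI hyI
    linarith
  rw [e1]
  have key : ∀ u ∈ Icc a b, ∀ v ∈ Icc a b, u ≤ v →
      dist (f u) (f v) ≤ variationOnFromTo f (Icc a b) u v := by
    intro u hu v hv huv
    rw [variationOnFromTo.eq_of_le _ _ huv]
    exact (hf.mono inter_subset_left).dist_le ⟨hu, le_rfl, huv⟩ ⟨hv, huv, le_rfl⟩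
  rcases le_total x y with h | h
  · rw [dist_comm]; exact (key x hxI y hyI h).trans (le_abs_self _)
  · rw [variationOnFromTo.eq_neg_swap, abs_neg]
    exact (key y hyI x hxI h).trans (le_abs_self _)

theorem BoundedVariationOn.intervalIntegrable_real {f : ℝ → ℝ} {a b : ℝ} (hab : a ≤ b)
    (hf : BoundedVariationOn f (Icc a b)) : IntervalIntegrable f volume a b := by
  rw [← uIcc_of_le hab] at hf
  obtain ⟨p, q, hp, hq, rfl⟩ := hf.locallyBoundedVariationOn.exists_monotoneOn_sub_monotoneOn
  exact hp.intervalIntegrable.sub hq.intervalIntegrable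

/-- A vector of `E3` expanded in the standard basis. -/
theorem E3.eq_sum (v : E3) : v = ∑ k : Fin 3, v k • EuclideanSpace.single k (1 : ℝ) := by
  ext j
  simp [Finset.sum_apply, Pi.single_apply]

theorem intervalIntegrable_of_coord {f : ℝ → E3} {a b : ℝ}
    (h : ∀ k, IntervalIntegrable (fun s => f s k) volume a b) :
    IntervalIntegrable f volume a b := by
  have e : f = fun s => ∑ k : Fin 3, f s k • EuclideanSpace.single k (1 : ℝ) :=
    funext fun s => E3.eq_sum _
  rw [e]
  simp only [Fin.sum_univ_three]
  have h' : ∀ k, IntervalIntegrable (fun s => f s k • (EuclideanSpace.single k (1 : ℝ) : E3))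
      volume a b := fun k =>
    ⟨Integrable.smul_const (h k).1 _, Integrable.smul_const (h k).2 _⟩
  exact ((h' 0).add (h' 1)).add (h' 2)

theorem E3.norm_coord_le (v : E3) (k : Fin 3) : |v k| ≤ ‖v‖ := by
  simpa using PiLp.norm_apply_le v k

theorem BoundedVariationOn.coord {α : Type*} [LinearOrder α] {s : Set α} {f : α → E3}
    (hf : BoundedVariationOn f s) (k : Fin 3) : BoundedVariationOn (fun x => f x k) s :=
  hf.of_dist_le hf zero_le_one le_rfl fun x _ y _ => by
    simpa [dist_eq_norm] using E3.norm_coord_le (f x - f y) k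

theorem BoundedVariationOn.intervalIntegrable_E3 {f : ℝ → E3} {a b : ℝ} (hab : a ≤ b)
    (hf : BoundedVariationOn f (Icc a b)) : IntervalIntegrable f volume a b :=
  intervalIntegrable_of_coord fun k => (hf.coord k).intervalIntegrable_real hab

theorem BoundedVariationOn.ae_differentiableAt_Icc {V : Type*} [NormedAddCommGroup V]
    [NormedSpace ℝ V] [FiniteDimensional ℝ V] {f : ℝ → V} {a b : ℝ} (hab : a ≤ b)
    (hf : BoundedVariationOn f (Icc a b)) : ∀ᵐ x, x ∈ Icc a b → DifferentiableAt ℝ f x := by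
  rw [← uIcc_of_le hab] at hf ⊢
  exact hf.ae_differentiableAt_of_mem_uIcc

/-- The scalar result applies to each coordinate. Derivative and coordinate commute only where `f`
is differentiable, which is almost everywhere. -/
theorem BoundedVariationOn.intervalIntegrable_deriv_E3 {f : ℝ → E3} {a b : ℝ} (hab : a ≤ b)
    (hf : BoundedVariationOn f (Icc a b)) : IntervalIntegrable (deriv f) volume a b := by
  refine intervalIntegrable_of_coord fun k => ?_
  have h1 : BoundedVariationOn (fun x => f x k) (uIcc a b) := by
    rw [uIcc_of_le hab]; exact hf.coord k
  refine h1.intervalIntegrable_deriv.congr_ae ?_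
  rw [EventuallyEq, ae_restrict_iff' measurableSet_uIoc]
  filter_upwards [hf.ae_differentiableAt_Icc hab] with x hx hxI
  have h2 := hx (by rw [← uIcc_of_le hab]; exact uIoc_subset_uIcc hxI)
  have h3 := ((EuclideanSpace.proj k : E3 →L[ℝ] ℝ).hasFDerivAt.comp_hasDerivAt x h2.hasDerivAt)
  exact h3.deriv

/-! ### Primitives of functions of bounded variation -/

section Primitive

variable {E : Type*} [NormedAddCommGroup E] [NormedSpace ℝ E] {f f' : ℝ → E} {a b : ℝ}

theorem sub_eq_integral_of_primitive (hf' : IntervalIntegrable f' volume a b)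
    (h : ∀ s ∈ Icc a b, f s = f a + ∫ r in a..s, f' r) {s s' : ℝ} (hs : s ∈ Icc a b)
    (hs' : s' ∈ Icc a b) : f s' - f s = ∫ r in s..s', f' r := by
  have hab : a ≤ b := hs.1.trans hs.2
  have h1 : IntervalIntegrable f' volume a s := hf'.mono_set (by
    rw [uIcc_of_le hs.1, uIcc_of_le hab]; exact Icc_subset_Icc le_rfl hs.2)
  have h2 : IntervalIntegrable f' volume a s' := hf'.mono_set (by
    rw [uIcc_of_le hs'.1, uIcc_of_le hab]; exact Icc_subset_Icc le_rfl hs'.2)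
  rw [h s hs, h s' hs', add_sub_add_left_eq_sub, intervalIntegral.integral_interval_sub_left h2 h1]

/-- Together with the countability of discontinuities, this makes the chosen representative the true
derivative off a countable set. -/
theorem hasDerivAt_of_primitive [CompleteSpace E] (hf' : IntervalIntegrable f' volume a b)
    (h : ∀ s ∈ Icc a b, f s = f a + ∫ r in a..s, f' r) {s : ℝ} (hs : s ∈ Ioo a b)
    (hc : ContinuousAt f' s) : HasDerivAt f (f' s) s := by
  have hab : a ≤ b := (hs.1.trans hs.2).le
  have h1 : IntervalIntegrable f' volume a s := hf'.mono_set (by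
    rw [uIcc_of_le hs.1.le, uIcc_of_le hab]; exact Icc_subset_Icc le_rfl hs.2.le)
  have hm : StronglyMeasurableAtFilter f' (𝓝 s) volume := by
    refine ⟨Ioc a b, Ioc_mem_nhds hs.1 hs.2, ?_⟩
    exact ((intervalIntegrable_iff_integrableOn_Ioc_of_le hab).1 hf').aestronglyMeasurable
  have h2 := (intervalIntegral.integral_hasDerivAt_right h1 hm hc).const_add (f a)
  refine h2.congr_of_eventuallyEq ?_
  filter_upwards [Icc_mem_nhds hs.1 hs.2] with y hy using h y hy

theorem dist_le_of_primitive (hf' : IntervalIntegrable f' volume a b)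
    (h : ∀ s ∈ Icc a b, f s = f a + ∫ r in a..s, f' r) {C : ℝ} (hC : ∀ s ∈ Icc a b, ‖f' s‖ ≤ C)
    {s s' : ℝ} (hs : s ∈ Icc a b) (hs' : s' ∈ Icc a b) : ‖f s' - f s‖ ≤ C * |s' - s| := by
  rw [sub_eq_integral_of_primitive hf' h hs hs']
  refine intervalIntegral.norm_integral_le_of_norm_le_const fun r hr => hC r ?_
  exact (uIcc_subset_Icc hs hs') (uIoc_subset_uIcc hr)

theorem le_sub_of_primitive {f f' : ℝ → ℝ} (hf' : IntervalIntegrable f' volume a b)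
    (h : ∀ s ∈ Icc a b, f s = f a + ∫ r in a..s, f' r) {c : ℝ} (hc : ∀ s ∈ Icc a b, c ≤ f' s)
    {s s' : ℝ} (hs : s ∈ Icc a b) (hs' : s' ∈ Icc a b) (hss : s ≤ s') :
    c * (s' - s) ≤ f s' - f s := by
  rw [sub_eq_integral_of_primitive hf' h hs hs']
  have h1 : IntervalIntegrable f' volume s s' := hf'.mono_set (by
    rw [uIcc_of_le hss, uIcc_of_le (hs.1.trans hs.2)]; exact Icc_subset_Icc hs.1 hs'.2)
  have := intervalIntegral.integral_mono_on hss (intervalIntegrable_const (c := c)) h1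
    fun r hr => hc r ⟨hs.1.trans hr.1, hr.2.trans hs'.2⟩
  simpa [mul_comm] using this

end Primitive

end RealAnalysis

/-! ### Changes of variable, absolute continuity and the du Bois-Reymond lemma. -/

section Substitution

open Filter
open scoped Topology NNReal ENNReal

/-! ### Increasing changes of variable -/

/-- `φ` is continuous on `[a, b]` and its difference quotients are bounded below by `c > 0`. -/
structure IsExpanding (φ : ℝ → ℝ) (a b c : ℝ) : Prop where
  le : a ≤ b
  pos : 0 < c
  cont : ContinuousOn φ (Icc a b)
  lower : ∀ s ∈ Icc a b, ∀ s' ∈ Icc a b, s ≤ s' → c * (s' - s) ≤ φ s' - φ s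

namespace IsExpanding

variable {φ : ℝ → ℝ} {a b c : ℝ}

theorem strictMonoOn (h : IsExpanding φ a b c) : StrictMonoOn φ (Icc a b) := fun s hs s' hs' hss => by
  have h1 := h.lower s hs s' hs' hss.le
  have h2 := mul_pos h.pos (sub_pos.2 hss)
  linarith

theorem mapsTo (h : IsExpanding φ a b c) : MapsTo φ (Icc a b) (Icc (φ a) (φ b)) := fun _ hs =>
  ⟨h.strictMonoOn.monotoneOn ⟨le_rfl, h.le⟩ hs hs.1,
    h.strictMonoOn.monotoneOn hs ⟨h.le, le_rfl⟩ hs.2⟩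

theorem mapsTo_Ioo (h : IsExpanding φ a b c) : MapsTo φ (Ioo a b) (Ioo (φ a) (φ b)) := fun _ hs =>
  ⟨h.strictMonoOn ⟨le_rfl, h.le⟩ (Ioo_subset_Icc_self hs) hs.1,
    h.strictMonoOn (Ioo_subset_Icc_self hs) ⟨h.le, le_rfl⟩ hs.2⟩

theorem image_Icc (h : IsExpanding φ a b c) : φ '' Icc a b = Icc (φ a) (φ b) :=
  Subset.antisymm (image_subset_iff.2 h.mapsTo) (intermediate_value_Icc h.le h.cont)

theorem mono (h : IsExpanding φ a b c) {a' b' : ℝ} (hab : a' ≤ b') (ha : a ≤ a') (hb : b' ≤ b) :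
    IsExpanding φ a' b' c :=
  ⟨hab, h.pos, h.cont.mono (Icc_subset_Icc ha hb), fun s hs s' hs' =>
    h.lower s (Icc_subset_Icc ha hb hs) s' (Icc_subset_Icc ha hb hs')⟩

/-- The inverse of `φ` is `c⁻¹`-Lipschitz, and a Lipschitz map enlarges one-dimensional Hausdorff
measure, which is Lebesgue measure, at most by its constant. `N` need not be measurable. -/
theorem volume_preimage_le (h : IsExpanding φ a b c) (N : Set ℝ) :
    volume (Icc a b ∩ φ ⁻¹' N) ≤ ENNReal.ofReal c⁻¹ * volume N := by
  let ψ := Function.invFunOn φ (Icc a b)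
  have hψ : ∀ s ∈ Icc a b, ψ (φ s) = s := fun s hs =>
    h.strictMonoOn.injOn.leftInvOn_invFunOn hs
  have hL : LipschitzOnWith (Real.toNNReal c⁻¹) ψ (φ '' Icc a b) := by
    refine LipschitzOnWith.of_dist_le_mul ?_
    rintro _ ⟨s, hs, rfl⟩ _ ⟨s', hs', rfl⟩
    rw [hψ s hs, hψ s' hs', Real.coe_toNNReal _ (inv_nonneg.2 h.pos.le), inv_mul_eq_div,
      le_div_iff₀ h.pos, Real.dist_eq, Real.dist_eq]
    rcases le_total s s' with hss | hss
    · have := h.lower s hs s' hs' hss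
      rw [abs_sub_comm, abs_of_nonneg (sub_nonneg.2 hss), abs_sub_comm (φ s)]
      exact (by linarith : _ ≤ φ s' - φ s).trans (le_abs_self _)
    · have := h.lower s' hs' s hs hss
      rw [abs_of_nonneg (sub_nonneg.2 hss)]
      exact (by linarith : _ ≤ φ s - φ s').trans (le_abs_self _)
  have hsub : Icc a b ∩ φ ⁻¹' N ⊆ ψ '' (N ∩ φ '' Icc a b) := by
    rintro s ⟨hs, hN⟩
    exact ⟨φ s, ⟨hN, s, hs, rfl⟩, hψ s hs⟩
  have h1 := (hL.mono (inter_subset_right : N ∩ φ '' Icc a b ⊆ _)).hausdorffMeasure_image_le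
    (d := 1) zero_le_one
  rw [hausdorffMeasure_real, ENNReal.rpow_one] at h1
  refine (measure_mono hsub).trans (h1.trans ?_)
  exact mul_le_mul_right (measure_mono inter_subset_left) _

/-- This transfers almost-everywhere statements on one orbit to light-cone feet of the other. -/
theorem ae_comp (h : IsExpanding φ a b c) {p : ℝ → Prop}
    (hp : ∀ᵐ r, r ∈ Icc (φ a) (φ b) → p r) : ∀ᵐ s, s ∈ Icc a b → p (φ s) := by
  rw [ae_iff] at hp ⊢
  have := h.volume_preimage_le {r | ¬ (r ∈ Icc (φ a) (φ b) → p r)}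
  rw [hp, mul_zero] at this
  refine measure_mono_null (fun s hs => ?_) (nonpos_iff_eq_zero.1 this)
  have hs' := Classical.not_imp.1 hs
  exact ⟨hs'.1, fun hc => hs'.2 (hc (h.mapsTo hs'.1))⟩

/-- The push-forward of Lebesgue measure under `φ` is at most `c⁻¹` times Lebesgue measure on the
image interval. -/
theorem intervalIntegrable_comp {E : Type*} [NormedAddCommGroup E] (h : IsExpanding φ a b c)
    {g : ℝ → E} (hg : IntervalIntegrable g volume (φ a) (φ b)) :
    IntervalIntegrable (fun s => g (φ s)) volume a b := by
  have hle : φ a ≤ φ b := h.strictMonoOn.monotoneOn ⟨le_rfl, h.le⟩ ⟨h.le, le_rfl⟩ h.le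
  rw [intervalIntegrable_iff_integrableOn_Icc_of_le hle] at hg
  rw [intervalIntegrable_iff_integrableOn_Icc_of_le h.le]
  have hm : AEMeasurable φ (volume.restrict (Icc a b)) := h.cont.aemeasurable measurableSet_Icc
  have hmap : Measure.map φ (volume.restrict (Icc a b)) ≤
      ENNReal.ofReal c⁻¹ • volume.restrict (Icc (φ a) (φ b)) := by
    refine Measure.le_iff.2 fun N hN => ?_
    rw [Measure.map_apply_of_aemeasurable hm hN, Measure.smul_apply, smul_eq_mul,
      Measure.restrict_apply hN]
    have e : (volume.restrict (Icc a b)) (φ ⁻¹' N) = volume (Icc a b ∩ φ ⁻¹' N) := by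
      rw [Measure.restrict_apply' measurableSet_Icc, inter_comm]
    rw [e]
    refine (measure_mono ?_).trans (h.volume_preimage_le (N ∩ Icc (φ a) (φ b)))
    exact fun s hs => ⟨hs.1, hs.2, h.mapsTo hs.1⟩
  have h1 : Integrable g (Measure.map φ (volume.restrict (Icc a b))) :=
    (hg.smul_measure ENNReal.ofReal_ne_top).mono_measure hmap
  exact h1.comp_aemeasurable hm

/-- The change-of-variables formula for injective maps is applied off `N` and the end points. It
holds for every `g`, integrable or not. -/
theorem integral_comp {E : Type*} [NormedAddCommGroup E] [NormedSpace ℝ E]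
    (h : IsExpanding φ a b c) {φ' : ℝ → ℝ} {N : Set ℝ} (hN : N.Countable)
    (hd : ∀ s ∈ Ioo a b \ N, HasDerivAt φ (φ' s) s) (g : ℝ → E) :
    ∫ s in a..b, φ' s • g (φ s) = ∫ r in (φ a)..(φ b), g r := by
  have hle : φ a ≤ φ b := h.strictMonoOn.monotoneOn ⟨le_rfl, h.le⟩ ⟨h.le, le_rfl⟩ h.le
  set S := Ioo a b \ N
  have hS : S ⊆ Icc a b := fun s hs => Ioo_subset_Icc_self hs.1
  have hpos : ∀ s ∈ S, 0 ≤ φ' s := by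
    intro s hs
    have h1 := (hd s hs).hasDerivWithinAt (s := Ioi s)
    rw [hasDerivWithinAt_iff_tendsto_slope' (by simp)] at h1
    refine ge_of_tendsto h1 ?_
    filter_upwards [Ioo_mem_nhdsGT hs.1.2] with y hy
    rw [slope_def_field]
    have := h.strictMonoOn (hS hs) ⟨hs.1.1.le.trans hy.1.le, hy.2.le⟩ hy.1
    exact div_nonneg (by linarith) (by linarith [hy.1])
  have key := integral_image_eq_integral_abs_deriv_smul (f := φ) (f' := φ') (s := S)
    (measurableSet_Ioo.diff hN.measurableSet) (fun s hs => (hd s hs).hasDerivWithinAt)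
    (h.strictMonoOn.injOn.mono hS) g
  -- The image of the discarded countable set is countable, hence null as well.
  have e1 : (volume.restrict (φ '' S)) = volume.restrict (Ioc (φ a) (φ b)) := by
    refine Measure.restrict_congr_set ?_
    have hc : (φ '' (N ∪ {a, b})).Countable := (hN.union (by simp)).image _
    refine ae_eq_set.2 ⟨?_, ?_⟩
    · refine measure_mono_null ?_ (measure_empty (μ := volume))
      rintro _ ⟨⟨s, hs, rfl⟩, h2⟩
      have := h.mapsTo_Ioo hs.1
      exact h2 ⟨this.1, this.2.le⟩
    · refine measure_mono_null ?_ (hc.measure_zero volume)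
      rintro r ⟨hr, h2⟩
      obtain ⟨s, hs, rfl⟩ : r ∈ φ '' Icc a b := by
        rw [h.image_Icc]; exact Ioc_subset_Icc_self hr
      refine ⟨s, ?_, rfl⟩
      by_contra hsN
      simp only [mem_union, mem_insert_iff, mem_singleton_iff, not_or] at hsN
      exact h2 ⟨s, ⟨⟨lt_of_le_of_ne hs.1 (Ne.symm hsN.2.1), lt_of_le_of_ne hs.2 hsN.2.2⟩, hsN.1⟩,
        rfl⟩
  have e2 : (volume.restrict S) = volume.restrict (Ioc a b) := by
    rw [← restrict_Ioo_eq_restrict_Ioc]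
    exact Measure.restrict_congr_set (sdiff_null_ae_eq_self (hN.measure_zero volume))
  rw [intervalIntegral.integral_of_le hle, intervalIntegral.integral_of_le h.le, ← e1, ← e2, key]
  refine (setIntegral_congr_fun (measurableSet_Ioo.diff hN.measurableSet) fun s hs => ?_).symm
  rw [abs_of_nonneg (hpos s hs)]

end IsExpanding

/-! ### Absolute continuity -/

/-- Monotonicity keeps disjoint intervals disjoint, and the Lipschitz bound controls their total
length. -/
theorem AbsolutelyContinuousOnInterval.comp_monotoneOn {E : Type*} [PseudoMetricSpace E] {g : ℝ → E}
    {φ : ℝ → ℝ} {a b : ℝ} (hab : a ≤ b) (hg : AbsolutelyContinuousOnInterval g (φ a) (φ b))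
    (hm : MonotoneOn φ (Icc a b)) {K : ℝ≥0} (hL : LipschitzOnWith K φ (Icc a b)) :
    AbsolutelyContinuousOnInterval (fun s => g (φ s)) a b := by
  rw [absolutelyContinuousOnInterval_iff] at hg ⊢
  intro ε hε
  obtain ⟨δ, hδ, H⟩ := hg ε hε
  -- Dividing by `K + 1` covers `K = 0` and leaves a strict inequality at the end.
  refine ⟨δ / (K + 1), by positivity, fun E hE hlen => ?_⟩
  have hle : φ a ≤ φ b := hm ⟨le_rfl, hab⟩ ⟨hab, le_rfl⟩ hab
  have hmem : ∀ i ∈ Finset.range E.1, (E.2 i).1 ∈ Icc a b ∧ (E.2 i).2 ∈ Icc a b := by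
    have := hE.1
    rwa [uIcc_of_le hab] at this
  refine H ⟨E.1, fun i => (φ (E.2 i).1, φ (E.2 i).2)⟩ ⟨?_, ?_⟩ ?_
  · intro i hi
    rw [uIcc_of_le hle]
    obtain ⟨h1, h2⟩ := hmem i hi
    exact ⟨⟨hm ⟨le_rfl, hab⟩ h1 h1.1, hm h1 ⟨hab, le_rfl⟩ h1.2⟩,
      ⟨hm ⟨le_rfl, hab⟩ h2 h2.1, hm h2 ⟨hab, le_rfl⟩ h2.2⟩⟩
  · intro i hi j hj hij
    have hd := hE.2 hi hj hij
    obtain ⟨hi1, hi2⟩ := hmem i (by simpa using hi)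
    obtain ⟨hj1, hj2⟩ := hmem j (by simpa using hj)
    simp only [Function.onFun] at hd ⊢
    rw [Set.disjoint_left] at hd ⊢
    intro z hz hz'
    simp only [uIoc, mem_Ioc] at hz hz' hd
    have hmax : ∀ {u v : ℝ}, u ∈ Icc a b → v ∈ Icc a b → φ (max u v) = max (φ u) (φ v) :=
      fun hu hv => hm.map_max hu hv
    have hmin : ∀ {u v : ℝ}, u ∈ Icc a b → v ∈ Icc a b → φ (min u v) = min (φ u) (φ v) :=
      fun hu hv => hm.map_min hu hv
    have mmax : ∀ {u v : ℝ}, u ∈ Icc a b → v ∈ Icc a b → max u v ∈ Icc a b := fun hu hv =>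
      ⟨hu.1.trans (le_max_left _ _), max_le hu.2 hv.2⟩
    have mmin : ∀ {u v : ℝ}, u ∈ Icc a b → v ∈ Icc a b → min u v ∈ Icc a b := fun hu hv =>
      ⟨le_min hu.1 hv.1, (min_le_left _ _).trans hu.2⟩
    rw [← hmin hi1 hi2, ← hmax hi1 hi2] at hz
    rw [← hmin hj1 hj2, ← hmax hj1 hj2] at hz'
    have lt_of : ∀ {u v : ℝ}, u ∈ Icc a b → v ∈ Icc a b → φ u < φ v → u < v := fun hu hv h =>
      lt_of_not_ge fun h' => absurd (hm hv hu h') (not_le.2 h)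
    -- A common point of the image intervals forces the original intervals to overlap; the smaller
    -- of their right end points lies in both.
    refine hd (a := min (max (E.2 i).1 (E.2 i).2) (max (E.2 j).1 (E.2 j).2))
      ⟨lt_min ?_ ?_, min_le_left _ _⟩ ⟨lt_min ?_ ?_, min_le_right _ _⟩
    · exact lt_of (mmin hi1 hi2) (mmax hi1 hi2) (hz.1.trans_le hz.2)
    · exact lt_of (mmin hi1 hi2) (mmax hj1 hj2) (hz.1.trans_le hz'.2)
    · exact lt_of (mmin hj1 hj2) (mmax hi1 hi2) (hz'.1.trans_le hz.2)
    · exact lt_of (mmin hj1 hj2) (mmax hj1 hj2) (hz'.1.trans_le hz'.2)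
  · calc ∑ i ∈ Finset.range E.1, dist (φ (E.2 i).1) (φ (E.2 i).2)
      _ ≤ ∑ i ∈ Finset.range E.1, K * dist (E.2 i).1 (E.2 i).2 :=
          Finset.sum_le_sum fun i hi => hL.dist_le_mul _ (hmem i hi).1 _ (hmem i hi).2
      _ = K * ∑ i ∈ Finset.range E.1, dist (E.2 i).1 (E.2 i).2 := by rw [Finset.mul_sum]
      _ ≤ K * (δ / (K + 1)) := by gcongr
      _ < δ := by
          rw [← mul_div_assoc, div_lt_iff₀ (by positivity)]
          nlinarith [K.coe_nonneg]

theorem AbsolutelyContinuousOnInterval.of_coord {g : ℝ → E3} {a b : ℝ}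
    (h : ∀ k, AbsolutelyContinuousOnInterval (fun s => g s k) a b) :
    AbsolutelyContinuousOnInterval g a b := by
  have hk : ∀ k, AbsolutelyContinuousOnInterval
      (fun s => g s k • (EuclideanSpace.single k (1 : ℝ) : E3)) a b := fun k =>
    (h k).smul (LipschitzWith.const (α := ℝ)
      (EuclideanSpace.single k (1 : ℝ) : E3)).lipschitzOnWith.absolutelyContinuousOnInterval
  have e : g = (fun s => g s 0 • (EuclideanSpace.single 0 (1 : ℝ) : E3)) +
      (fun s => g s 1 • (EuclideanSpace.single 1 (1 : ℝ) : E3)) +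
      (fun s => g s 2 • (EuclideanSpace.single 2 (1 : ℝ) : E3)) := by
    funext s
    conv_lhs => rw [E3.eq_sum (g s), Fin.sum_univ_three]
    rfl
  rw [e]
  exact ((hk 0).add (hk 1)).add (hk 2)

/-! ### The fundamental lemma of the calculus of variations -/

theorem frequently_notMem_of_countable {N : Set ℝ} (hN : N.Countable) (s : ℝ) :
    ∃ᶠ y in 𝓝[≠] s, y ∉ N := by
  have h1 : s ∈ closure (N ∪ {s})ᶜ := (hN.union (by simp)).dense_compl ℝ s
  rw [mem_closure_iff_frequently] at h1
  rw [frequently_nhdsWithin_iff]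
  refine h1.mono fun y hy => ?_
  simp only [mem_compl_iff, mem_union, mem_singleton_iff, not_or] at hy
  exact ⟨hy.1, hy.2⟩

theorem eq_of_eqOn_compl_countable {E : Type*} [NormedAddCommGroup E] {p g : ℝ → E} {a b s : ℝ}
    {N : Set ℝ} (hN : N.Countable) (hs : s ∈ Ioo a b) (h : ∀ r ∈ Icc a b \ N, p r = g r)
    (hp : ContinuousAt p s) (hg : ContinuousAt g s) : p s = g s := by
  have h1 : Tendsto (fun y => p y - g y) (𝓝[≠] s) (𝓝 (p s - g s)) :=
    (hp.sub hg).tendsto.mono_left nhdsWithin_le_nhds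
  have h2 : ∃ᶠ y in 𝓝[≠] s, p y - g y ∈ ({0} : Set E) := by
    refine ((frequently_notMem_of_countable hN s).and_eventually
      (mem_nhdsWithin_of_mem_nhds (Icc_mem_nhds hs.1 hs.2))).mono fun y hy => ?_
    rw [mem_singleton_iff, sub_eq_zero]
    exact h y ⟨hy.2, hy.1⟩
  exact sub_eq_zero.1 (isClosed_singleton.mem_of_frequently_of_tendsto h2 h1)

/-- The points outside `N` accumulate at `s`, and the slopes of `p - g` vanish along them. -/
theorem deriv_eq_of_eqOn_compl_countable {E : Type*} [NormedAddCommGroup E] [NormedSpace ℝ E]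
    {p g : ℝ → E} {p' g' : E} {a b s : ℝ}
    {N : Set ℝ} (hN : N.Countable) (hs : s ∈ Ioo a b) (h : ∀ r ∈ Icc a b \ N, p r = g r)
    (hp : HasDerivAt p p' s) (hg : HasDerivAt g g' s) : p' = g' := by
  have h0 := eq_of_eqOn_compl_countable hN hs h hp.continuousAt hg.continuousAt
  have h1 := (hp.sub hg).tendsto_slope
  have h2 : ∃ᶠ y in 𝓝[≠] s, slope (p - g) s y ∈ ({0} : Set E) := by
    refine ((frequently_notMem_of_countable hN s).and_eventually
      (mem_nhdsWithin_of_mem_nhds (Icc_mem_nhds hs.1 hs.2))).mono fun y hy => ?_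
    simp [slope_def_module, h0, h y ⟨hy.2, hy.1⟩]
  exact sub_eq_zero.1 (isClosed_singleton.mem_of_frequently_of_tendsto h2 h1)

/-- The du Bois-Reymond lemma. With `G` the primitive of `f`, the admissible derivative `p - G - c`
is itself the test function: integration by parts turns the hypothesis into the vanishing of the
integral of its square. Bounded variation then upgrades "almost everywhere" to "off a countable
set". -/
theorem eq_const_add_primitive_of_forall_variation {f p : ℝ → ℝ} {a b : ℝ} (hab : a < b)
    (hf : IntervalIntegrable f volume a b) (hp : BoundedVariationOn p (Icc a b))
    (H : ∀ β dβ : ℝ → ℝ, BoundedVariationOn dβ (Icc a b) →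
      (∀ s ∈ Icc a b, β s = ∫ r in a..s, dβ r) → β b = 0 →
      (∀ s ∉ Icc a b, β s = 0 ∧ dβ s = 0) →
      ∫ s in a..b, (f s * β s + p s * dβ s) = 0) :
    ∃ c : ℝ, ∃ N : Set ℝ, N.Countable ∧ ∀ s ∈ Icc a b \ N, p s = c + ∫ r in a..s, f r := by
  set G : ℝ → ℝ := fun s => ∫ r in a..s, f r with hG
  have hGac : AbsolutelyContinuousOnInterval G a b :=
    hf.absolutelyContinuousOnInterval_intervalIntegral left_mem_uIcc
  have hGbv : BoundedVariationOn G (Icc a b) := by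
    rw [← uIcc_of_le hab.le]; exact hGac.boundedVariationOn
  -- `c` is the mean value of `p - G`, which makes the test function vanish at `b`.
  set c : ℝ := (∫ s in a..b, (p s - G s)) / (b - a) with hc
  have hq : BoundedVariationOn (fun s => p s - G s - c) (Icc a b) :=
    (hp.fun_sub hGbv).fun_sub (boundedVariationOn_const c)
  set dβ : ℝ → ℝ := (Icc a b).indicator (fun s => p s - G s - c) with hdβ
  have hdβbv : BoundedVariationOn dβ (Icc a b) :=
    hq.congr_on fun x hx => indicator_of_mem hx _
  have hdβi : IntervalIntegrable dβ volume a b := hdβbv.intervalIntegrable_real hab.le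
  set β : ℝ → ℝ := (Icc a b).indicator (fun s => ∫ r in a..s, dβ r) with hβ
  have hβeq : ∀ s ∈ Icc a b, β s = ∫ r in a..s, dβ r := fun s hs => indicator_of_mem hs _
  have hβb : β b = 0 := by
    rw [hβeq b ⟨hab.le, le_rfl⟩]
    have : ∫ r in a..b, dβ r = ∫ r in a..b, ((p r - G r) - c) := by
      refine intervalIntegral.integral_congr fun r hr => ?_
      rw [uIcc_of_le hab.le] at hr
      exact indicator_of_mem hr _
    rw [this, intervalIntegral.integral_sub ((hp.fun_sub hGbv).intervalIntegrable_real hab.le)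
      intervalIntegrable_const, intervalIntegral.integral_const, hc, smul_eq_mul,
      mul_div_cancel₀ _ (sub_pos.2 hab).ne', sub_self]
  have h0 := H β dβ hdβbv hβeq hβb fun s hs =>
    ⟨indicator_of_notMem hs _, indicator_of_notMem hs _⟩
  have hBac : AbsolutelyContinuousOnInterval (fun s => ∫ r in a..s, dβ r) a b :=
    hdβi.absolutelyContinuousOnInterval_intervalIntegral left_mem_uIcc
  have hparts := hGac.integral_deriv_mul_eq_sub hBac
  have hβb' : ∫ r in a..b, dβ r = 0 := by rw [← hβeq b ⟨hab.le, le_rfl⟩, hβb]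
  -- The integrand is almost everywhere the derivative of `G β`, and `β` vanishes at both ends.
  have hparts' : ∫ s in a..b, (f s * β s + G s * dβ s) = 0 := by
    have e : ∫ s in a..b, (f s * β s + G s * dβ s) =
        ∫ x in a..b, deriv G x * (∫ r in a..x, dβ r) +
          G x * deriv (fun s => ∫ r in a..s, dβ r) x := by
      refine intervalIntegral.integral_congr_ae ?_
      filter_upwards [hf.ae_hasDerivAt_integral, hdβi.ae_hasDerivAt_integral] with x h1 h2 hx
      have hx' := uIoc_subset_uIcc hx
      rw [(h1 hx' a left_mem_uIcc).deriv, (h2 hx' a left_mem_uIcc).deriv, hβeq x]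
      rwa [uIcc_of_le hab.le] at hx'
    rw [e, hparts, hβb']
    simp [hG]
  have hβc : ContinuousOn β (uIcc a b) := by
    refine hBac.continuousOn.congr fun s hs => ?_
    rw [uIcc_of_le hab.le] at hs
    exact hβeq s hs
  have hfβ : IntervalIntegrable (fun s => f s * β s) volume a b := hf.mul_continuousOn hβc
  have hpd : IntervalIntegrable (fun s => p s * dβ s) volume a b :=
    (hp.fun_mul hdβbv).intervalIntegrable_real hab.le
  have hGd : IntervalIntegrable (fun s => G s * dβ s) volume a b :=
    (hGbv.fun_mul hdβbv).intervalIntegrable_real hab.le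
  have hsq : ∫ s in a..b, dβ s * dβ s = 0 := by
    have e : ∫ s in a..b, dβ s * dβ s = ∫ s in a..b, ((f s * β s + p s * dβ s) -
        (f s * β s + G s * dβ s) - c * dβ s) := by
      refine intervalIntegral.integral_congr fun s hs => ?_
      rw [uIcc_of_le hab.le] at hs
      have : dβ s = p s - G s - c := indicator_of_mem hs _
      rw [this]; ring
    rw [e, intervalIntegral.integral_sub ((hfβ.add hpd).sub (hfβ.add hGd)) (hdβi.const_mul c),
      intervalIntegral.integral_sub (hfβ.add hpd) (hfβ.add hGd), h0, hparts',
      intervalIntegral.integral_const_mul, hβb']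
    simp
  have hae : ∀ᵐ s, s ∈ Ioc a b → dβ s * dβ s = 0 := by
    rw [intervalIntegral.integral_eq_zero_iff_of_le_of_nonneg_ae hab.le
      (Eventually.of_forall fun s => mul_self_nonneg _)
      ((hdβbv.fun_mul hdβbv).intervalIntegrable_real hab.le)] at hsq
    rw [← ae_restrict_iff' measurableSet_Ioc]
    exact hsq
  -- At a point of continuity a nonzero value would persist on a neighbourhood, against vanishing
  -- almost everywhere; only discontinuities and end points are excepted.
  refine ⟨c, {x ∈ Ioo a b | ¬ ContinuousAt (fun s => p s - G s - c) x} ∪ {a, b},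
    hq.countable_not_continuousAt.union (by simp), fun s hs => ?_⟩
  have hsI : s ∈ Ioo a b :=
    ⟨lt_of_le_of_ne hs.1.1 fun h => hs.2 (Or.inr (by simp [h])),
      lt_of_le_of_ne hs.1.2 fun h => hs.2 (Or.inr (by simp [h]))⟩
  have hcont : ContinuousAt (fun s => p s - G s - c) s :=
    not_not.1 fun h => hs.2 (Or.inl ⟨hsI, h⟩)
  by_contra hne
  have hne' : p s - G s - c ≠ 0 := fun h => hne (by rw [← hG] at *; linarith)
  have hev := (hcont.eventually_ne hne').and (Ioo_mem_nhds hsI.1 hsI.2)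
  obtain ⟨y, hy1, hy2⟩ := (Measure.dense_of_ae hae).inter_nhds_nonempty hev
  have h3 := mul_self_eq_zero.1 (hy1 (Ioo_subset_Ioc_self hy2.2))
  rw [hdβ, indicator_of_mem (Ioo_subset_Icc_self hy2.2)] at h3
  exact hy2.1 h3

end Substitution

/-! ### Existence, uniqueness and regularity of the light-cone foot. -/

section LightCone

open Filter
open scoped Topology NNReal ENNReal

/-! ### Light cones of sub-luminal orbits -/

/-- An orbit of `X_BV` whose speed is bounded by `κ < 1`. -/
structure TimeOrbit.IsXBVWith (X : TimeOrbit) (κ : ℝ) : Prop where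
  isXBV : X.IsXBV
  nonneg : 0 ≤ κ
  lt_one : κ < 1
  bound : ∀ t ∈ Icc X.lo X.hi, ‖X.v t‖ ≤ κ

theorem TimeOrbit.IsXBV.exists_isXBVWith {X : TimeOrbit} (h : X.IsXBV) : ∃ κ, X.IsXBVWith κ := by
  obtain ⟨κ, hκ, hb⟩ := h.subluminal
  exact ⟨κ, h, (norm_nonneg _).trans (hb X.lo ⟨le_rfl, h.lt.le⟩), hκ, hb⟩

/-- A sign: `1` or `-1`. -/
def IsSign (σ : ℝ) : Prop := σ = 1 ∨ σ = -1

theorem IsSign.abs {σ : ℝ} (h : IsSign σ) : |σ| = 1 := by rcases h with rfl | rfl <;> simp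

theorem IsSign.mul_self {σ : ℝ} (h : IsSign σ) : σ * σ = 1 := by rcases h with rfl | rfl <;> simp

theorem IsSign.neg {σ : ℝ} (h : IsSign σ) : IsSign (-σ) := by
  rcases h with rfl | rfl
  · exact Or.inr rfl
  · exact Or.inl (neg_neg 1)

/-- The function `τ - σ |y - x(τ)|`, whose level `t` is the light-cone condition. -/
noncomputable def TimeOrbit.coneFun (X : TimeOrbit) (σ : ℝ) (y : E3) (τ : ℝ) : ℝ :=
  τ - σ * ‖y - X.x τ‖

namespace TimeOrbit

variable {X : TimeOrbit} {κ σ : ℝ}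

theorem onCone_iff {t : ℝ} {y : E3} {τ : ℝ} :
    X.OnCone σ t y τ ↔ τ ∈ Icc X.lo X.hi ∧ X.coneFun σ y τ = t := by
  simp only [OnCone, coneFun, sub_eq_iff_eq_add]

theorem abs_coneFun_sub_le_event (hσ : IsSign σ) (y y' : E3) (τ : ℝ) :
    |X.coneFun σ y τ - X.coneFun σ y' τ| ≤ ‖y - y'‖ := by
  have h : X.coneFun σ y τ - X.coneFun σ y' τ = -σ * (‖y - X.x τ‖ - ‖y' - X.x τ‖) := by
    simp only [coneFun]; ring
  rw [h, abs_mul, abs_neg, hσ.abs, one_mul]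
  refine (abs_norm_sub_norm_le _ _).trans_eq ?_
  rw [sub_sub_sub_cancel_right]

theorem OnCone.norm_eq (hσ : IsSign σ) {t : ℝ} {y : E3} {τ : ℝ} (h : X.OnCone σ t y τ) :
    ‖y - X.x τ‖ = σ * (τ - t) := by
  have := h.2
  have h2 := hσ.mul_self
  have : τ - t = σ * ‖y - X.x τ‖ := by linarith
  rw [this, ← mul_assoc, h2, one_mul]

theorem OnCone.abs_sub_eq (hσ : IsSign σ) {t : ℝ} {y : E3} {τ : ℝ} (h : X.OnCone σ t y τ) :
    ‖y - X.x τ‖ = |τ - t| := by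
  rw [← abs_of_nonneg (norm_nonneg (y - X.x τ)), h.norm_eq hσ, abs_mul, hσ.abs, one_mul]

theorem coneTime_spec {t : ℝ} {y : E3} (h : ∃ τ, X.OnCone σ t y τ) :
    X.OnCone σ t y (X.coneTime σ t y) :=
  Classical.epsilon_spec h

namespace IsXBVWith

variable (h : X.IsXBVWith κ)
include h

theorem norm_x_sub_le {s s' : ℝ} (hs : s ∈ Icc X.lo X.hi) (hs' : s' ∈ Icc X.lo X.hi) :
    ‖X.x s' - X.x s‖ ≤ κ * |s' - s| :=
  dist_le_of_primitive (h.isXBV.bv.intervalIntegrable_E3 h.isXBV.lt.le) h.isXBV.x_eq h.bound hs hs'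

theorem lipschitzOnWith_x : LipschitzOnWith (Real.toNNReal κ) X.x (Icc X.lo X.hi) :=
  LipschitzOnWith.of_dist_le_mul fun s hs s' hs' => by
    rw [dist_eq_norm, Real.dist_eq, Real.coe_toNNReal _ h.nonneg]
    exact h.norm_x_sub_le hs' hs

theorem hasDerivAt_x {s : ℝ} (hs : s ∈ Ioo X.lo X.hi) (hc : ContinuousAt X.v s) :
    HasDerivAt X.x (X.v s) s :=
  hasDerivAt_of_primitive (h.isXBV.bv.intervalIntegrable_E3 h.isXBV.lt.le) h.isXBV.x_eq hs hc

theorem abs_norm_sub_le (y : E3) {s s' : ℝ} (hs : s ∈ Icc X.lo X.hi) (hs' : s' ∈ Icc X.lo X.hi) :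
    |‖y - X.x s'‖ - ‖y - X.x s‖| ≤ κ * |s' - s| := by
  refine (abs_norm_sub_norm_le _ _).trans ?_
  rw [sub_sub_sub_cancel_left, norm_sub_rev]
  exact h.norm_x_sub_le hs hs'

/-- The distance to `y` changes at rate at most `κ < 1`, so the time term dominates. -/
theorem isExpanding_coneFun (hσ : IsSign σ) (y : E3) :
    IsExpanding (X.coneFun σ y) X.lo X.hi (1 - κ) where
  le := h.isXBV.lt.le
  pos := sub_pos.2 h.lt_one
  cont := continuousOn_id.sub (continuousOn_const.mul
    (continuousOn_const.sub h.lipschitzOnWith_x.continuousOn).norm)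
  lower s hs s' hs' hss := by
    have h1 := h.abs_norm_sub_le y hs hs'
    rw [abs_of_nonneg (sub_nonneg.2 hss)] at h1
    have h2 : |σ * (‖y - X.x s'‖ - ‖y - X.x s‖)| ≤ κ * (s' - s) := by
      rwa [abs_mul, hσ.abs, one_mul]
    have h3 := (abs_le.1 h2).2
    simp only [coneFun]
    linarith

theorem coneFun_sub_le (hσ : IsSign σ) (y : E3) {s s' : ℝ} (hs : s ∈ Icc X.lo X.hi)
    (hs' : s' ∈ Icc X.lo X.hi) (hss : s ≤ s') :
    X.coneFun σ y s' - X.coneFun σ y s ≤ (1 + κ) * (s' - s) := by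
  have h1 := h.abs_norm_sub_le y hs hs'
  rw [abs_of_nonneg (sub_nonneg.2 hss)] at h1
  have h2 : |σ * (‖y - X.x s'‖ - ‖y - X.x s‖)| ≤ κ * (s' - s) := by
    rwa [abs_mul, hσ.abs, one_mul]
  have h3 := (abs_le.1 h2).1
  simp only [coneFun]
  linarith

/-- The cone function separates the two feet at rate at least `1 - κ`, while a change of event
changes its values by at most the displacement of `y` and its prescribed level by `t - t'`. -/
theorem abs_sub_le_of_onCone (hσ : IsSign σ) {t t' : ℝ} {y y' : E3} {τ τ' : ℝ}
    (h1 : X.OnCone σ t y τ) (h2 : X.OnCone σ t' y' τ') :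
    (1 - κ) * |τ - τ'| ≤ |t - t'| + ‖y - y'‖ := by
  rw [onCone_iff] at h1 h2
  have h3 := abs_coneFun_sub_le_event (X := X) hσ y y' τ'
  have e : X.coneFun σ y τ - X.coneFun σ y τ' =
      (t - t') - (X.coneFun σ y τ' - X.coneFun σ y' τ') := by rw [h1.2, h2.2]; ring
  have h4 : |X.coneFun σ y τ - X.coneFun σ y τ'| ≤ |t - t'| + ‖y - y'‖ := by
    rw [e]; exact (abs_sub _ _).trans (by gcongr)
  refine le_trans ?_ h4
  rcases le_total τ τ' with hle | hle
  · have := (h.isExpanding_coneFun hσ y).lower τ h1.1 τ' h2.1 hle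
    rw [abs_sub_comm τ, abs_of_nonneg (sub_nonneg.2 hle), abs_sub_comm]
    exact this.trans (le_abs_self _)
  · have := (h.isExpanding_coneFun hσ y).lower τ' h2.1 τ h1.1 hle
    rw [abs_of_nonneg (sub_nonneg.2 hle)]
    exact this.trans (le_abs_self _)

theorem onCone_unique (hσ : IsSign σ) {t : ℝ} {y : E3} {τ τ' : ℝ}
    (h1 : X.OnCone σ t y τ) (h2 : X.OnCone σ t y τ') : τ = τ' := by
  rw [onCone_iff] at h1 h2
  exact (h.isExpanding_coneFun hσ y).strictMonoOn.injOn h1.1 h2.1 (h1.2.trans h2.2.symm)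

theorem coneTime_eq (hσ : IsSign σ) {t : ℝ} {y : E3} {τ : ℝ} (h1 : X.OnCone σ t y τ) :
    X.coneTime σ t y = τ :=
  h.onCone_unique hσ (coneTime_spec ⟨τ, h1⟩) h1

theorem exists_onCone (hσ : IsSign σ) {t : ℝ} {y : E3} (h1 : X.coneFun σ y X.lo ≤ t)
    (h2 : t ≤ X.coneFun σ y X.hi) : ∃ τ, X.OnCone σ t y τ := by
  have := (h.isExpanding_coneFun hσ y).image_Icc
  obtain ⟨τ, hτ, e⟩ : t ∈ X.coneFun σ y '' Icc X.lo X.hi := by rw [this]; exact ⟨h1, h2⟩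
  exact ⟨τ, onCone_iff.2 ⟨hτ, e⟩⟩

/-- For an interior foot the level lies strictly between the end values of the cone function, an
open condition on the event. -/
theorem eventually_exists_onCone (hσ : IsSign σ) {e₀ : ℝ × E3} {τ : ℝ}
    (h1 : X.OnCone σ e₀.1 e₀.2 τ) (hτ : τ ∈ Ioo X.lo X.hi) :
    ∀ᶠ e : ℝ × E3 in 𝓝 e₀, ∃ τ, X.OnCone σ e.1 e.2 τ := by
  have hE := h.isExpanding_coneFun hσ e₀.2
  have hlo := hE.strictMonoOn ⟨le_rfl, h.isXBV.lt.le⟩ h1.1 hτ.1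
  have hhi := hE.strictMonoOn h1.1 ⟨h.isXBV.lt.le, le_rfl⟩ hτ.2
  rw [(onCone_iff.1 h1).2] at hlo hhi
  have c1 : ∀ r : ℝ, Continuous fun e : ℝ × E3 => X.coneFun σ e.2 r := fun r => by
    unfold coneFun; fun_prop
  have l1 : ∀ᶠ e : ℝ × E3 in 𝓝 e₀, X.coneFun σ e.2 X.lo < e.1 :=
    (c1 _).continuousAt.eventually_lt continuous_fst.continuousAt hlo
  have l2 : ∀ᶠ e : ℝ × E3 in 𝓝 e₀, e.1 < X.coneFun σ e.2 X.hi :=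
    continuous_fst.continuousAt.eventually_lt (c1 _).continuousAt hhi
  filter_upwards [l1, l2] with e he1 he2 using h.exists_onCone hσ he1.le he2.le

/-- The foot of the light cone moves forward along a timelike curve of events. -/
theorem sub_le_of_timelike (hσ : IsSign σ) {t t' : ℝ} {y y' : E3} {τ τ' κ' : ℝ} (hκ' : κ' < 1)
    (ht : t ≤ t') (hy : ‖y' - y‖ ≤ κ' * (t' - t)) (h1 : X.OnCone σ t y τ)
    (h2 : X.OnCone σ t' y' τ') : (1 - κ') / (1 + κ) * (t' - t) ≤ τ' - τ := by
  rw [onCone_iff] at h1 h2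
  have hκ := h.nonneg
  have hE := h.isExpanding_coneFun hσ y'
  have h3 := (abs_le.1 ((abs_coneFun_sub_le_event (X := X) hσ y' y τ).trans hy)).2
  rw [h1.2] at h3
  -- At the old foot the cone function of `y'` is at most `t + κ' (t' - t)`. It still has to climb
  -- `(1 - κ') (t' - t)` to reach the level `t'`, at rate at most `1 + κ`.
  have h4 : (1 - κ') * (t' - t) ≤ X.coneFun σ y' τ' - X.coneFun σ y' τ := by
    rw [h2.2]; linarith
  have h5 : 0 ≤ (1 - κ') * (t' - t) := mul_nonneg (by linarith) (by linarith)
  have h6 : τ ≤ τ' := (hE.strictMonoOn.le_iff_le h1.1 h2.1).1 (by linarith)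
  have h7 := h.coneFun_sub_le hσ y' h1.1 h2.1 h6
  rw [div_mul_eq_mul_div, div_le_iff₀ (by linarith)]
  linarith

theorem continuousAt_coneTime (hσ : IsSign σ) {e₀ : ℝ × E3} {τ : ℝ}
    (h1 : X.OnCone σ e₀.1 e₀.2 τ) (hτ : τ ∈ Ioo X.lo X.hi) :
    ContinuousAt (fun e : ℝ × E3 => X.coneTime σ e.1 e.2) e₀ := by
  have hpos : 0 < 1 - κ := sub_pos.2 h.lt_one
  rw [ContinuousAt, tendsto_iff_dist_tendsto_zero]
  have hlim : Tendsto (fun e : ℝ × E3 => (1 - κ)⁻¹ * (|e.1 - e₀.1| + ‖e.2 - e₀.2‖)) (𝓝 e₀)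
      (𝓝 0) := by
    have hc : Continuous fun e : ℝ × E3 => (1 - κ)⁻¹ * (|e.1 - e₀.1| + ‖e.2 - e₀.2‖) := by
      fun_prop
    simpa using hc.tendsto e₀
  refine squeeze_zero' (Eventually.of_forall fun _ => dist_nonneg) ?_ hlim
  filter_upwards [h.eventually_exists_onCone hσ h1 hτ] with e he
  rw [Real.dist_eq, h.coneTime_eq hσ h1, inv_mul_eq_div, le_div_iff₀ hpos, mul_comm]
  exact h.abs_sub_le_of_onCone hσ (coneTime_spec he) h1

end IsXBVWith

/-! ### The denominator -/

/-- Clears the unit vector; at zero distance both sides are zero, so no case distinction is needed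
afterwards. -/
theorem coneDen_eq {t : ℝ} {y : E3} :
    coneDen σ X t y = 2 * (‖y - X.x (X.coneTime σ t y)‖ +
      σ * inner ℝ (y - X.x (X.coneTime σ t y)) (X.v (X.coneTime σ t y))) := by
  set z := y - X.x (X.coneTime σ t y) with hz
  rcases eq_or_ne z 0 with h0 | h0
  · simp [coneDen, ← hz, h0]
  · have hr : ‖z‖ ≠ 0 := norm_ne_zero_iff.2 h0
    rw [coneDen, unitVec, ← hz, real_inner_smul_left]
    field_simp

/-- By Cauchy–Schwarz the term with the velocity takes away at most the fraction `κ` of the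
distance. -/
theorem IsXBVWith.le_coneDen (h : X.IsXBVWith κ) (hσ : IsSign σ) {t : ℝ} {y : E3} {τ : ℝ}
    (h1 : X.OnCone σ t y τ) : 2 * (1 - κ) * ‖y - X.x τ‖ ≤ coneDen σ X t y := by
  rw [coneDen_eq, h.coneTime_eq hσ h1]
  have h2 : |σ * inner ℝ (y - X.x τ) (X.v τ)| ≤ ‖y - X.x τ‖ * κ := by
    rw [abs_mul, hσ.abs, one_mul]
    exact (abs_real_inner_le_norm _ _).trans (by gcongr; exact h.bound τ h1.1)
  have := (abs_le.1 h2).1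
  linarith

theorem IsXBVWith.coneDen_pos (h : X.IsXBVWith κ) (hσ : IsSign σ) {t : ℝ} {y : E3} {τ : ℝ}
    (h1 : X.OnCone σ t y τ) (hne : y ≠ X.x τ) : 0 < coneDen σ X t y :=
  (mul_pos (mul_pos two_pos (sub_pos.2 h.lt_one)) (norm_pos_iff.2 (sub_ne_zero.2 hne))).trans_le
    (h.le_coneDen hσ h1)

/-- On the light cone the distance is the time difference. -/
theorem coneDen_eq_of_onCone (hσ : IsSign σ) {t : ℝ} {y : E3} (h1 : ∃ τ, X.OnCone σ t y τ) :
    coneDen σ X t y = 2 * σ * (X.coneTime σ t y - t +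
      inner ℝ (y - X.x (X.coneTime σ t y)) (X.v (X.coneTime σ t y))) := by
  rw [coneDen_eq, (coneTime_spec h1).norm_eq hσ]
  ring

/-! ### Differentiability of the light-cone foot and of the potentials -/

/-- A pointwise inverse function argument: the foot, paired with `y`, is a continuous right inverse
of the cone function paired with `y`. Continuity being known already, differentiability of the
latter at the single point `(τ, y)` with invertible derivative suffices. -/
theorem IsXBVWith.hasFDerivAt_coneTime (h : X.IsXBVWith κ) (hσ : IsSign σ) {e₀ : ℝ × E3} {τ : ℝ}
    (h1 : X.OnCone σ e₀.1 e₀.2 τ) (hτ : τ ∈ Ioo X.lo X.hi) (hne : e₀.2 ≠ X.x τ)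
    (hc : ContinuousAt X.v τ) :
    HasFDerivAt (fun e : ℝ × E3 => X.coneTime σ e.1 e.2)
      ((coneDen σ X e₀.1 e₀.2)⁻¹ • ((2 * ‖e₀.2 - X.x τ‖) • ContinuousLinearMap.fst ℝ ℝ E3 +
        (2 * σ) • (innerSL ℝ (e₀.2 - X.x τ)).comp (ContinuousLinearMap.snd ℝ ℝ E3))) e₀ := by
  set D := coneDen σ X e₀.1 e₀.2 with hD
  have hDpos : 0 < D := h.coneDen_pos hσ h1 hne
  set z := e₀.2 - X.x τ with hz
  have hz0 : z ≠ 0 := sub_ne_zero.2 hne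
  have hr : 0 < ‖z‖ := norm_pos_iff.2 hz0
  have hDeq : D = 2 * (‖z‖ + σ * inner ℝ z (X.v τ)) := by
    rw [hD, coneDen_eq, h.coneTime_eq hσ h1]
  have hτ0 : X.coneTime σ e₀.1 e₀.2 = τ := h.coneTime_eq hσ h1
  -- the cone function, as a function of the foot and the event
  let F : ℝ × E3 → ℝ × E3 := fun p => (X.coneFun σ p.2 p.1, p.2)
  let g : ℝ × E3 → ℝ × E3 := fun e => (X.coneTime σ e.1 e.2, e.2)
  have hx := h.hasDerivAt_x hτ hc
  have hdiff : HasFDerivAt (fun p : ℝ × E3 => p.2 - X.x p.1)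
      (ContinuousLinearMap.snd ℝ ℝ E3 -
        (ContinuousLinearMap.fst ℝ ℝ E3).smulRight (X.v τ)) (τ, e₀.2) := by
    refine (hasFDerivAt_snd).sub ?_
    have := (hx.hasFDerivAt.comp (τ, e₀.2) (hasFDerivAt_fst (𝕜 := ℝ) (E := ℝ) (F := E3)
      (p := (τ, e₀.2))))
    refine this.congr_fderiv ?_
    ext <;> simp
  have hnorm : HasFDerivAt (fun p : ℝ × E3 => ‖p.2 - X.x p.1‖)
      (‖z‖⁻¹ • (innerSL ℝ z).comp (ContinuousLinearMap.snd ℝ ℝ E3 -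
        (ContinuousLinearMap.fst ℝ ℝ E3).smulRight (X.v τ))) (τ, e₀.2) := by
    have h2 := (hdiff.norm_sq).sqrt (by simpa [← hz] using hr.ne')
    simp only [Real.sqrt_sq (norm_nonneg _)] at h2
    refine h2.congr_fderiv ?_
    rw [← hz]
    ext <;> simp <;> field_simp
  have hF : HasFDerivAt F (((ContinuousLinearMap.fst ℝ ℝ E3) - σ • (‖z‖⁻¹ •
      (innerSL ℝ z).comp (ContinuousLinearMap.snd ℝ ℝ E3 -
        (ContinuousLinearMap.fst ℝ ℝ E3).smulRight (X.v τ)))).prod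
          (ContinuousLinearMap.snd ℝ ℝ E3)) (g e₀) := by
    have : g e₀ = (τ, e₀.2) := by simp [g, hτ0]
    rw [this]
    exact ((hasFDerivAt_fst).sub (hnorm.const_mul σ)).prodMk hasFDerivAt_snd
  have hg : ContinuousAt g e₀ :=
    (h.continuousAt_coneTime hσ h1 hτ).prodMk continuous_snd.continuousAt
  have hFg : ∀ᶠ e in 𝓝 e₀, F (g e) = e := by
    filter_upwards [h.eventually_exists_onCone hσ h1 hτ] with e he
    exact Prod.ext (onCone_iff.1 (coneTime_spec he)).2 rfl
  -- The candidate derivative comes from solving the linearised cone condition for the foot; the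
  -- remaining goal checks that it inverts the derivative of `F`.
  have key := hF.of_comp_of_leftInverse (f'symm := ((D⁻¹ • ((2 * ‖z‖) •
    ContinuousLinearMap.fst ℝ ℝ E3 + (2 * σ) • (innerSL ℝ z).comp
      (ContinuousLinearMap.snd ℝ ℝ E3))).prod (ContinuousLinearMap.snd ℝ ℝ E3))) hg
    (hasFDerivAt_id e₀) hFg ?_
  · exact key.fst.congr_fderiv (by ext <;> simp)
  · rintro ⟨a, u⟩
    have hs := hσ.mul_self
    refine Prod.ext ?_ rfl
    simp only [ContinuousLinearMap.prod_apply, sub_apply,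
      smul_apply, add_apply,
      ContinuousLinearMap.comp_apply, ContinuousLinearMap.coe_fst', ContinuousLinearMap.coe_snd',
      ContinuousLinearMap.smulRight_apply, innerSL_apply_apply, inner_sub_right,
      inner_smul_right, smul_eq_mul]
    rw [inv_mul_eq_div, div_eq_iff hDpos.ne', hDeq]
    field_simp
    ring

end TimeOrbit

end LightCone

/-! ### Scalar and vector potentials, and timelike orbits. -/

section Potentials

open Filter
open scoped Topology NNReal ENNReal

/-- The contribution of one light cone to the scalar potential. -/
noncomputable def TimeOrbit.pot (X : TimeOrbit) (σ : ℝ) (e : ℝ × E3) : ℝ :=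
  (coneDen σ X e.1 e.2)⁻¹

/-- The contribution of one light cone to the vector potential. -/
noncomputable def TimeOrbit.vpot (X : TimeOrbit) (σ : ℝ) (e : ℝ × E3) : E3 :=
  (coneDen σ X e.1 e.2)⁻¹ • X.v (X.coneTime σ e.1 e.2)

theorem scalPot_eq (X : TimeOrbit) (t : ℝ) (y : E3) :
    scalPot X t y = X.pot (-1) (t, y) + X.pot 1 (t, y) := rfl

theorem vecPot_eq (X : TimeOrbit) (t : ℝ) (y : E3) :
    vecPot X t y = X.vpot (-1) (t, y) + X.vpot 1 (t, y) := rfl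

/-- The interaction is affine in the velocity `v`, with coefficients that depend on the event alone.
This separates velocity derivatives from the light-cone geometry. -/
theorem interLag_eq (σ : ℝ) (X : TimeOrbit) (t : ℝ) (y v : E3) :
    interLag σ X t y v = X.pot σ (t, y) - inner ℝ v (X.vpot σ (t, y)) := by
  simp only [interLag, TimeOrbit.pot, TimeOrbit.vpot, real_inner_smul_right, div_eq_mul_inv]
  ring

theorem partialLag_eq (m : ℝ) (X : TimeOrbit) (y v : E3) (t : ℝ) :
    partialLag m X y v t = localLag m v + scalPot X t y - inner ℝ v (vecPot X t y) := by
  rw [partialLag, interLag_eq, interLag_eq, scalPot_eq, vecPot_eq, inner_add_right]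
  ring

namespace TimeOrbit.IsXBVWith

variable {X : TimeOrbit} {κ σ : ℝ}

/-- On the cone the denominator can be written without a norm, through `coneDen_eq_of_onCone`, and
the chain rule applies to the foot. Here `θ` is the derivative of the foot in the direction `d` and
`w` the acceleration at the foot, so both derivatives are affine in `w`. -/
theorem exists_hasFDerivAt_pot (h : X.IsXBVWith κ) (hσ : IsSign σ) {e₀ : ℝ × E3} {τ : ℝ}
    (h1 : X.OnCone σ e₀.1 e₀.2 τ) (hτ : τ ∈ Ioo X.lo X.hi) (hne : e₀.2 ≠ X.x τ) {w : E3}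
    (hw : HasDerivAt X.v w τ) :
    ∃ (Φ' : ℝ × E3 →L[ℝ] ℝ) (A' : ℝ × E3 →L[ℝ] E3), HasFDerivAt (X.pot σ) Φ' e₀ ∧
      HasFDerivAt (X.vpot σ) A' e₀ ∧ ∀ d : ℝ × E3, ∀ D θ : ℝ, D = coneDen σ X e₀.1 e₀.2 →
        θ = D⁻¹ * (2 * ‖e₀.2 - X.x τ‖ * d.1 + 2 * σ * inner ℝ (e₀.2 - X.x τ) d.2) →
        Φ' d = -(D⁻¹ * D⁻¹) * (2 * σ * (θ - d.1 + (inner ℝ (d.2 - θ • X.v τ) (X.v τ) +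
          inner ℝ (e₀.2 - X.x τ) (θ • w)))) ∧
        A' d = D⁻¹ • θ • w + Φ' d • X.v τ := by
  have hτ0 : X.coneTime σ e₀.1 e₀.2 = τ := h.coneTime_eq hσ h1
  have hcone := h.hasFDerivAt_coneTime hσ h1 hτ hne hw.continuousAt
  set θ' := ((coneDen σ X e₀.1 e₀.2)⁻¹ • ((2 * ‖e₀.2 - X.x τ‖) •
    ContinuousLinearMap.fst ℝ ℝ E3 + (2 * σ) • (innerSL ℝ (e₀.2 - X.x τ)).comp
      (ContinuousLinearMap.snd ℝ ℝ E3))) with hθ'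
  have hDpos := h.coneDen_pos hσ h1 hne
  have hxτ : HasDerivAt X.x (X.v τ) (X.coneTime σ e₀.1 e₀.2) := by
    rw [hτ0]; exact h.hasDerivAt_x hτ hw.continuousAt
  have hvτ : HasDerivAt X.v w (X.coneTime σ e₀.1 e₀.2) := by rwa [hτ0]
  have hx' := hxτ.hasFDerivAt.comp e₀ hcone
  have hv' := hvτ.hasFDerivAt.comp e₀ hcone
  have hz' := (hasFDerivAt_snd (𝕜 := ℝ) (E := ℝ) (F := E3) (p := e₀)).fun_sub hx'
  have hin := hz'.inner ℝ hv'
  have hD' := ((hcone.sub (hasFDerivAt_fst (𝕜 := ℝ) (E := ℝ) (F := E3) (p := e₀))).add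
    hin).const_mul (2 * σ)
  -- The norm-free formula needs an actual foot, which exists for events near `e₀`.
  have hD := hD'.congr_of_eventuallyEq (f₁ := fun e : ℝ × E3 => coneDen σ X e.1 e.2) (by
    filter_upwards [h.eventually_exists_onCone hσ h1 hτ] with e he
    exact coneDen_eq_of_onCone hσ he)
  have hinv := (hasDerivAt_inv hDpos.ne').comp_hasFDerivAt e₀ hD
  refine ⟨_, _, hinv, hinv.smul hv', ?_⟩
  rintro ⟨d, u⟩ D θ hDD hθ
  have hθd : θ' (d, u) = θ := by
    rw [hθ, hDD, hθ']
    simp [inner_sub_left]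
    ring
  have hΦ : ∀ F : ℝ × E3 →L[ℝ] ℝ, F (d, u) = 2 * σ * (θ - d + (inner ℝ (u - θ • X.v τ) (X.v τ) +
      inner ℝ (e₀.2 - X.x τ) (θ • w))) → (-(coneDen σ X e₀.1 e₀.2 ^ 2)⁻¹ • F) (d, u) =
      -(D⁻¹ * D⁻¹) * (2 * σ * (θ - d + (inner ℝ (u - θ • X.v τ) (X.v τ) +
        inner ℝ (e₀.2 - X.x τ) (θ • w)))) := by
    intro F hF
    rw [smul_apply, hF, hDD, smul_eq_mul, sq, mul_inv]
  refine ⟨hΦ _ ?_, ?_⟩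
  · simp [hθd, hτ0]
    ring
  · simp [hθd, hτ0, hDD]

/-- If the velocity is Lipschitz, the potentials are Lipschitz at bounded distances, away from the
orbit. -/
theorem exists_lipschitz_pot (h : X.IsXBVWith κ) (hσ : IsSign σ) {K : ℝ≥0}
    (hv : LipschitzOnWith K X.v (Icc X.lo X.hi)) {r₀ R : ℝ} (hr₀ : 0 < r₀) :
    ∃ C, 0 ≤ C ∧ ∀ (e e' : ℝ × E3) (τ τ' : ℝ), X.OnCone σ e.1 e.2 τ → X.OnCone σ e'.1 e'.2 τ' →
      r₀ ≤ ‖e.2 - X.x τ‖ → r₀ ≤ ‖e'.2 - X.x τ'‖ → ‖e'.2 - X.x τ'‖ ≤ R →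
      |X.pot σ e - X.pot σ e'| ≤ C * (|e.1 - e'.1| + ‖e.2 - e'.2‖) ∧
      ‖X.vpot σ e - X.vpot σ e'‖ ≤ C * (|e.1 - e'.1| + ‖e.2 - e'.2‖) := by
  have hκ := h.nonneg
  have hpos : 0 < 1 - κ := sub_pos.2 h.lt_one
  -- `C₁` is the Lipschitz constant of the foot, `C₂` that of the denominator, `c` a lower bound for
  -- the denominator, and `C₃` the resulting constant for its inverse.
  set C₁ : ℝ := (1 - κ)⁻¹ with hC₁
  have hC₁0 : 0 < C₁ := inv_pos.2 hpos
  set C₂ : ℝ := 2 * (1 + κ * C₁ + ((1 + κ * C₁) * κ + |R| * (K * C₁))) with hC₂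
  have hC₂0 : 0 ≤ C₂ := by positivity
  set c : ℝ := 2 * (1 - κ) * r₀ with hc
  have hc0 : 0 < c := by positivity
  set C₃ : ℝ := (c * c)⁻¹ * C₂ with hC₃
  have hC₃0 : 0 ≤ C₃ := by positivity
  refine ⟨C₃ + (C₃ * κ + c⁻¹ * (K * C₁)), by positivity, ?_⟩
  intro e e' τ τ' h1 h2 hr hr' hR
  set δ : ℝ := |e.1 - e'.1| + ‖e.2 - e'.2‖ with hδ
  have hδ0 : 0 ≤ δ := by positivity
  have hτ : |τ - τ'| ≤ C₁ * δ := by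
    rw [hC₁, inv_mul_eq_div, le_div_iff₀ hpos, mul_comm]
    exact h.abs_sub_le_of_onCone hσ h1 h2
  have hvτ : ‖X.v τ - X.v τ'‖ ≤ K * C₁ * δ := by
    have := hv.dist_le_mul τ h1.1 τ' h2.1
    rw [dist_eq_norm, Real.dist_eq] at this
    refine this.trans ?_
    rw [mul_assoc]
    gcongr
  have hz : ‖(e.2 - X.x τ) - (e'.2 - X.x τ')‖ ≤ (1 + κ * C₁) * δ := by
    have e1 : (e.2 - X.x τ) - (e'.2 - X.x τ') = (e.2 - e'.2) - (X.x τ - X.x τ') := by abel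
    have e2 : ‖X.x τ - X.x τ'‖ ≤ κ * (C₁ * δ) :=
      (h.norm_x_sub_le h2.1 h1.1).trans (by gcongr)
    have e3 : ‖e.2 - e'.2‖ ≤ δ := by rw [hδ]; linarith [abs_nonneg (e.1 - e'.1)]
    rw [e1]
    calc _ ≤ ‖e.2 - e'.2‖ + ‖X.x τ - X.x τ'‖ := norm_sub_le _ _
      _ ≤ _ := by linarith
  have hin : |inner ℝ (e.2 - X.x τ) (X.v τ) - inner ℝ (e'.2 - X.x τ') (X.v τ')| ≤
      ((1 + κ * C₁) * κ + |R| * (K * C₁)) * δ := by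
    have e1 : inner ℝ (e.2 - X.x τ) (X.v τ) - inner ℝ (e'.2 - X.x τ') (X.v τ') =
        inner ℝ ((e.2 - X.x τ) - (e'.2 - X.x τ')) (X.v τ) +
          inner ℝ (e'.2 - X.x τ') (X.v τ - X.v τ') := by
      rw [inner_sub_left (e.2 - X.x τ), inner_sub_right (e'.2 - X.x τ')]; ring
    rw [e1]
    calc _ ≤ |inner ℝ ((e.2 - X.x τ) - (e'.2 - X.x τ')) (X.v τ)| +
          |inner ℝ (e'.2 - X.x τ') (X.v τ - X.v τ')| := abs_add_le _ _
      _ ≤ ((1 + κ * C₁) * δ) * κ + |R| * (K * C₁ * δ) := by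
          refine add_le_add ((abs_real_inner_le_norm _ _).trans ?_)
            ((abs_real_inner_le_norm _ _).trans ?_)
          · exact mul_le_mul hz (h.bound τ h1.1) (norm_nonneg _) (by positivity)
          · exact mul_le_mul (hR.trans (le_abs_self R)) hvτ (norm_nonneg _) (abs_nonneg _)
      _ = _ := by ring
  have hD : |coneDen σ X e.1 e.2 - coneDen σ X e'.1 e'.2| ≤ C₂ * δ := by
    rw [coneDen_eq, coneDen_eq, h.coneTime_eq hσ h1, h.coneTime_eq hσ h2, ← mul_sub, abs_mul,
      abs_two, hC₂, mul_assoc]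
    refine mul_le_mul_of_nonneg_left ?_ two_pos.le
    rw [add_sub_add_comm, ← mul_sub]
    refine (abs_add_le _ _).trans ?_
    rw [abs_mul, hσ.abs, one_mul, add_mul]
    exact add_le_add ((abs_norm_sub_norm_le _ _).trans hz) hin
  have hDc : c ≤ coneDen σ X e.1 e.2 :=
    le_trans (by rw [hc]; gcongr) (h.le_coneDen hσ h1)
  have hDc' : c ≤ coneDen σ X e'.1 e'.2 :=
    le_trans (by rw [hc]; gcongr) (h.le_coneDen hσ h2)
  have hD0 := hc0.trans_le hDc
  have hD0' := hc0.trans_le hDc'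
  have hpot : |X.pot σ e - X.pot σ e'| ≤ C₃ * δ := by
    rw [pot, pot, inv_sub_inv hD0.ne' hD0'.ne', abs_div, abs_of_pos (mul_pos hD0 hD0'),
      abs_sub_comm, hC₃, mul_assoc, inv_mul_eq_div]
    gcongr
  have hpe : ‖(coneDen σ X e'.1 e'.2)⁻¹‖ ≤ c⁻¹ := by
    rw [Real.norm_of_nonneg (inv_nonneg.2 hD0'.le)]
    gcongr
  refine ⟨hpot.trans ?_, ?_⟩
  · refine mul_le_mul_of_nonneg_right ?_ hδ0
    have : 0 ≤ C₃ * κ + c⁻¹ * (K * C₁) := by positivity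
    linarith
  · have e1 : X.vpot σ e - X.vpot σ e' = (X.pot σ e - X.pot σ e') • X.v τ +
        (coneDen σ X e'.1 e'.2)⁻¹ • (X.v τ - X.v τ') := by
      rw [vpot, vpot, pot, pot, h.coneTime_eq hσ h1, h.coneTime_eq hσ h2, sub_smul, smul_sub]
      abel
    rw [e1]
    calc _ ≤ ‖(X.pot σ e - X.pot σ e') • X.v τ‖ +
          ‖(coneDen σ X e'.1 e'.2)⁻¹ • (X.v τ - X.v τ')‖ := norm_add_le _ _
      _ ≤ C₃ * δ * κ + c⁻¹ * (K * C₁ * δ) := by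
          rw [norm_smul, norm_smul, Real.norm_eq_abs (X.pot σ e - X.pot σ e')]
          refine add_le_add ?_ ?_
          · exact mul_le_mul hpot (h.bound τ h1.1) (norm_nonneg _) (by positivity)
          · exact mul_le_mul hpe hvτ (norm_nonneg _) (by positivity)
      _ ≤ _ := by
          have : 0 ≤ C₃ * δ := by positivity
          linarith

end TimeOrbit.IsXBVWith

/-! ### Orbits of `T_BV ⊗ X_BV` -/

theorem IsTBV.isExpanding {lo hi c : ℝ} {t dt : ℝ → ℝ} (h : IsTBV lo hi t dt) (hc : 0 < c)
    (hdt : ∀ s ∈ Icc lo hi, c ≤ dt s) : IsExpanding t lo hi c where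
  le := h.lt.le
  pos := hc
  cont := by
    have hi := h.bv.intervalIntegrable_real h.lt.le
    obtain ⟨C, hC0, hC⟩ := h.bv.exists_norm_le
    refine (LipschitzOnWith.of_dist_le_mul (K := Real.toNNReal C) fun s hs s' hs' => ?_).continuousOn
    rw [Real.coe_toNNReal _ hC0.le, dist_eq_norm, dist_eq_norm]
    exact dist_le_of_primitive hi h.t_eq hC hs' hs
  lower s hs s' hs' hss :=
    le_sub_of_primitive (h.bv.intervalIntegrable_real h.lt.le) h.t_eq hdt hs hs' hss

theorem IsTBV.exists_isExpanding {lo hi : ℝ} {t dt : ℝ → ℝ} (h : IsTBV lo hi t dt) :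
    ∃ c, IsExpanding t lo hi c := by
  obtain ⟨c, hc, hdt⟩ := h.pos
  exact ⟨c, h.isExpanding hc hdt⟩

theorem IsTBV.exists_lipschitzOnWith {lo hi : ℝ} {t dt : ℝ → ℝ} (h : IsTBV lo hi t dt) :
    ∃ K, LipschitzOnWith K t (Icc lo hi) := by
  have hi := h.bv.intervalIntegrable_real h.lt.le
  obtain ⟨C, hC0, hC⟩ := h.bv.exists_norm_le
  refine ⟨Real.toNNReal C, LipschitzOnWith.of_dist_le_mul fun s hs s' hs' => ?_⟩
  rw [Real.coe_toNNReal _ hC0.le, dist_eq_norm, dist_eq_norm]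
  exact dist_le_of_primitive hi h.t_eq hC hs' hs

theorem IsTBV.dt_pos {lo hi : ℝ} {t dt : ℝ → ℝ} (h : IsTBV lo hi t dt) {s : ℝ}
    (hs : s ∈ Icc lo hi) : 0 < dt s := by
  obtain ⟨c, hc, hdt⟩ := h.pos
  exact hc.trans_le (hdt s hs)

theorem IsTBV.hasDerivAt {lo hi : ℝ} {t dt : ℝ → ℝ} (h : IsTBV lo hi t dt) {s : ℝ}
    (hs : s ∈ Ioo lo hi) (hc : ContinuousAt dt s) : HasDerivAt t (dt s) s :=
  hasDerivAt_of_primitive (h.bv.intervalIntegrable_real h.lt.le) h.t_eq hs hc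

namespace FourOrbit.IsTBVXBV

variable {Q : FourOrbit} (h : Q.IsTBVXBV)
include h

theorem intervalIntegrable_dx : IntervalIntegrable Q.dx volume Q.lo Q.hi :=
  h.bv.intervalIntegrable_E3 h.time.lt.le

theorem exists_lipschitzOnWith_x : ∃ K, LipschitzOnWith K Q.x (Icc Q.lo Q.hi) := by
  obtain ⟨C, hC0, hC⟩ := h.bv.exists_norm_le
  refine ⟨Real.toNNReal C, LipschitzOnWith.of_dist_le_mul fun s hs s' hs' => ?_⟩
  rw [Real.coe_toNNReal _ hC0.le, dist_eq_norm, dist_eq_norm]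
  exact dist_le_of_primitive h.intervalIntegrable_dx h.x_eq hC hs' hs

theorem hasDerivAt_x {s : ℝ} (hs : s ∈ Ioo Q.lo Q.hi) (hc : ContinuousAt Q.dx s) :
    HasDerivAt Q.x (Q.dx s) s :=
  hasDerivAt_of_primitive h.intervalIntegrable_dx h.x_eq hs hc

/-- Integrating the pointwise bound shows that any two events of the orbit are timelike related,
with the same `κ`; this is what drives the foot forward. -/
theorem exists_timelike : ∃ κ, 0 ≤ κ ∧ κ < 1 ∧ (∀ s ∈ Icc Q.lo Q.hi, ‖Q.dx s‖ ≤ κ * Q.dt s) ∧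
    ∀ s ∈ Icc Q.lo Q.hi, ∀ s' ∈ Icc Q.lo Q.hi, s ≤ s' →
      ‖Q.x s' - Q.x s‖ ≤ κ * (Q.t s' - Q.t s) := by
  obtain ⟨κ, hκ, hb⟩ := h.subluminal
  have hlo : Q.lo ∈ Icc Q.lo Q.hi := ⟨le_rfl, h.time.lt.le⟩
  have hκ0 : 0 ≤ κ := by
    by_contra hneg
    have h1 := (norm_nonneg _).trans (hb _ hlo)
    have h2 := mul_neg_of_neg_of_pos (not_le.1 hneg) (h.time.dt_pos hlo)
    linarith
  refine ⟨κ, hκ0, hκ, hb, fun s hs s' hs' hss => ?_⟩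
  have hdt := h.time.bv.intervalIntegrable_real h.time.lt.le
  rw [sub_eq_integral_of_primitive h.intervalIntegrable_dx h.x_eq hs hs',
    sub_eq_integral_of_primitive hdt h.time.t_eq hs hs', ← intervalIntegral.integral_const_mul]
  refine intervalIntegral.norm_integral_le_of_norm_le hss ?_ ?_
  · exact Eventually.of_forall fun r hr => hb r ⟨hs.1.trans hr.1.le, hr.2.trans hs'.2⟩
  · refine (hdt.mono_set ?_).const_mul κ
    rw [uIcc_of_le hss, uIcc_of_le h.time.lt.le]
    exact Icc_subset_Icc hs.1 hs'.2

end FourOrbit.IsTBVXBV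

end Potentials

/-! ### The light-cone foot and the potentials along an orbit. -/

section ConeSegment

open Filter
open scoped Topology NNReal ENNReal

theorem BoundedVariationOn.smul_intervalIntegrable {E : Type*} [NormedAddCommGroup E]
    [NormedSpace ℝ E] {f : ℝ → ℝ} {g : ℝ → E} {a b : ℝ} (hab : a ≤ b)
    (hf : BoundedVariationOn f (Icc a b)) (hg : IntervalIntegrable g volume a b) :
    IntervalIntegrable (fun s => f s • g s) volume a b := by
  obtain ⟨C, hC0, hC⟩ := hf.exists_norm_le
  have hfi := hf.intervalIntegrable_real hab
  rw [intervalIntegrable_iff_integrableOn_Icc_of_le hab] at *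
  refine Integrable.mono' (hg.norm.const_mul C)
    (hfi.aestronglyMeasurable.smul hg.aestronglyMeasurable) ?_
  refine (ae_restrict_iff' measurableSet_Icc).2 (Eventually.of_forall fun s hs => ?_)
  rw [norm_smul]
  exact mul_le_mul_of_nonneg_right (hC s hs) (norm_nonneg _)

theorem BoundedVariationOn.inner_intervalIntegrable {f g : ℝ → E3} {a b : ℝ} (hab : a ≤ b)
    (hf : BoundedVariationOn f (Icc a b)) (hg : IntervalIntegrable g volume a b) :
    IntervalIntegrable (fun s => inner ℝ (f s) (g s)) volume a b := by
  obtain ⟨C, hC0, hC⟩ := hf.exists_norm_le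
  have hfi := hf.intervalIntegrable_E3 hab
  rw [intervalIntegrable_iff_integrableOn_Icc_of_le hab] at *
  refine Integrable.mono' (hg.norm.const_mul C)
    (hfi.aestronglyMeasurable.inner hg.aestronglyMeasurable) ?_
  refine (ae_restrict_iff' measurableSet_Icc).2 (Eventually.of_forall fun s hs => ?_)
  exact (norm_inner_le_norm _ _).trans (mul_le_mul_of_nonneg_right (hC s hs) (norm_nonneg _))

/-- A segment `[a, b]` of the orbit `Q` all of whose events have, in the direction `σ`, a light-cone
foot on the orbit `X`, which it does not meet. -/
structure IsConeSeg (X : TimeOrbit) (κ σ : ℝ) (Q : FourOrbit) (a b : ℝ) : Prop where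
  orbit : X.IsXBVWith κ
  sign : IsSign σ
  curve : Q.IsTBVXBV
  lt : a < b
  lo_le : Q.lo ≤ a
  le_hi : b ≤ Q.hi
  exists_onCone : ∀ s ∈ Icc a b, ∃ τ, X.OnCone σ (Q.t s) (Q.x s) τ
  ne : ∀ s ∈ Icc a b, ∀ τ ∈ Icc X.lo X.hi, (Q.t s, Q.x s) ≠ (τ, X.x τ)

namespace IsConeSeg

variable {X : TimeOrbit} {κ σ : ℝ} {Q : FourOrbit} {a b : ℝ} (h : IsConeSeg X κ σ Q a b)
include h

theorem mono {a' b' : ℝ} (hab : a' < b') (ha : a ≤ a') (hb : b' ≤ b) :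
    IsConeSeg X κ σ Q a' b' :=
  ⟨h.orbit, h.sign, h.curve, hab, h.lo_le.trans ha, hb.trans h.le_hi,
    fun s hs => h.exists_onCone s (Icc_subset_Icc ha hb hs),
    fun s hs => h.ne s (Icc_subset_Icc ha hb hs)⟩

theorem subset : Icc a b ⊆ Icc Q.lo Q.hi := Icc_subset_Icc h.lo_le h.le_hi

theorem subset_Ioo : Ioo a b ⊆ Ioo Q.lo Q.hi := Ioo_subset_Ioo h.lo_le h.le_hi

theorem onCone {s : ℝ} (hs : s ∈ Icc a b) :
    X.OnCone σ (Q.t s) (Q.x s) (X.coneTime σ (Q.t s) (Q.x s)) :=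
  TimeOrbit.coneTime_spec (h.exists_onCone s hs)

/-- On the light cone, equal positions force equal times, hence a collision. -/
theorem x_ne {s : ℝ} (hs : s ∈ Icc a b) : Q.x s ≠ X.x (X.coneTime σ (Q.t s) (Q.x s)) := by
  intro heq
  have h1 := h.onCone hs
  refine h.ne s hs _ h1.1 (Prod.ext ?_ heq)
  have h2 := h1.2
  rw [← heq, sub_self, norm_zero, mul_zero, add_zero] at h2
  exact h2.symm

/-- Continuity is the Lipschitz dependence on the event; the lower rate multiplies that of
`sub_le_of_timelike` by the lower bound for `t'`. Monotonicity serves for bounded variation,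
expansion for null sets. -/
theorem exists_isExpanding_coneTime :
    ∃ c, IsExpanding (fun s => X.coneTime σ (Q.t s) (Q.x s)) a b c := by
  obtain ⟨κ', hκ'0, hκ', -, htl⟩ := h.curve.exists_timelike
  obtain ⟨c, hc⟩ := h.curve.time.exists_isExpanding
  obtain ⟨K, hK⟩ := h.curve.time.exists_lipschitzOnWith
  have hκ := h.orbit.nonneg
  have hcoef : 0 < (1 - κ') / (1 + κ) := div_pos (by linarith) (by linarith)
  have hmono : ∀ s ∈ Icc a b, ∀ s' ∈ Icc a b, s ≤ s' → Q.t s ≤ Q.t s' := fun s hs s' hs' hss =>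
    hc.strictMonoOn.monotoneOn (h.subset hs) (h.subset hs') hss
  refine ⟨(1 - κ') / (1 + κ) * c, h.lt.le, mul_pos hcoef hc.pos, ?_, ?_⟩
  · have hpos : 0 < 1 - κ := sub_pos.2 h.orbit.lt_one
    have key : ∀ s ∈ Icc a b, ∀ s' ∈ Icc a b, s ≤ s' →
        |X.coneTime σ (Q.t s') (Q.x s') - X.coneTime σ (Q.t s) (Q.x s)| ≤
          (1 - κ)⁻¹ * ((1 + κ') * K) * |s' - s| := by
      intro s hs s' hs' hss
      have h1 := h.orbit.abs_sub_le_of_onCone h.sign (h.onCone hs') (h.onCone hs)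
      have h2 := htl s (h.subset hs) s' (h.subset hs') hss
      have h3 := hK.dist_le_mul s' (h.subset hs') s (h.subset hs)
      rw [Real.dist_eq, Real.dist_eq] at h3
      rw [← abs_of_nonneg (sub_nonneg.2 (hmono s hs s' hs' hss))] at h2
      rw [mul_assoc, inv_mul_eq_div, le_div_iff₀ hpos, mul_comm]
      refine h1.trans ?_
      calc _ ≤ |Q.t s' - Q.t s| + κ' * |Q.t s' - Q.t s| := by gcongr
        _ = (1 + κ') * |Q.t s' - Q.t s| := by ring
        _ ≤ (1 + κ') * (K * |s' - s|) := by gcongr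
        _ = _ := by ring
    refine (LipschitzOnWith.of_dist_le_mul (K := Real.toNNReal ((1 - κ)⁻¹ * ((1 + κ') * K)))
      fun s hs s' hs' => ?_).continuousOn
    have hnn : 0 ≤ (1 - κ)⁻¹ * ((1 + κ') * K) :=
      mul_nonneg (inv_nonneg.2 hpos.le) (mul_nonneg (by linarith) K.coe_nonneg)
    rw [Real.coe_toNNReal _ hnn, Real.dist_eq, Real.dist_eq]
    rcases le_total s s' with hss | hss
    · rw [abs_sub_comm, abs_sub_comm s]; exact key s hs s' hs' hss
    · exact key s' hs' s hs hss
  · intro s hs s' hs' hss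
    have h1 := h.orbit.sub_le_of_timelike h.sign hκ' (hmono s hs s' hs' hss)
      (htl s (h.subset hs) s' (h.subset hs') hss) (h.onCone hs) (h.onCone hs')
    refine le_trans ?_ h1
    rw [mul_assoc]
    gcongr
    exact hc.lower s (h.subset hs) s' (h.subset hs') hss

theorem coneTime_mem_Ioo {s : ℝ} (hs : s ∈ Ioo a b) :
    X.coneTime σ (Q.t s) (Q.x s) ∈ Ioo X.lo X.hi := by
  obtain ⟨c, hc⟩ := h.exists_isExpanding_coneTime
  have h1 := hc.mapsTo_Ioo hs
  exact ⟨(h.onCone ⟨le_rfl, h.lt.le⟩).1.1.trans_lt h1.1,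
    h1.2.trans_le (h.onCone ⟨h.lt.le, le_rfl⟩).1.2⟩

theorem boundedVariationOn_comp_coneTime {E : Type*} [PseudoMetricSpace E] {f : ℝ → E}
    (hf : BoundedVariationOn f (Icc X.lo X.hi)) :
    BoundedVariationOn (fun s => f (X.coneTime σ (Q.t s) (Q.x s))) (Icc a b) := by
  obtain ⟨c, hc⟩ := h.exists_isExpanding_coneTime
  exact hf.comp_monotoneOn hc.strictMonoOn.monotoneOn fun s hs => (h.onCone hs).1

theorem boundedVariationOn_sub :
    BoundedVariationOn (fun s => Q.x s - X.x (X.coneTime σ (Q.t s) (Q.x s))) (Icc a b) := by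
  obtain ⟨K, hK⟩ := h.curve.exists_lipschitzOnWith_x
  exact (hK.boundedVariationOn_Icc.mono h.subset).fun_sub
    (h.boundedVariationOn_comp_coneTime h.orbit.lipschitzOnWith_x.boundedVariationOn_Icc)

/-- A continuous positive function on a compact interval attains a positive minimum; positivity is
the absence of collisions. -/
theorem exists_le_norm :
    ∃ r₀ > 0, ∀ s ∈ Icc a b, r₀ ≤ ‖Q.x s - X.x (X.coneTime σ (Q.t s) (Q.x s))‖ := by
  obtain ⟨c, hc⟩ := h.exists_isExpanding_coneTime
  obtain ⟨K, hK⟩ := h.curve.exists_lipschitzOnWith_x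
  have hcont : ContinuousOn (fun s => ‖Q.x s - X.x (X.coneTime σ (Q.t s) (Q.x s))‖) (Icc a b) :=
    ((hK.continuousOn.mono h.subset).sub (h.orbit.lipschitzOnWith_x.continuousOn.comp hc.cont
      fun s hs => (h.onCone hs).1)).norm
  obtain ⟨s₀, hs₀, hmin⟩ := isCompact_Icc.exists_isMinOn (nonempty_Icc.2 h.lt.le) hcont
  exact ⟨_, norm_pos_iff.2 (sub_ne_zero.2 (h.x_ne hs₀)), fun s hs => hmin hs⟩

theorem exists_le_coneDen : ∃ c > 0, ∀ s ∈ Icc a b, c ≤ coneDen σ X (Q.t s) (Q.x s) := by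
  obtain ⟨r₀, hr₀, hr⟩ := h.exists_le_norm
  have hpos : 0 < 1 - κ := sub_pos.2 h.orbit.lt_one
  refine ⟨2 * (1 - κ) * r₀, by positivity, fun s hs => ?_⟩
  refine le_trans ?_ (h.orbit.le_coneDen h.sign (h.onCone hs))
  have := hr s hs
  gcongr

theorem boundedVariationOn_coneDen :
    BoundedVariationOn (fun s => coneDen σ X (Q.t s) (Q.x s)) (Icc a b) := by
  simp only [TimeOrbit.coneDen_eq]
  have hz := h.boundedVariationOn_sub
  exact (boundedVariationOn_const _).fun_mul (hz.fun_norm.fun_add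
    ((boundedVariationOn_const _).fun_mul
      (hz.fun_inner (h.boundedVariationOn_comp_coneTime h.orbit.isXBV.bv))))

theorem boundedVariationOn_pot :
    BoundedVariationOn (fun s => X.pot σ (Q.t s, Q.x s)) (Icc a b) := by
  obtain ⟨c, hc, hb⟩ := h.exists_le_coneDen
  exact h.boundedVariationOn_coneDen.fun_inv hc hb

theorem boundedVariationOn_vpot :
    BoundedVariationOn (fun s => X.vpot σ (Q.t s, Q.x s)) (Icc a b) :=
  h.boundedVariationOn_pot.fun_smul (h.boundedVariationOn_comp_coneTime h.orbit.isXBV.bv)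

/-- Off a countable set the foot of the light cone is differentiable along the orbit. -/
theorem exists_countable_hasDerivAt_coneTime :
    ∃ N : Set ℝ, N.Countable ∧ ∀ s ∈ Ioo a b \ N,
      HasDerivAt (fun s => X.coneTime σ (Q.t s) (Q.x s)) ((coneDen σ X (Q.t s) (Q.x s))⁻¹ *
        (2 * ‖Q.x s - X.x (X.coneTime σ (Q.t s) (Q.x s))‖ * Q.dt s + 2 * σ *
          inner ℝ (Q.x s - X.x (X.coneTime σ (Q.t s) (Q.x s))) (Q.dx s))) s := by
  obtain ⟨c, hc⟩ := h.exists_isExpanding_coneTime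
  have c1 := (h.curve.time.bv.mono h.subset).countable_not_continuousAt
  have c2 := (h.curve.bv.mono h.subset).countable_not_continuousAt
  have c3 := h.orbit.isXBV.bv.countable_not_continuousAt
  set M := {x ∈ Ioo X.lo X.hi | ¬ ContinuousAt X.v x}
  -- The foot map is injective, so only countably many parameters have their foot at a discontinuity
  -- of the velocity.
  have c4 : (Icc a b ∩ (fun s => X.coneTime σ (Q.t s) (Q.x s)) ⁻¹' M).Countable := by
    refine countable_of_injective_of_countable_image
      (hc.strictMonoOn.injOn.mono inter_subset_left) (c3.mono ?_)
    rintro _ ⟨s, hs, rfl⟩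
    exact hs.2
  refine ⟨_, (c1.union c2).union c4, fun s hs => ?_⟩
  have hsI := Ioo_subset_Icc_self hs.1
  have hdt : ContinuousAt Q.dt s := not_not.1 fun hn => hs.2 (Or.inl (Or.inl ⟨hs.1, hn⟩))
  have hdx : ContinuousAt Q.dx s := not_not.1 fun hn => hs.2 (Or.inl (Or.inr ⟨hs.1, hn⟩))
  have hv : ContinuousAt X.v (X.coneTime σ (Q.t s) (Q.x s)) := not_not.1 fun hn =>
    hs.2 (Or.inr ⟨hsI, h.coneTime_mem_Ioo hs.1, hn⟩)
  have hQ := (h.curve.time.hasDerivAt (h.subset_Ioo hs.1) hdt).prodMk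
    (h.curve.hasDerivAt_x (h.subset_Ioo hs.1) hdx)
  have hF := h.orbit.hasFDerivAt_coneTime (e₀ := (Q.t s, Q.x s)) h.sign (h.onCone hsI)
    (h.coneTime_mem_Ioo hs.1) (h.x_ne hsI) hv
  have := hF.comp_hasDerivAt s hQ
  refine this.congr_deriv ?_
  simp [inner_sub_left]
  ring

/-- Almost everywhere along the orbit the potentials are differentiable; their directional
derivatives, in terms of the derivative `w` of the velocity at the foot. -/
theorem ae_hasFDerivAt_pot : ∀ᵐ s, s ∈ Icc a b →
    DifferentiableAt ℝ (X.pot σ) (Q.t s, Q.x s) ∧ DifferentiableAt ℝ (X.vpot σ) (Q.t s, Q.x s) ∧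
    ∀ d : ℝ × E3, ∀ D θ : ℝ, ∀ z w : E3, D = coneDen σ X (Q.t s) (Q.x s) →
      z = Q.x s - X.x (X.coneTime σ (Q.t s) (Q.x s)) →
      θ = D⁻¹ * (2 * ‖z‖ * d.1 + 2 * σ * inner ℝ z d.2) →
      w = deriv X.v (X.coneTime σ (Q.t s) (Q.x s)) →
      fderiv ℝ (X.pot σ) (Q.t s, Q.x s) d = -(D⁻¹ * D⁻¹) * (2 * σ * (θ - d.1 +
        (inner ℝ (d.2 - θ • X.v (X.coneTime σ (Q.t s) (Q.x s)))
          (X.v (X.coneTime σ (Q.t s) (Q.x s))) + inner ℝ z (θ • w)))) ∧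
      fderiv ℝ (X.vpot σ) (Q.t s, Q.x s) d = D⁻¹ • θ • w +
        fderiv ℝ (X.pot σ) (Q.t s, Q.x s) d • X.v (X.coneTime σ (Q.t s) (Q.x s)) := by
  obtain ⟨c, hc⟩ := h.exists_isExpanding_coneTime
  have h1 := h.orbit.isXBV.bv.ae_differentiableAt_Icc h.orbit.isXBV.lt.le
  have h2 := hc.ae_comp (p := fun r => DifferentiableAt ℝ X.v r) (by
    filter_upwards [h1] with r hr hrI
    exact hr ⟨(h.onCone ⟨le_rfl, h.lt.le⟩).1.1.trans hrI.1,
      hrI.2.trans (h.onCone ⟨h.lt.le, le_rfl⟩).1.2⟩)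
  -- Off the two end points the foot is interior to orbit `X`, as differentiation requires.
  have ha : ∀ᵐ s : ℝ, s ≠ a := by simp [ae_iff, measure_singleton]
  have hb : ∀ᵐ s : ℝ, s ≠ b := by simp [ae_iff, measure_singleton]
  filter_upwards [h2, ha, hb] with s hs hsa hsb hsI
  have hsO : s ∈ Ioo a b := ⟨lt_of_le_of_ne hsI.1 (Ne.symm hsa), lt_of_le_of_ne hsI.2 hsb⟩
  obtain ⟨Φ', A', hΦ, hA, hform⟩ := h.orbit.exists_hasFDerivAt_pot (e₀ := (Q.t s, Q.x s)) h.sign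
    (h.onCone hsI) (h.coneTime_mem_Ioo hsO) (h.x_ne hsI) (hs hsI).hasDerivAt
  refine ⟨hΦ.differentiableAt, hA.differentiableAt, ?_⟩
  rintro d D θ z w hD rfl hθ rfl
  rw [hΦ.fderiv, hA.fderiv]
  exact hform d D θ hD hθ

/-- In the explicit formulas every factor has bounded variation except the acceleration at the foot,
which enters affinely and is integrable. -/
theorem intervalIntegrable_fderiv_pot (d : ℝ × E3) :
    IntervalIntegrable (fun s => fderiv ℝ (X.pot σ) (Q.t s, Q.x s) d) volume a b ∧
    IntervalIntegrable (fun s => fderiv ℝ (X.vpot σ) (Q.t s, Q.x s) d) volume a b := by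
  have hab := h.lt.le
  obtain ⟨c, hc⟩ := h.exists_isExpanding_coneTime
  have hz := h.boundedVariationOn_sub
  have hv := h.boundedVariationOn_comp_coneTime h.orbit.isXBV.bv
  have hDi := h.boundedVariationOn_pot
  simp only [TimeOrbit.pot] at hDi
  have hk : ∀ k : ℝ, BoundedVariationOn (fun _ : ℝ => k) (Icc a b) := boundedVariationOn_const
  have hθ : BoundedVariationOn (fun s => (coneDen σ X (Q.t s) (Q.x s))⁻¹ *
      (2 * ‖Q.x s - X.x (X.coneTime σ (Q.t s) (Q.x s))‖ * d.1 + 2 * σ *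
        inner ℝ (Q.x s - X.x (X.coneTime σ (Q.t s) (Q.x s))) d.2)) (Icc a b) :=
    hDi.fun_mul ((((hk 2).fun_mul hz.fun_norm).fun_mul (hk d.1)).fun_add
      ((hk (2 * σ)).fun_mul (hz.fun_inner (boundedVariationOn_const d.2))))
  -- The derivative of a function of bounded variation is integrable, and the expanding foot map
  -- preserves integrability under composition.
  have hw : IntervalIntegrable (fun s => deriv X.v (X.coneTime σ (Q.t s) (Q.x s))) volume a b := by
    refine hc.intervalIntegrable_comp
      ((h.orbit.isXBV.bv.intervalIntegrable_deriv_E3 h.orbit.isXBV.lt.le).mono_set ?_)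
    have hle := hc.strictMonoOn.monotoneOn ⟨le_rfl, hab⟩ ⟨hab, le_rfl⟩ hab
    rw [uIcc_of_le hle, uIcc_of_le h.orbit.isXBV.lt.le]
    exact Icc_subset_Icc (h.onCone ⟨le_rfl, hab⟩).1.1 (h.onCone ⟨hab, le_rfl⟩).1.2
  have hmain := ((hk (-1)).fun_mul (hDi.fun_mul hDi)).fun_mul (hk (2 * σ))
  have hθw := hθ.smul_intervalIntegrable hab hw
  have hpot : IntervalIntegrable (fun s => fderiv ℝ (X.pot σ) (Q.t s, Q.x s) d) volume a b := by
    have i1 := hmain.smul_intervalIntegrable hab ((((hθ.fun_sub (hk d.1)).fun_add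
      (((boundedVariationOn_const d.2).fun_sub (hθ.fun_smul hv)).fun_inner
        hv)).intervalIntegrable_real hab).add (hz.inner_intervalIntegrable hab hθw))
    refine i1.congr_ae ?_
    rw [EventuallyEq, ae_restrict_iff' measurableSet_uIoc]
    filter_upwards [h.ae_hasFDerivAt_pot] with s hs hsI
    rw [uIoc_of_le hab] at hsI
    rw [((hs (Ioc_subset_Icc_self hsI)).2.2 d _ _ _ _ rfl rfl rfl rfl).1, smul_eq_mul]
    ring
  refine ⟨hpot, ?_⟩
  have i2 := (hDi.smul_intervalIntegrable hab hθw).add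
    (intervalIntegrable_of_coord fun k => ?_ : IntervalIntegrable (fun s =>
      fderiv ℝ (X.pot σ) (Q.t s, Q.x s) d • X.v (X.coneTime σ (Q.t s) (Q.x s))) volume a b)
  · refine i2.congr_ae ?_
    rw [EventuallyEq, ae_restrict_iff' measurableSet_uIoc]
    filter_upwards [h.ae_hasFDerivAt_pot] with s hs hsI
    rw [uIoc_of_le hab] at hsI
    rw [((hs (Ioc_subset_Icc_self hsI)).2.2 d _ _ _ _ rfl rfl rfl rfl).2]
  · have := (hv.coord k).smul_intervalIntegrable hab hpot
    refine this.congr fun s _ => ?_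
    simp [mul_comm]

end IsConeSeg

end ConeSegment

/-! ### Passage between the parameter and the time. -/

section Reparametrisation

open Filter
open scoped Topology NNReal ENNReal

theorem outerSign_isSign (i : Fin 2) : IsSign (outerSign i) := by
  match i with
  | 0 => exact Or.inr rfl
  | 1 => exact Or.inl rfl

/-- Integration along an orbit, in the parameter and in the time. -/
theorem IsTBV.integral_comp {E : Type*} [NormedAddCommGroup E] [NormedSpace ℝ E] {lo hi : ℝ}
    {t dt : ℝ → ℝ} (h : IsTBV lo hi t dt) {a b : ℝ} (ha : lo ≤ a) (hab : a ≤ b) (hb : b ≤ hi)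
    (g : ℝ → E) : ∫ s in a..b, dt s • g (t s) = ∫ r in (t a)..(t b), g r := by
  obtain ⟨c, hc⟩ := h.exists_isExpanding
  have hN := h.bv.countable_not_continuousAt
  refine (hc.mono hab ha hb).integral_comp hN (fun s hs => ?_) g
  have hs' : s ∈ Ioo lo hi := Ioo_subset_Ioo ha hb hs.1
  exact h.hasDerivAt hs' (not_not.1 fun hn => hs.2 ⟨hs', hn⟩)

theorem TimeOrbit.IsXBV.reparam_isTBVXBV {X : TimeOrbit} (hX : X.IsXBV) {lo hi : ℝ}
    {t dt : ℝ → ℝ} (h : IsTBV lo hi t dt) (hlo : t lo = X.lo) (hhi : t hi = X.hi) :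
    (X.reparam lo hi t dt).IsTBVXBV ∧ IsReparam (X.reparam lo hi t dt) X := by
  obtain ⟨c, hc⟩ := h.exists_isExpanding
  have hmaps : MapsTo t (Icc lo hi) (Icc X.lo X.hi) := by
    rw [← hlo, ← hhi]; exact hc.mapsTo
  refine ⟨⟨h, ?_, ?_, ?_⟩, ⟨hlo, hhi, fun _ _ => rfl, fun _ _ => rfl⟩⟩
  · exact h.bv.fun_smul (hX.bv.comp_monotoneOn hc.strictMonoOn.monotoneOn hmaps)
  · intro s hs
    have := h.integral_comp le_rfl hs.1 hs.2 X.v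
    change X.x (t s) = X.x (t lo) + ∫ r in lo..s, dt r • X.v (t r)
    rw [this, hlo]
    exact hX.x_eq _ (hmaps hs)
  · obtain ⟨κ, hκ, hb⟩ := hX.subluminal
    refine ⟨κ, hκ, fun s hs => ?_⟩
    have hdt := h.dt_pos hs
    change ‖dt s • X.v (t s)‖ ≤ κ * dt s
    rw [norm_smul, Real.norm_of_nonneg hdt.le, mul_comm]
    exact mul_le_mul_of_nonneg_right (hb _ (hmaps hs)) hdt.le

theorem TimeOrbit.IsXBV.isTBV_id {X : TimeOrbit} (hX : X.IsXBV) : IsTBV X.lo X.hi id 1 where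
  lt := hX.lt
  bv := boundedVariationOn_const 1
  t_eq s _ := by simp
  pos := ⟨1, one_pos, fun _ _ => le_rfl⟩

namespace FourOrbit.IsTBVXBV

variable {Q : FourOrbit} (h : Q.IsTBVXBV)
include h

theorem exists_inverse_time : ∃ (ψ : ℝ → ℝ) (K : ℝ≥0), (∀ s ∈ Icc Q.lo Q.hi, ψ (Q.t s) = s) ∧
    MapsTo ψ (Icc (Q.t Q.lo) (Q.t Q.hi)) (Icc Q.lo Q.hi) ∧
    (∀ r ∈ Icc (Q.t Q.lo) (Q.t Q.hi), Q.t (ψ r) = r) ∧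
    MonotoneOn ψ (Icc (Q.t Q.lo) (Q.t Q.hi)) ∧
    LipschitzOnWith K ψ (Icc (Q.t Q.lo) (Q.t Q.hi)) := by
  obtain ⟨c, hc⟩ := h.time.exists_isExpanding
  have hψ : ∀ s ∈ Icc Q.lo Q.hi, Function.invFunOn Q.t (Icc Q.lo Q.hi) (Q.t s) = s := fun s hs =>
    hc.strictMonoOn.injOn.leftInvOn_invFunOn hs
  refine ⟨Function.invFunOn Q.t (Icc Q.lo Q.hi), Real.toNNReal c⁻¹, hψ, ?_, ?_, ?_, ?_⟩ <;>
    rw [← hc.image_Icc]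
  · rintro _ ⟨s, hs, rfl⟩; rwa [hψ s hs]
  · rintro _ ⟨s, hs, rfl⟩; rw [hψ s hs]
  · rintro _ ⟨s, hs, rfl⟩ _ ⟨s', hs', rfl⟩ hle
    rw [hψ s hs, hψ s' hs']
    exact (hc.strictMonoOn.le_iff_le hs hs').1 hle
  · refine LipschitzOnWith.of_dist_le_mul ?_
    rintro _ ⟨s, hs, rfl⟩ _ ⟨s', hs', rfl⟩
    rw [hψ s hs, hψ s' hs', Real.coe_toNNReal _ (inv_nonneg.2 hc.pos.le), inv_mul_eq_div,
      le_div_iff₀ hc.pos, Real.dist_eq, Real.dist_eq]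
    rcases le_total s s' with hss | hss
    · have := hc.lower s hs s' hs' hss
      rw [abs_sub_comm, abs_of_nonneg (sub_nonneg.2 hss), abs_sub_comm (Q.t s)]
      exact (by linarith : _ ≤ Q.t s' - Q.t s).trans (le_abs_self _)
    · have := hc.lower s' hs' s hs hss
      rw [abs_of_nonneg (sub_nonneg.2 hss)]
      exact (by linarith : _ ≤ Q.t s - Q.t s').trans (le_abs_self _)

theorem boundedVariationOn_inv_dt : BoundedVariationOn (fun s => (Q.dt s)⁻¹) (Icc Q.lo Q.hi) := by
  obtain ⟨c, hc, hb⟩ := h.time.pos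
  exact h.time.bv.fun_inv hc hb

/-- The velocity is `x' / t'` composed with the increasing inverse of `t(·)`; each defining property
transfers through this formula. -/
theorem isXBV {X : TimeOrbit} (hR : IsReparam Q X) : X.IsXBV := by
  obtain ⟨ψ, K, hψ, hmaps, htψ, hmono, -⟩ := h.exists_inverse_time
  obtain ⟨c, hc⟩ := h.time.exists_isExpanding
  have hlo : Q.lo ∈ Icc Q.lo Q.hi := ⟨le_rfl, h.time.lt.le⟩
  have hhi : Q.hi ∈ Icc Q.lo Q.hi := ⟨h.time.lt.le, le_rfl⟩
  have hv : ∀ s ∈ Icc Q.lo Q.hi, X.v (Q.t s) = (Q.dt s)⁻¹ • Q.dx s := fun s hs => by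
    rw [hR.dx_eq s hs, inv_smul_smul₀ (h.time.dt_pos hs).ne']
  refine ⟨?_, ?_, ?_, ?_⟩ <;> rw [← hR.lo_eq, ← hR.hi_eq]
  · exact hc.strictMonoOn hlo hhi h.time.lt
  · refine ((h.boundedVariationOn_inv_dt.fun_smul h.bv).comp_monotoneOn hmono hmaps).congr_on
      fun r hr => ?_
    rw [← hv _ (hmaps hr), htψ r hr]
  · intro r hr
    have hs := hmaps hr
    have h1 := h.time.integral_comp le_rfl hs.1 hs.2 X.v
    rw [htψ r hr] at h1
    rw [← h1, ← hR.x_eq _ hlo]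
    conv_lhs => rw [← htψ r hr]
    rw [← hR.x_eq _ hs, h.x_eq _ hs]
    congr 1
    refine intervalIntegral.integral_congr fun u hu => ?_
    rw [uIcc_of_le hs.1] at hu
    exact hR.dx_eq u ⟨hu.1, hu.2.trans hs.2⟩
  · obtain ⟨κ, hκ, hb⟩ := h.subluminal
    refine ⟨κ, hκ, fun r hr => ?_⟩
    have hs := hmaps hr
    have hdt := h.time.dt_pos hs
    rw [← htψ r hr, hv _ hs, norm_smul, norm_inv, Real.norm_of_nonneg hdt.le, inv_mul_eq_div,
      div_le_iff₀ hdt]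
    exact hb _ hs

theorem exists_isReparam : ∃ X : TimeOrbit, X.IsXBV ∧ IsReparam Q X := by
  obtain ⟨ψ, K, hψ, hmaps, htψ, hmono, -⟩ := h.exists_inverse_time
  let X : TimeOrbit := ⟨Q.t Q.lo, Q.t Q.hi, fun r => Q.x (ψ r), fun r => (Q.dt (ψ r))⁻¹ • Q.dx (ψ r)⟩
  have hR : IsReparam Q X := by
    refine ⟨rfl, rfl, fun s hs => ?_, fun s hs => ?_⟩
    · simp only [X, hψ s hs]
    · simp only [X, hψ s hs]
      rw [smul_inv_smul₀ (h.time.dt_pos hs).ne']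
  exact ⟨X, h.isXBV hR, hR⟩

end FourOrbit.IsTBVXBV

/-! ### Light cones and Lagrangians under reparametrisation -/

/-- One event lies on the future cone of another exactly when the latter lies on its past cone. -/
theorem FourOrbit.OnCone.swap {Q Q' : FourOrbit} {σ s s' : ℝ}
    (h : Q.OnCone σ (Q'.t s') (Q'.x s') s) (hs' : s' ∈ Icc Q'.lo Q'.hi) :
    Q'.OnCone (-σ) (Q.t s) (Q.x s) s' := by
  refine ⟨hs', ?_⟩
  have := h.2
  rw [norm_sub_rev]
  linarith

namespace IsReparam

variable {Q : FourOrbit} {X : TimeOrbit} (hR : IsReparam Q X) (hQ : Q.IsTBVXBV)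
include hR hQ

theorem mapsTo : MapsTo Q.t (Icc Q.lo Q.hi) (Icc X.lo X.hi) := by
  obtain ⟨c, hc⟩ := hQ.time.exists_isExpanding
  rw [← hR.lo_eq, ← hR.hi_eq]
  exact hc.mapsTo

theorem onCone {σ T : ℝ} {y : E3} {s : ℝ} (h : Q.OnCone σ T y s) : X.OnCone σ T y (Q.t s) :=
  ⟨hR.mapsTo hQ h.1, by rw [← hR.x_eq s h.1]; exact h.2⟩

theorem exists_onCone {σ T : ℝ} {y : E3} (h : ∃ τ, X.OnCone σ T y τ) : ∃ s, Q.OnCone σ T y s := by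
  obtain ⟨τ, hτ, h2⟩ := h
  obtain ⟨c, hc⟩ := hQ.time.exists_isExpanding
  rw [← hR.lo_eq, ← hR.hi_eq, ← hc.image_Icc] at hτ
  obtain ⟨s, hs, rfl⟩ := hτ
  exact ⟨s, hs, by rw [hR.x_eq s hs]; exact h2⟩

theorem existsUnique_onCone {σ T : ℝ} {y : E3} (hσ : IsSign σ) (h : ∃ τ, X.OnCone σ T y τ) :
    ∃! s, Q.OnCone σ T y s := by
  obtain ⟨κ, hκ⟩ := (hQ.isXBV hR).exists_isXBVWith
  obtain ⟨c, hc⟩ := hQ.time.exists_isExpanding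
  obtain ⟨s, hs⟩ := hR.exists_onCone hQ h
  refine ⟨s, hs, fun s' hs' => hc.strictMonoOn.injOn hs'.1 hs.1 ?_⟩
  exact hκ.onCone_unique hσ (hR.onCone hQ hs') (hR.onCone hQ hs)

/-- The derivative of the time function at the foot is a common factor of numerator and denominator
and cancels. What remains is linear in `(τ, u)` and independent of the parametrisation of the other
particle. -/
theorem interLagExt_eq {σ T : ℝ} {y : E3} (hσ : IsSign σ) (h : ∃ τ, X.OnCone σ T y τ) (τ : ℝ)
    (u : E3) :
    interLagExt σ Q T y τ u = τ * X.pot σ (T, y) - inner ℝ u (X.vpot σ (T, y)) := by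
  obtain ⟨κ, hκ⟩ := (hQ.isXBV hR).exists_isXBVWith
  have hs : Q.OnCone σ T y (Q.conePar σ T y) := Classical.epsilon_spec (hR.exists_onCone hQ h)
  have ht := hκ.coneTime_eq hσ (hR.onCone hQ hs)
  have hdt := hQ.time.dt_pos hs.1
  rw [interLagExt, hR.x_eq _ hs.1, hR.dx_eq _ hs.1, ← ht, TimeOrbit.pot, TimeOrbit.vpot, coneDen,
    real_inner_smul_right, real_inner_smul_right, real_inner_smul_right]
  set s := Q.conePar σ T y
  set r := X.coneTime σ T y
  have e1 : τ * Q.dt s - Q.dt s * inner ℝ u (X.v r) = Q.dt s * (τ - inner ℝ u (X.v r)) := by ring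
  have e2 : 2 * ‖y - X.x r‖ * (Q.dt s + σ * (Q.dt s * inner ℝ (unitVec y (X.x r)) (X.v r))) =
    Q.dt s * (2 * ‖y - X.x r‖ * (1 + σ * inner ℝ (unitVec y (X.x r)) (X.v r))) := by ring
  rw [e1, e2, mul_div_mul_left _ _ hdt.ne', div_eq_mul_inv]
  ring

theorem partialLagExt_eq {m T : ℝ} {y : E3} (h : ∃ τ, X.OnCone (-1) T y τ)
    (h' : ∃ τ, X.OnCone 1 T y τ) (τ : ℝ) (u : E3) :
    partialLagExt m Q T y τ u =
      localLagExt m τ u + τ * scalPot X T y - inner ℝ u (vecPot X T y) := by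
  rw [partialLagExt, hR.interLagExt_eq hQ (Or.inr rfl) h, hR.interLagExt_eq hQ (Or.inl rfl) h',
    scalPot_eq, vecPot_eq, inner_add_right]
  ring

end IsReparam

theorem localLagExt_smul (m : ℝ) {τ : ℝ} (hτ : 0 < τ) (v : E3) :
    localLagExt m τ (τ • v) = τ * localLag m v := by
  have e : τ ^ 2 - ‖τ • v‖ ^ 2 = τ ^ 2 * (1 - ‖v‖ ^ 2) := by
    rw [norm_smul, Real.norm_of_nonneg hτ.le]; ring
  rw [localLagExt, localLag, e, Real.sqrt_mul (sq_nonneg τ), Real.sqrt_sq hτ.le]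
  ring

/-- Between two events of a timelike orbit the cone function at fixed foot changes by less than the
elapsed time or exactly as much. The end-value inequalities that give a foot thus propagate forward
from `a` and backward from `b`. -/
theorem IsConeSeg.of_endpoints {X : TimeOrbit} {κ σ : ℝ} {Q : FourOrbit} {a b : ℝ}
    (hX : X.IsXBVWith κ) (hσ : IsSign σ) (hQ : Q.IsTBVXBV) (hab : a < b) (ha : Q.lo ≤ a)
    (hb : b ≤ Q.hi) (h1 : ∃ τ, X.OnCone σ (Q.t a) (Q.x a) τ)
    (h2 : ∃ τ, X.OnCone σ (Q.t b) (Q.x b) τ)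
    (hne : ∀ s ∈ Icc Q.lo Q.hi, ∀ τ ∈ Icc X.lo X.hi, (Q.t s, Q.x s) ≠ (τ, X.x τ)) :
    IsConeSeg X κ σ Q a b := by
  have hsub : Icc a b ⊆ Icc Q.lo Q.hi := Icc_subset_Icc ha hb
  refine ⟨hX, hσ, hQ, hab, ha, hb, fun s hs => ?_, fun s hs => hne s (hsub hs)⟩
  obtain ⟨κ', hκ'0, hκ', -, htl⟩ := hQ.exists_timelike
  obtain ⟨c, hc⟩ := hQ.time.exists_isExpanding
  obtain ⟨τ₁, hτ₁⟩ := h1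
  obtain ⟨τ₂, hτ₂⟩ := h2
  rw [TimeOrbit.onCone_iff] at hτ₁ hτ₂
  have ha' : a ∈ Icc a b := ⟨le_rfl, hab.le⟩
  have hb' : b ∈ Icc a b := ⟨hab.le, le_rfl⟩
  have step : ∀ u ∈ Icc a b, ∀ u' ∈ Icc a b, u ≤ u' → ‖Q.x u' - Q.x u‖ ≤ Q.t u' - Q.t u := by
    intro u hu u' hu' huu
    have h3 := htl u (hsub hu) u' (hsub hu') huu
    have h4 := hc.strictMonoOn.monotoneOn (hsub hu) (hsub hu') huu
    refine h3.trans ?_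
    nlinarith
  refine hX.exists_onCone hσ ?_ ?_
  · have h3 := (hX.isExpanding_coneFun hσ (Q.x a)).strictMonoOn.monotoneOn
      ⟨le_rfl, hX.isXBV.lt.le⟩ hτ₁.1 hτ₁.1.1
    have h4 := (abs_le.1 (TimeOrbit.abs_coneFun_sub_le_event (X := X) hσ (Q.x s) (Q.x a) X.lo)).2
    have h5 := step a ha' s hs hs.1
    linarith [hτ₁.2]
  · have h3 := (hX.isExpanding_coneFun hσ (Q.x b)).strictMonoOn.monotoneOn
      hτ₂.1 ⟨hX.isXBV.lt.le, le_rfl⟩ hτ₂.1.2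
    have h4 := (abs_le.1 (TimeOrbit.abs_coneFun_sub_le_event (X := X) hσ (Q.x b) (Q.x s) X.hi)).2
    have h5 := step s hs b hb' hs.2
    linarith [hτ₂.2]

end Reparametrisation

/-! ### The extended action and its two forms. -/

section BoundaryValueProblem

open Filter
open scoped Topology NNReal ENNReal

/-- The interaction integral along one orbit, as an integral over the opposite light cones along
the other one. -/
theorem IsConeSeg.integral_interAlong_eq {Q Q' : FourOrbit} {X X' : TimeOrbit} {κ σ a b : ℝ}
    (h : IsConeSeg X' κ σ Q a b) (hR : IsReparam Q X) (hQ' : Q'.IsTBVXBV)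
    (hR' : IsReparam Q' X') :
    ∫ s in a..b, interAlong σ Q Q' s =
      ∫ r in (X'.coneTime σ (Q.t a) (Q.x a))..(X'.coneTime σ (Q.t b) (Q.x b)),
        interLag (-σ) X r (X'.x r) (X'.v r) := by
  obtain ⟨c, hc⟩ := h.exists_isExpanding_coneTime
  obtain ⟨N, hN, hd⟩ := h.exists_countable_hasDerivAt_coneTime
  obtain ⟨κ₀, hX⟩ := (h.curve.isXBV hR).exists_isXBVWith
  rw [← hc.integral_comp hN hd fun r => interLag (-σ) X r (X'.x r) (X'.v r)]
  refine intervalIntegral.integral_congr fun s hs => ?_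
  rw [uIcc_of_le h.lt.le] at hs
  have hsQ := h.subset hs
  have hcone := h.onCone hs
  have hne := h.x_ne hs
  have hDpos := h.orbit.coneDen_pos h.sign hcone hne
  rw [interAlong, hR'.interLagExt_eq hQ' h.sign (h.exists_onCone s hs), interLag, hR.dx_eq s hsQ,
    TimeOrbit.pot, TimeOrbit.vpot]
  rw [hR.x_eq s hsQ] at *
  have hdt := h.curve.time.dt_pos hsQ
  set t := Q.t s
  set r := X'.coneTime σ t (X.x t)
  -- The same pair of events, read from the other particle.
  have hopp : X.OnCone (-σ) r (X'.x r) t := by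
    refine ⟨hR.mapsTo h.curve hsQ, ?_⟩
    have := hcone.2
    rw [norm_sub_rev]
    linarith
  have hD' := hX.coneDen_pos h.sign.neg hopp hne.symm
  have ht := hX.coneTime_eq h.sign.neg hopp
  have hDeq : coneDen (-σ) X r (X'.x r) =
      2 * (‖X.x t - X'.x r‖ + σ * inner ℝ (X.x t - X'.x r) (X.v t)) := by
    rw [TimeOrbit.coneDen_eq, ht, norm_sub_rev, ← neg_sub (X.x t) (X'.x r), inner_neg_left]
    ring
  -- Hence the rate of the foot is `t'` times the quotient of the opposite denominators, which
  -- replaces one denominator by the other under the substitution.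
  have e1 : 2 * ‖X.x t - X'.x r‖ * Q.dt s + 2 * σ * (Q.dt s * inner ℝ (X.x t - X'.x r) (X.v t)) =
      Q.dt s * coneDen (-σ) X r (X'.x r) := by
    rw [hDeq]; ring
  simp only [ht, smul_eq_mul, real_inner_smul_left, real_inner_smul_right]
  rw [e1, real_inner_comm (X.v t) (X'.v r)]
  field_simp

theorem interAlong_eq {Q Q' : FourOrbit} {X X' : TimeOrbit} {σ s : ℝ} (hσ : IsSign σ)
    (hR : IsReparam Q X) (hQ' : Q'.IsTBVXBV) (hR' : IsReparam Q' X') (hs : s ∈ Icc Q.lo Q.hi)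
    (h : ∃ τ, X'.OnCone σ (Q.t s) (Q.x s) τ) :
    interAlong σ Q Q' s = Q.dt s • interLag σ X' (Q.t s) (X.x (Q.t s)) (X.v (Q.t s)) := by
  rw [interAlong, hR'.interLagExt_eq hQ' hσ h, interLag_eq, hR.dx_eq s hs, hR.x_eq s hs,
    real_inner_smul_left, smul_eq_mul]
  ring

theorem localAlong_eq {Q : FourOrbit} {X : TimeOrbit} (m : ℝ) {s : ℝ} (hQ : Q.IsTBVXBV)
    (hR : IsReparam Q X) (hs : s ∈ Icc Q.lo Q.hi) :
    localAlong m Q s = Q.dt s • localLag m (X.v (Q.t s)) := by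
  rw [localAlong, hR.dx_eq s hs, localLagExt_smul m (hQ.time.dt_pos hs), smul_eq_mul]

theorem IsConeSeg.integral_interAlong_eq_time {Q Q' : FourOrbit} {X X' : TimeOrbit} {κ σ a b : ℝ}
    (h : IsConeSeg X' κ σ Q a b) (hR : IsReparam Q X) (hQ' : Q'.IsTBVXBV)
    (hR' : IsReparam Q' X') :
    ∫ s in a..b, interAlong σ Q Q' s =
      ∫ t in (Q.t a)..(Q.t b), interLag σ X' t (X.x t) (X.v t) := by
  rw [← h.curve.time.integral_comp h.lo_le h.lt.le h.le_hi]
  refine intervalIntegral.integral_congr fun s hs => ?_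
  rw [uIcc_of_le h.lt.le] at hs
  exact interAlong_eq h.sign hR hQ' hR' (h.subset hs) (h.exists_onCone s hs)

theorem FourOrbit.IsTBVXBV.integral_localAlong_eq {Q : FourOrbit} {X : TimeOrbit} (m : ℝ)
    {a b : ℝ} (hQ : Q.IsTBVXBV) (hR : IsReparam Q X) (ha : Q.lo ≤ a) (hab : a ≤ b) (hb : b ≤ Q.hi) :
    ∫ s in a..b, localAlong m Q s = ∫ t in (Q.t a)..(Q.t b), localLag m (X.v t) := by
  rw [← hQ.time.integral_comp ha hab hb fun t => localLag m (X.v t)]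
  refine intervalIntegral.integral_congr fun s hs => ?_
  rw [uIcc_of_le hab] at hs
  exact localAlong_eq m hQ hR ⟨ha.trans hs.1, hs.2.trans hb⟩

theorem IsConeSeg.boundedVariationOn_interAlong {Q Q' : FourOrbit} {X' : TimeOrbit} {κ σ a b : ℝ}
    (h : IsConeSeg X' κ σ Q a b) (hQ' : Q'.IsTBVXBV) (hR' : IsReparam Q' X') :
    BoundedVariationOn (interAlong σ Q Q') (Icc a b) := by
  refine (((h.curve.time.bv.mono h.subset).fun_mul h.boundedVariationOn_pot).fun_sub
    ((h.curve.bv.mono h.subset).fun_inner h.boundedVariationOn_vpot)).congr_on fun s hs => ?_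
  exact hR'.interLagExt_eq hQ' h.sign (h.exists_onCone s hs) _ _

/-- Uniform room inside the cone, from `‖x'‖ ≤ κ t'` and the lower bound for `t'`. It keeps the
square root smooth and its inverse of bounded variation. -/
theorem FourOrbit.IsTBVXBV.exists_le_sq_sub {Q : FourOrbit} (h : Q.IsTBVXBV) :
    ∃ c > 0, ∀ s ∈ Icc Q.lo Q.hi, c ≤ Q.dt s ^ 2 - ‖Q.dx s‖ ^ 2 := by
  obtain ⟨κ, hκ0, hκ, hb, -⟩ := h.exists_timelike
  obtain ⟨c, hc, hdt⟩ := h.time.pos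
  have h1 : 0 < 1 - κ ^ 2 := by nlinarith
  refine ⟨(1 - κ ^ 2) * c ^ 2, by positivity, fun s hs => ?_⟩
  have h2 := hb s hs
  have h3 := hdt s hs
  have h4 : ‖Q.dx s‖ ^ 2 ≤ (κ * Q.dt s) ^ 2 := pow_le_pow_left₀ (norm_nonneg _) h2 2
  have h5 : c ^ 2 ≤ Q.dt s ^ 2 := pow_le_pow_left₀ hc.le h3 2
  nlinarith

theorem FourOrbit.IsTBVXBV.boundedVariationOn_sqrt {Q : FourOrbit} (h : Q.IsTBVXBV) :
    BoundedVariationOn (fun s => Real.sqrt (Q.dt s ^ 2 - ‖Q.dx s‖ ^ 2)) (Icc Q.lo Q.hi) := by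
  obtain ⟨c, hc, hb⟩ := h.exists_le_sq_sub
  refine BoundedVariationOn.fun_sqrt ?_ hc hb
  simp only [sq]
  exact (h.time.bv.fun_mul h.time.bv).fun_sub (h.bv.fun_norm.fun_mul h.bv.fun_norm)

theorem FourOrbit.IsTBVXBV.boundedVariationOn_localAlong {Q : FourOrbit} (m : ℝ)
    (h : Q.IsTBVXBV) : BoundedVariationOn (localAlong m Q) (Icc Q.lo Q.hi) :=
  (boundedVariationOn_const m).fun_mul (h.time.bv.fun_sub h.boundedVariationOn_sqrt)

theorem freeLo_comp (Q : Fin 2 → FourOrbit) (k : Fin 2 → ℝ) (i : Fin 2) :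
    freeLo (fun j => (Q j).t (Q j).lo) (fun j => (Q j).t (k j)) i = (Q i).t (parLo Q k i) := by
  match i with
  | 0 => rfl
  | 1 => rfl

theorem freeHi_comp (Q : Fin 2 → FourOrbit) (k : Fin 2 → ℝ) (i : Fin 2) :
    freeHi (fun j => (Q j).t (Q j).hi) (fun j => (Q j).t (k j)) i = (Q i).t (parHi Q k i) := by
  match i with
  | 0 => rfl
  | 1 => rfl

theorem Fin.one_sub_one_sub (i : Fin 2) : 1 - (1 - i) = i := by
  match i with
  | 0 => rfl
  | 1 => rfl

theorem outerSign_one_sub (i : Fin 2) : outerSign (1 - i) = -outerSign i := by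
  match i with
  | 0 => exact (neg_neg (1 : ℝ)).symm
  | 1 => rfl

theorem Fin.one_sub_ne (i : Fin 2) : 1 - i ≠ i := by
  match i with
  | 0 => decide
  | 1 => decide

namespace IsBoundaryPair

variable {Q : Fin 2 → FourOrbit} {k : Fin 2 → ℝ} (h : IsBoundaryPair Q k)
include h

theorem parLo_lt_parHi (i : Fin 2) : parLo Q k i < parHi Q k i := by
  match i with
  | 0 => exact (h.k_mem 0).1
  | 1 => exact (h.k_mem 1).2

theorem lo_le_parLo (i : Fin 2) : (Q i).lo ≤ parLo Q k i := by
  match i with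
  | 0 => exact le_rfl
  | 1 => exact (h.k_mem 1).1.le

theorem parHi_le_hi (i : Fin 2) : parHi Q k i ≤ (Q i).hi := by
  match i with
  | 0 => exact (h.k_mem 0).2.le
  | 1 => exact le_rfl

theorem lo_mem (i : Fin 2) : (Q i).lo ∈ Icc (Q i).lo (Q i).hi := ⟨le_rfl, (h.mem i).time.lt.le⟩

theorem hi_mem (i : Fin 2) : (Q i).hi ∈ Icc (Q i).lo (Q i).hi := ⟨(h.mem i).time.lt.le, le_rfl⟩

/-- The light-cone relations at the end points, seen from particle `i`. -/
theorem onCone_ends (i : Fin 2) :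
    (Q (1 - i)).OnCone (outerSign i) ((Q i).t (Q i).lo) ((Q i).x (Q i).lo) (Q (1 - i)).lo ∧
    (Q (1 - i)).OnCone (outerSign i) ((Q i).t (Q i).hi) ((Q i).x (Q i).hi) (Q (1 - i)).hi ∧
    (Q (1 - i)).OnCone (-outerSign i) ((Q i).t (parLo Q k i)) ((Q i).x (parLo Q k i))
      (parLo Q k (1 - i)) ∧
    (Q (1 - i)).OnCone (-outerSign i) ((Q i).t (parHi Q k i)) ((Q i).x (parHi Q k i))
      (parHi Q k (1 - i)) := by
  have e : -(-1 : ℝ) = 1 := neg_neg 1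
  match i with
  | 0 =>
    refine ⟨h.O1_past, h.L2_future.swap (h.hi_mem 1), ?_, ?_⟩
    · change (Q 1).OnCone (-(-1)) _ _ _
      rw [e]; exact h.O1_future
    · exact h.L2_past.swap (h.hi_mem 1)
  | 1 =>
    refine ⟨?_, h.L2_future, h.O1_future.swap (h.lo_mem 0), h.L2_past⟩
    have := h.O1_past.swap (h.lo_mem 0)
    rw [e] at this
    exact this

theorem ne (i : Fin 2) {s s' : ℝ} (hs : s ∈ Icc (Q i).lo (Q i).hi)
    (hs' : s' ∈ Icc (Q (1 - i)).lo (Q (1 - i)).hi) :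
    ((Q i).t s, (Q i).x s) ≠ ((Q (1 - i)).t s', (Q (1 - i)).x s') := by
  match i with
  | 0 => exact h.noncollision s hs s' hs'
  | 1 => exact (h.noncollision s' hs' s hs).symm

variable {X : Fin 2 → TimeOrbit} (hR : ∀ i, IsReparam (Q i) (X i))
include hR

theorem ne_time (i : Fin 2) : ∀ s ∈ Icc (Q i).lo (Q i).hi,
    ∀ τ ∈ Icc (X (1 - i)).lo (X (1 - i)).hi,
      ((Q i).t s, (Q i).x s) ≠ (τ, (X (1 - i)).x τ) := by
  intro s hs τ hτ
  obtain ⟨c, hc⟩ := (h.mem (1 - i)).time.exists_isExpanding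
  rw [← (hR (1 - i)).lo_eq, ← (hR (1 - i)).hi_eq, ← hc.image_Icc] at hτ
  obtain ⟨s', hs', rfl⟩ := hτ
  rw [← (hR (1 - i)).x_eq s' hs']
  exact h.ne i hs hs'

/-- The boundary conditions supply feet at the extreme events, which is all that
`IsConeSeg.of_endpoints` requires. -/
theorem exists_isConeSeg (i : Fin 2) : ∃ κ,
    IsConeSeg (X (1 - i)) κ (outerSign i) (Q i) (Q i).lo (Q i).hi ∧
    IsConeSeg (X (1 - i)) κ (-outerSign i) (Q i) (parLo Q k i) (parHi Q k i) := by
  obtain ⟨κ, hκ⟩ := ((h.mem (1 - i)).isXBV (hR (1 - i))).exists_isXBVWith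
  obtain ⟨h1, h2, h3, h4⟩ := h.onCone_ends i
  have hc := fun {σ T : ℝ} {y : E3} {s : ℝ} (hh : (Q (1 - i)).OnCone σ T y s) =>
    (hR (1 - i)).onCone (h.mem (1 - i)) hh
  exact ⟨κ, IsConeSeg.of_endpoints hκ (outerSign_isSign i) (h.mem i) (h.mem i).time.lt le_rfl le_rfl
      ⟨_, hc h1⟩ ⟨_, hc h2⟩ (h.ne_time hR i),
    IsConeSeg.of_endpoints hκ (outerSign_isSign i).neg (h.mem i) (h.parLo_lt_parHi i)
      (h.lo_le_parLo i) (h.parHi_le_hi i) ⟨_, hc h3⟩ ⟨_, hc h4⟩ (h.ne_time hR i)⟩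

theorem actionExt_eq_action (i : Fin 2) (m : Fin 2 → ℝ) :
    actionExt i m Q k = action i m X (fun j => (Q j).t (k j)) := by
  obtain ⟨κ, h1, h2⟩ := h.exists_isConeSeg hR i
  have hl : (fun j => (X j).lo) = fun j => (Q j).t (Q j).lo := funext fun j => (hR j).lo_eq.symm
  have hh : (fun j => (X j).hi) = fun j => (Q j).t (Q j).hi := funext fun j => (hR j).hi_eq.symm
  simp only [actionExt, action]
  rw [hl, hh, freeLo_comp, freeLo_comp, freeHi_comp, freeHi_comp,
    h1.integral_interAlong_eq_time (hR i) (h.mem (1 - i)) (hR (1 - i)),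
    h2.integral_interAlong_eq_time (hR i) (h.mem (1 - i)) (hR (1 - i)),
    (h.mem i).integral_localAlong_eq (m i) (hR i) (h.lo_le_parLo i) (h.parLo_lt_parHi i).le
      (h.parHi_le_hi i),
    (h.mem (1 - i)).integral_localAlong_eq (m (1 - i)) (hR (1 - i)) (h.lo_le_parLo (1 - i))
      (h.parLo_lt_parHi (1 - i)).le (h.parHi_le_hi (1 - i)), (hR i).lo_eq, (hR i).hi_eq]

/-- The interaction integrals are carried to the other orbit by the foot map. By `onCone_ends` it
sends the limits of integration exactly to those of the other form. -/
theorem actionExt_eq_action_other (i : Fin 2) (m : Fin 2 → ℝ) :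
    actionExt i m Q k = action (1 - i) m X (fun j => (Q j).t (k j)) := by
  obtain ⟨κ, h1, h2⟩ := h.exists_isConeSeg hR i
  have hl : (fun j => (X j).lo) = fun j => (Q j).t (Q j).lo := funext fun j => (hR j).lo_eq.symm
  have hh : (fun j => (X j).hi) = fun j => (Q j).t (Q j).hi := funext fun j => (hR j).hi_eq.symm
  have hc := fun {σ T : ℝ} {y : E3} {s : ℝ} (hh : (Q (1 - i)).OnCone σ T y s) =>
    (hR (1 - i)).onCone (h.mem (1 - i)) hh
  obtain ⟨e1, e2, e3, e4⟩ := h.onCone_ends i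
  simp only [actionExt, action]
  rw [Fin.one_sub_one_sub, outerSign_one_sub, hl, hh, freeLo_comp, freeLo_comp, freeHi_comp,
    freeHi_comp, h1.integral_interAlong_eq (hR i) (h.mem (1 - i)) (hR (1 - i)),
    h2.integral_interAlong_eq (hR i) (h.mem (1 - i)) (hR (1 - i)),
    (h.mem i).integral_localAlong_eq (m i) (hR i) (h.lo_le_parLo i) (h.parLo_lt_parHi i).le
      (h.parHi_le_hi i),
    (h.mem (1 - i)).integral_localAlong_eq (m (1 - i)) (hR (1 - i)) (h.lo_le_parLo (1 - i))
      (h.parLo_lt_parHi (1 - i)).le (h.parHi_le_hi (1 - i)),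
    h1.orbit.coneTime_eq h1.sign (hc e1), h1.orbit.coneTime_eq h1.sign (hc e2),
    h1.orbit.coneTime_eq h2.sign (hc e3), h1.orbit.coneTime_eq h2.sign (hc e4),
    add_comm (∫ t in _.._, localLag (m (1 - i)) _), (hR (1 - i)).lo_eq, (hR (1 - i)).hi_eq]

end IsBoundaryPair

end BoundaryValueProblem

/-! ### Momenta, Legendre transform and their bounded variation. -/

section Momenta

open Filter
open scoped Topology NNReal ENNReal

theorem hasFDerivAt_localLagExt (m : ℝ) {τ : ℝ} {u : E3} (h : 0 < τ ^ 2 - ‖u‖ ^ 2) :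
    HasFDerivAt (fun p : ℝ × E3 => localLagExt m p.1 p.2)
      ((m * (1 - τ / Real.sqrt (τ ^ 2 - ‖u‖ ^ 2))) • ContinuousLinearMap.fst ℝ ℝ E3 +
        (m / Real.sqrt (τ ^ 2 - ‖u‖ ^ 2)) • (innerSL ℝ u).comp (ContinuousLinearMap.snd ℝ ℝ E3))
      (τ, u) := by
  have hS := Real.sqrt_pos.2 h
  have h1 := (hasFDerivAt_fst (𝕜 := ℝ) (E := ℝ) (F := E3) (p := (τ, u)))
  have h2 := (hasFDerivAt_snd (𝕜 := ℝ) (E := ℝ) (F := E3) (p := (τ, u))).norm_sq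
  have h3 := ((h1.pow 2).fun_sub h2).sqrt h.ne'
  have h4 := (h1.fun_sub h3).const_mul m
  refine h4.congr_fderiv ?_
  ext <;> simp <;> field_simp
  exact Or.inl trivial

/-- A model with frozen potentials. It serves the extended Lagrangian as it stands and the original
one at `τ = 1`. -/
theorem hasFDerivAt_lag (m Φ : ℝ) (A : E3) {τ : ℝ} {u : E3} (h : 0 < τ ^ 2 - ‖u‖ ^ 2) :
    HasFDerivAt (fun p : ℝ × E3 => localLagExt m p.1 p.2 + p.1 * Φ - inner ℝ p.2 A)
      ((m * (1 - τ / Real.sqrt (τ ^ 2 - ‖u‖ ^ 2)) + Φ) • ContinuousLinearMap.fst ℝ ℝ E3 +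
        (innerSL ℝ ((m / Real.sqrt (τ ^ 2 - ‖u‖ ^ 2)) • u - A)).comp
          (ContinuousLinearMap.snd ℝ ℝ E3)) (τ, u) := by
  have h1 := (hasFDerivAt_fst (𝕜 := ℝ) (E := ℝ) (F := E3) (p := (τ, u))).mul_const Φ
  have h2 : HasFDerivAt (fun p : ℝ × E3 => inner ℝ p.2 A)
      ((innerSL ℝ A).comp (ContinuousLinearMap.snd ℝ ℝ E3)) (τ, u) := by
    have := (innerSL ℝ A).hasFDerivAt.comp (τ, u)
      (hasFDerivAt_snd (𝕜 := ℝ) (E := ℝ) (F := E3) (p := (τ, u)))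
    refine this.congr_of_eventuallyEq (Eventually.of_forall fun p => ?_)
    exact real_inner_comm A p.2
  refine (((hasFDerivAt_localLagExt m h).add h1).sub h2).congr_fderiv ?_
  ext <;> simp

theorem hasDerivAt_lag (m Φ : ℝ) (A : E3) {τ : ℝ} {u : E3} (h : 0 < τ ^ 2 - ‖u‖ ^ 2) :
    HasDerivAt (fun τ => localLagExt m τ u + τ * Φ - inner ℝ u A)
      (m * (1 - τ / Real.sqrt (τ ^ 2 - ‖u‖ ^ 2)) + Φ) τ := by
  have := (hasFDerivAt_lag m Φ A h).comp_hasDerivAt τ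
    ((hasDerivAt_id τ).prodMk (hasDerivAt_const τ u))
  refine this.congr_deriv ?_
  simp

theorem hasGradientAt_lag (m Φ : ℝ) (A : E3) {τ : ℝ} {u : E3} (h : 0 < τ ^ 2 - ‖u‖ ^ 2) :
    HasGradientAt (fun u => localLagExt m τ u + τ * Φ - inner ℝ u A)
      ((m / Real.sqrt (τ ^ 2 - ‖u‖ ^ 2)) • u - A) u := by
  rw [hasGradientAt_iff_hasFDerivAt]
  have := (hasFDerivAt_lag m Φ A h).comp u
    ((hasFDerivAt_const τ u).prodMk (hasFDerivAt_id u))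
  refine this.congr_fderiv ?_
  ext v
  simp

theorem partialLag_eq_ext (m : ℝ) (X : TimeOrbit) (y v : E3) (t : ℝ) :
    partialLag m X y v t = localLagExt m 1 v + 1 * scalPot X t y - inner ℝ v (vecPot X t y) := by
  rw [partialLag_eq, localLag, localLagExt]
  simp

section Time

variable (m : ℝ) {Xi : TimeOrbit} (Xj : TimeOrbit) {t : ℝ} (h : ‖Xi.v t‖ < 1)
include h

theorem one_sub_sq_pos_of_norm_lt_one : 0 < (1 : ℝ) ^ 2 - ‖Xi.v t‖ ^ 2 := by
  have := norm_nonneg (Xi.v t)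
  nlinarith

theorem hasGradientAt_partialLag :
    HasGradientAt (fun v => partialLag m Xj (Xi.x t) v t)
      ((m / Real.sqrt (1 - ‖Xi.v t‖ ^ 2)) • Xi.v t - vecPot Xj t (Xi.x t)) (Xi.v t) := by
  simp only [partialLag_eq_ext]
  have := hasGradientAt_lag m (scalPot Xj t (Xi.x t)) (vecPot Xj t (Xi.x t))
    (one_sub_sq_pos_of_norm_lt_one h)
  rwa [one_pow] at this

theorem momentum_eq : momentum m Xi Xj t =
    (m / Real.sqrt (1 - ‖Xi.v t‖ ^ 2)) • Xi.v t - vecPot Xj t (Xi.x t) :=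
  (hasGradientAt_partialLag m Xj h).gradient

/-- Terms linear in the velocity drop out of the Legendre transform, so the vector potential
disappears. -/
theorem legendre_eq : legendre m Xi Xj t =
    m / Real.sqrt (1 - ‖Xi.v t‖ ^ 2) - m - scalPot Xj t (Xi.x t) := by
  have hpos := one_sub_sq_pos_of_norm_lt_one h
  rw [one_pow] at hpos
  have hS := Real.sqrt_pos.2 hpos
  have hsq := Real.sq_sqrt hpos.le
  rw [legendre, momentum_eq m Xj h, partialLag_eq, localLag, inner_sub_right,
    real_inner_smul_right, real_inner_self_eq_norm_sq]
  have e : ‖Xi.v t‖ ^ 2 = 1 - Real.sqrt (1 - ‖Xi.v t‖ ^ 2) ^ 2 := by linarith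
  set S := Real.sqrt (1 - ‖Xi.v t‖ ^ 2)
  rw [e]
  field_simp
  ring

end Time

section Parameter

variable (m : ℝ) {Qi Qj : FourOrbit} {Xj : TimeOrbit} (hRj : IsReparam Qj Xj) (hQj : Qj.IsTBVXBV)
  {s : ℝ} (hs : 0 < Qi.dt s ^ 2 - ‖Qi.dx s‖ ^ 2)
  (hc : ∀ σ, IsSign σ → ∃ τ, Xj.OnCone σ (Qi.t s) (Qi.x s) τ)
include hRj hQj hc

theorem partialLagExt_eq_along (τ : ℝ) (u : E3) : partialLagExt m Qj (Qi.t s) (Qi.x s) τ u =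
    localLagExt m τ u + τ * scalPot Xj (Qi.t s) (Qi.x s) -
      inner ℝ u (vecPot Xj (Qi.t s) (Qi.x s)) :=
  hRj.partialLagExt_eq hQj (hc _ (Or.inr rfl)) (hc _ (Or.inl rfl)) τ u

include hs

theorem hasDerivAt_partialLagExt :
    HasDerivAt (fun τ => partialLagExt m Qj (Qi.t s) (Qi.x s) τ (Qi.dx s))
      (m * (1 - Qi.dt s / Real.sqrt (Qi.dt s ^ 2 - ‖Qi.dx s‖ ^ 2)) +
        scalPot Xj (Qi.t s) (Qi.x s)) (Qi.dt s) := by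
  simp only [partialLagExt_eq_along m hRj hQj hc]
  exact hasDerivAt_lag m _ _ hs

theorem hasGradientAt_partialLagExt :
    HasGradientAt (fun u => partialLagExt m Qj (Qi.t s) (Qi.x s) (Qi.dt s) u)
      ((m / Real.sqrt (Qi.dt s ^ 2 - ‖Qi.dx s‖ ^ 2)) • Qi.dx s -
        vecPot Xj (Qi.t s) (Qi.x s)) (Qi.dx s) := by
  simp only [partialLagExt_eq_along m hRj hQj hc]
  exact hasGradientAt_lag m _ _ hs

theorem momentumExt0_eq : momentumExt0 m Qi Qj s =
    m * (1 - Qi.dt s / Real.sqrt (Qi.dt s ^ 2 - ‖Qi.dx s‖ ^ 2)) + scalPot Xj (Qi.t s) (Qi.x s) :=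
  (hasDerivAt_partialLagExt m hRj hQj hs hc).deriv

theorem momentumExt_eq : momentumExt m Qi Qj s =
    (m / Real.sqrt (Qi.dt s ^ 2 - ‖Qi.dx s‖ ^ 2)) • Qi.dx s - vecPot Xj (Qi.t s) (Qi.x s) :=
  (hasGradientAt_partialLagExt m hRj hQj hs hc).gradient

end Parameter

theorem FourOrbit.IsTBVXBV.sq_sub_pos {Q : FourOrbit} (h : Q.IsTBVXBV) {s : ℝ}
    (hs : s ∈ Icc Q.lo Q.hi) : 0 < Q.dt s ^ 2 - ‖Q.dx s‖ ^ 2 := by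
  obtain ⟨c, hc, hb⟩ := h.exists_le_sq_sub
  exact hc.trans_le (hb s hs)

theorem TimeOrbit.IsXBV.norm_lt_one {X : TimeOrbit} (h : X.IsXBV) {t : ℝ}
    (ht : t ∈ Icc X.lo X.hi) : ‖X.v t‖ < 1 := by
  obtain ⟨κ, hκ, hb⟩ := h.subluminal
  exact (hb t ht).trans_lt hκ

/-! ### Orbits in the field of another particle -/

/-- The segment `[a, b]` of the orbit `Q` lies in the field of the orbit `X`, with both light cones
available. -/
def IsFieldSeg (X : TimeOrbit) (κ : ℝ) (Q : FourOrbit) (a b : ℝ) : Prop :=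
  ∀ σ, IsSign σ → IsConeSeg X κ σ Q a b

/-- The outer cone is available on the whole orbit and its opposite on the free segment, so both are
available on the latter. -/
theorem IsBoundaryPair.exists_isFieldSeg {Q : Fin 2 → FourOrbit} {k : Fin 2 → ℝ}
    (h : IsBoundaryPair Q k) {X : Fin 2 → TimeOrbit} (hR : ∀ i, IsReparam (Q i) (X i))
    (i : Fin 2) : ∃ κ, IsFieldSeg (X (1 - i)) κ (Q i) (parLo Q k i) (parHi Q k i) := by
  obtain ⟨κ, h1, h2⟩ := h.exists_isConeSeg hR i
  have h1' := h1.mono (h.parLo_lt_parHi i) (h.lo_le_parLo i) (h.parHi_le_hi i)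
  refine ⟨κ, fun σ hσ => ?_⟩
  have : σ = outerSign i ∨ σ = -outerSign i := by
    rcases outerSign_isSign i with hi | hi <;> rcases hσ with rfl | rfl <;> simp [hi]
  rcases this with rfl | rfl
  · exact h1'
  · exact h2

namespace IsFieldSeg

variable {X : TimeOrbit} {κ : ℝ} {Q : FourOrbit} {a b : ℝ} (h : IsFieldSeg X κ Q a b)
include h

theorem past : IsConeSeg X κ (-1) Q a b := h _ (Or.inr rfl)

theorem future : IsConeSeg X κ 1 Q a b := h _ (Or.inl rfl)

theorem exists_onCone {s : ℝ} (hs : s ∈ Icc a b) (σ : ℝ) (hσ : IsSign σ) :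
    ∃ τ, X.OnCone σ (Q.t s) (Q.x s) τ := (h σ hσ).exists_onCone s hs

theorem boundedVariationOn_scalPot :
    BoundedVariationOn (fun s => scalPot X (Q.t s) (Q.x s)) (Icc a b) :=
  h.past.boundedVariationOn_pot.fun_add h.future.boundedVariationOn_pot

theorem boundedVariationOn_vecPot :
    BoundedVariationOn (fun s => vecPot X (Q.t s) (Q.x s)) (Icc a b) :=
  h.past.boundedVariationOn_vpot.fun_add h.future.boundedVariationOn_vpot

theorem boundedVariationOn_inv_sqrt :
    BoundedVariationOn (fun s => (Real.sqrt (Q.dt s ^ 2 - ‖Q.dx s‖ ^ 2))⁻¹) (Icc a b) := by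
  obtain ⟨c, hc, hb⟩ := h.past.curve.exists_le_sq_sub
  exact (h.past.curve.boundedVariationOn_sqrt.mono h.past.subset).fun_inv (Real.sqrt_pos.2 hc)
    fun s hs => Real.sqrt_le_sqrt (hb s (h.past.subset hs))

theorem sqrt_eq {Xi : TimeOrbit} {s : ℝ} (hR : IsReparam Q Xi) (hs : s ∈ Icc a b) :
    Real.sqrt (Q.dt s ^ 2 - ‖Q.dx s‖ ^ 2) = Q.dt s * Real.sqrt (1 - ‖Xi.v (Q.t s)‖ ^ 2) := by
  have hsQ := h.past.subset hs
  have hdt := h.past.curve.time.dt_pos hsQ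
  have e : Q.dt s ^ 2 - ‖Q.dx s‖ ^ 2 = Q.dt s ^ 2 * (1 - ‖Xi.v (Q.t s)‖ ^ 2) := by
    rw [hR.dx_eq s hsQ, norm_smul, Real.norm_of_nonneg hdt.le]; ring
  rw [e, Real.sqrt_mul (sq_nonneg _), Real.sqrt_sq hdt.le]

theorem norm_v_lt_one {Xi : TimeOrbit} {s : ℝ} (hR : IsReparam Q Xi) (hs : s ∈ Icc a b) :
    ‖Xi.v (Q.t s)‖ < 1 :=
  (h.past.curve.isXBV hR).norm_lt_one (hR.mapsTo h.past.curve (h.past.subset hs))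

theorem exists_inverse_time : ∃ (ψ : ℝ → ℝ) (K : ℝ≥0), (∀ s ∈ Icc a b, ψ (Q.t s) = s) ∧
    MapsTo ψ (Icc (Q.t a) (Q.t b)) (Icc a b) ∧
    (∀ r ∈ Icc (Q.t a) (Q.t b), Q.t (ψ r) = r) ∧
    MonotoneOn ψ (Icc (Q.t a) (Q.t b)) ∧ LipschitzOnWith K ψ (Icc (Q.t a) (Q.t b)) := by
  obtain ⟨ψ, K, h1, h2, h3, h4, h5⟩ := h.past.curve.exists_inverse_time
  obtain ⟨c, hc⟩ := h.past.curve.time.exists_isExpanding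
  have hc' := hc.mono h.past.lt.le h.past.lo_le h.past.le_hi
  have hsub : Icc (Q.t a) (Q.t b) ⊆ Icc (Q.t Q.lo) (Q.t Q.hi) := by
    rw [← hc'.image_Icc, ← hc.image_Icc]
    exact image_mono h.past.subset
  refine ⟨ψ, K, fun s hs => h1 s (h.past.subset hs), ?_, fun r hr => h3 r (hsub hr),
    h4.mono hsub, h5.mono hsub⟩
  rw [← hc'.image_Icc]
  rintro _ ⟨s, hs, rfl⟩
  rwa [h1 s (h.past.subset hs)]

variable (m : ℝ) {Q' : FourOrbit} (hQ' : Q'.IsTBVXBV) (hR' : IsReparam Q' X)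
include hQ' hR'

theorem momentumExt0_eq {s : ℝ} (hs : s ∈ Icc a b) : momentumExt0 m Q Q' s =
    m * (1 - Q.dt s / Real.sqrt (Q.dt s ^ 2 - ‖Q.dx s‖ ^ 2)) + scalPot X (Q.t s) (Q.x s) :=
  _root_.momentumExt0_eq m hR' hQ' (h.past.curve.sq_sub_pos (h.past.subset hs)) (h.exists_onCone hs)

theorem momentumExt_eq {s : ℝ} (hs : s ∈ Icc a b) : momentumExt m Q Q' s =
    (m / Real.sqrt (Q.dt s ^ 2 - ‖Q.dx s‖ ^ 2)) • Q.dx s - vecPot X (Q.t s) (Q.x s) :=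
  _root_.momentumExt_eq m hR' hQ' (h.past.curve.sq_sub_pos (h.past.subset hs)) (h.exists_onCone hs)

theorem boundedVariationOn_momentumExt0 :
    BoundedVariationOn (momentumExt0 m Q Q') (Icc a b) := by
  refine (((boundedVariationOn_const m).fun_mul ((boundedVariationOn_const 1).fun_sub
    ((h.past.curve.time.bv.mono h.past.subset).fun_mul
      h.boundedVariationOn_inv_sqrt))).fun_add
        h.boundedVariationOn_scalPot).congr_on fun s hs => ?_
  rw [h.momentumExt0_eq m hQ' hR' hs, div_eq_mul_inv]

theorem boundedVariationOn_momentumExt :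
    BoundedVariationOn (momentumExt m Q Q') (Icc a b) := by
  refine ((((boundedVariationOn_const m).fun_mul
    h.boundedVariationOn_inv_sqrt).fun_smul
      (h.past.curve.bv.mono h.past.subset)).fun_sub
        h.boundedVariationOn_vecPot).congr_on fun s hs => ?_
  rw [h.momentumExt_eq m hQ' hR' hs, div_eq_mul_inv]

variable {Xi : TimeOrbit} (hR : IsReparam Q Xi)
include hR

theorem partialLagExt_eq_mul {s : ℝ} (hs : s ∈ Icc a b) :
    partialLagExt m Q' (Q.t s) (Q.x s) (Q.dt s) (Q.dx s) =
      Q.dt s * partialLag m X (Xi.x (Q.t s)) (Xi.v (Q.t s)) (Q.t s) := by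
  have hsQ := h.past.subset hs
  rw [partialLagExt_eq_along m hR' hQ' (h.exists_onCone hs), partialLag_eq, hR.dx_eq s hsQ,
    localLagExt_smul m (h.past.curve.time.dt_pos hsQ), hR.x_eq s hsQ, real_inner_smul_left]
  ring

theorem momentumExt0_eq_neg_legendre {s : ℝ} (hs : s ∈ Icc a b) :
    momentumExt0 m Q Q' s = -legendre m Xi X (Q.t s) := by
  have hsQ := h.past.subset hs
  have hdt := h.past.curve.time.dt_pos hsQ
  rw [h.momentumExt0_eq m hQ' hR' hs, legendre_eq m X (h.norm_v_lt_one hR hs),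
    h.sqrt_eq hR hs, hR.x_eq s hsQ, div_mul_eq_div_div, div_self hdt.ne']
  ring

theorem momentumExt_eq_momentum {s : ℝ} (hs : s ∈ Icc a b) :
    momentumExt m Q Q' s = momentum m Xi X (Q.t s) := by
  have hsQ := h.past.subset hs
  have hdt := h.past.curve.time.dt_pos hsQ
  rw [h.momentumExt_eq m hQ' hR' hs, momentum_eq m X (h.norm_v_lt_one hR hs),
    h.sqrt_eq hR hs, hR.x_eq s hsQ, hR.dx_eq s hsQ, smul_smul]
  congr 2
  field_simp

theorem boundedVariationOn_legendre :
    BoundedVariationOn (legendre m Xi X) (Icc (Q.t a) (Q.t b)) := by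
  obtain ⟨ψ, K, h1, h2, h3, h4, -⟩ := h.exists_inverse_time
  refine ((h.boundedVariationOn_momentumExt0 m hQ' hR').fun_neg.comp_monotoneOn h4 h2).congr_on
    fun r hr => ?_
  rw [h.momentumExt0_eq_neg_legendre m hQ' hR' hR (h2 hr), neg_neg, h3 r hr]

theorem boundedVariationOn_momentum :
    BoundedVariationOn (momentum m Xi X) (Icc (Q.t a) (Q.t b)) := by
  obtain ⟨ψ, K, h1, h2, h3, h4, -⟩ := h.exists_inverse_time
  refine ((h.boundedVariationOn_momentumExt m hQ' hR').comp_monotoneOn h4 h2).congr_on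
    fun r hr => ?_
  rw [h.momentumExt_eq_momentum m hQ' hR' hR (h2 hr), h3 r hr]

end IsFieldSeg

end Momenta

/-! ### Admissible variations and stability of the light-cone geometry. -/

section Variations

open Filter
open scoped Topology NNReal ENNReal

theorem intervalIntegral_eq_of_eq_zero_outside {E : Type*} [NormedAddCommGroup E] [NormedSpace ℝ E]
    {f : ℝ → E} {lo a b hi : ℝ} (ha : lo ≤ a) (hab : a ≤ b) (hb : b ≤ hi)
    (h : ∀ s ∉ Icc a b, f s = 0) : ∫ s in lo..hi, f s = ∫ s in a..b, f s := by
  rw [intervalIntegral.integral_of_le (ha.trans (hab.trans hb)),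
    intervalIntegral.integral_of_le hab, ← integral_Icc_eq_integral_Ioc,
    ← integral_Icc_eq_integral_Ioc]
  exact setIntegral_eq_of_subset_of_forall_sdiff_eq_zero measurableSet_Icc (Icc_subset_Icc ha hb)
    fun s hs => h s hs.2

/-- `f` is the indicator of `[a, b]`, a difference of two increasing step functions, times `f`
composed with the monotone projection onto `[a, b]`. -/
theorem BoundedVariationOn.of_eq_zero_outside {E : Type*} [NormedAddCommGroup E] [NormedSpace ℝ E]
    {f : ℝ → E} {a b : ℝ} (hab : a ≤ b) (hf : BoundedVariationOn f (Icc a b))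
    (h : ∀ s ∉ Icc a b, f s = 0) (s : Set ℝ) : BoundedVariationOn f s := by
  have hstep : ∀ t : Set ℝ, (∀ x ∈ t, ∀ y, x ≤ y → y ∈ t) →
      BoundedVariationOn (t.indicator fun _ => (1 : ℝ)) s := by
    intro t ht
    refine MonotoneOn.boundedVariationOn (C := 1) (fun x _ y _ hxy => ?_) fun x _ => ?_
    · by_cases hx : x ∈ t
      · rw [indicator_of_mem hx, indicator_of_mem (ht x hx y hxy)]
      · rw [indicator_of_notMem hx]
        exact indicator_nonneg (fun _ _ => zero_le_one) _
    · by_cases hx : x ∈ t <;> simp [hx]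
  have hproj : BoundedVariationOn (fun x => f (max a (min b x))) s := by
    refine hf.comp_monotoneOn (fun x _ y _ hxy => ?_) fun x _ => ?_
    · exact max_le_max le_rfl (min_le_min le_rfl hxy)
    · exact ⟨le_max_left _ _, max_le hab (min_le_left _ _)⟩
  refine (((hstep (Ici a) fun x hx y hxy => le_trans hx hxy).fun_sub
    (hstep (Ioi b) fun x hx y hxy => lt_of_lt_of_le hx hxy)).fun_smul hproj).congr_on
      fun x _ => ?_
  by_cases hx : x ∈ Icc a b
  · have e : max a (min b x) = x := by rw [min_eq_right hx.2, max_eq_right hx.1]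
    simp [hx.1, not_lt.2 hx.2, e]
  · rw [h x hx]
    rcases lt_or_ge x a with hxa | hxa
    · simp [not_le.2 hxa, not_lt.2 (hxa.le.trans hab)]
    · have hxb : b < x := not_le.1 fun hxb => hx ⟨hxa, hxb⟩
      simp [hxa, hxb]

namespace Variation.IsAdmissible

variable {w : Variation} {a b : ℝ} (hw : w.IsAdmissible a b)
include hw

/-- Needed because the outer interaction term is integrated over the entire orbit and the varied
orbit has to be admissible there. -/
theorem extend (hab : a ≤ b) {lo hi : ℝ} (ha : lo ≤ a) (hb : b ≤ hi) : w.IsAdmissible lo hi := by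
  have hz : ∀ s ∉ Icc a b, w.db0 s = 0 := fun s hs => (hw.outside s hs).2.2.1
  have hz' : ∀ s ∉ Icc a b, w.db s = 0 := fun s hs => (hw.outside s hs).2.2.2
  have prim : ∀ {E : Type} [NormedAddCommGroup E] [NormedSpace ℝ E] (f f' : ℝ → E),
      (∀ s ∉ Icc a b, f s = 0) → (∀ s ∉ Icc a b, f' s = 0) →
      (∀ s ∈ Icc a b, f s = ∫ r in a..s, f' r) → f b = 0 →
      ∀ s ∈ Icc lo hi, f s = ∫ r in lo..s, f' r := by
    intro E _ _ f f' h0 h0' hprim hfb s hs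
    rcases lt_or_ge s a with hsa | hsa
    · rw [h0 s fun h => absurd h.1 (not_le.2 hsa)]
      symm
      refine (intervalIntegral.integral_congr (g := fun _ => (0 : E)) fun r hr => ?_).trans
        intervalIntegral.integral_zero
      rw [uIcc_of_le hs.1] at hr
      exact h0' r fun h => absurd (h.1.trans hr.2) (not_le.2 hsa)
    · rcases le_or_gt s b with hsb | hsb
      · rw [hprim s ⟨hsa, hsb⟩]
        -- Cutting off at `s` produces an integrand that vanishes outside `[a, s]`.
        have : ∫ r in lo..s, f' r = ∫ r in lo..s, (Iic s).indicator f' r := by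
          refine intervalIntegral.integral_congr fun r hr => ?_
          rw [uIcc_of_le hs.1] at hr
          exact (indicator_of_mem (show r ∈ Iic s from hr.2) f').symm
        rw [this, intervalIntegral_eq_of_eq_zero_outside ha hsa le_rfl]
        · refine intervalIntegral.integral_congr fun r hr => ?_
          rw [uIcc_of_le hsa] at hr
          exact (indicator_of_mem (show r ∈ Iic s from hr.2) f').symm
        · intro r hr
          by_cases hrs : r ∈ Iic s
          · rw [indicator_of_mem hrs]
            exact h0' r fun h => hr ⟨h.1, hrs⟩
          · exact indicator_of_notMem hrs _
      · rw [h0 s fun h => absurd h.2 (not_le.2 hsb),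
          intervalIntegral_eq_of_eq_zero_outside ha hab hsb.le h0', ← hprim b ⟨hab, le_rfl⟩, hfb]
  have hends : w.b0 hi = 0 ∧ w.b hi = 0 := by
    rcases hb.eq_or_lt with rfl | hlt
    · exact ⟨hw.b0_hi, hw.b_hi⟩
    · have := hw.outside hi fun h => absurd h.2 (not_le.2 hlt)
      exact ⟨this.1, this.2.1⟩
  exact ⟨hw.bv0.of_eq_zero_outside hab hz _, hw.bv.of_eq_zero_outside hab hz' _,
    prim w.b0 w.db0 (fun s hs => (hw.outside s hs).1) hz hw.b0_eq hw.b0_hi,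
    prim w.b w.db (fun s hs => (hw.outside s hs).2.1) hz' hw.b_eq hw.b_hi, hends.1, hends.2,
    fun s hs => hw.outside s fun h => hs (Icc_subset_Icc ha hb h)⟩

theorem b0_lo (hab : a ≤ b) : w.b0 a = 0 := by
  rw [hw.b0_eq a ⟨le_rfl, hab⟩, intervalIntegral.integral_same]

theorem b_lo (hab : a ≤ b) : w.b a = 0 := by
  rw [hw.b_eq a ⟨le_rfl, hab⟩, intervalIntegral.integral_same]

theorem boundedVariationOn_b0 (hab : a ≤ b) : BoundedVariationOn w.b0 (Icc a b) := by
  obtain ⟨C, hC0, hC⟩ := hw.bv0.exists_norm_le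
  refine LipschitzOnWith.boundedVariationOn_Icc (C := Real.toNNReal C)
    (LipschitzOnWith.of_dist_le_mul fun s hs s' hs' => ?_)
  rw [Real.coe_toNNReal _ hC0.le, dist_eq_norm, dist_eq_norm]
  exact dist_le_of_primitive (hw.bv0.intervalIntegrable_real hab)
    (fun s hs => by rw [hw.b0_lo hab, zero_add]; exact hw.b0_eq s hs) hC hs' hs

theorem boundedVariationOn_b (hab : a ≤ b) : BoundedVariationOn w.b (Icc a b) := by
  obtain ⟨C, hC0, hC⟩ := hw.bv.exists_norm_le
  refine LipschitzOnWith.boundedVariationOn_Icc (C := Real.toNNReal C)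
    (LipschitzOnWith.of_dist_le_mul fun s hs s' hs' => ?_)
  rw [Real.coe_toNNReal _ hC0.le, dist_eq_norm, dist_eq_norm]
  exact dist_le_of_primitive (hw.bv.intervalIntegrable_E3 hab)
    (fun s hs => by rw [hw.b_lo hab, zero_add]; exact hw.b_eq s hs) hC hs' hs

/-- A common bound for an admissible variation. -/
theorem exists_bound (hab : a ≤ b) : ∃ B > 0, ∀ s,
    |w.b0 s| ≤ B ∧ ‖w.b s‖ ≤ B ∧ |w.db0 s| ≤ B ∧ ‖w.db s‖ ≤ B := by
  obtain ⟨B₁, hB₁, h1⟩ := (hw.boundedVariationOn_b0 hab).exists_norm_le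
  obtain ⟨B₂, hB₂, h2⟩ := (hw.boundedVariationOn_b hab).exists_norm_le
  obtain ⟨B₃, hB₃, h3⟩ := hw.bv0.exists_norm_le
  obtain ⟨B₄, hB₄, h4⟩ := hw.bv.exists_norm_le
  refine ⟨B₁ + B₂ + B₃ + B₄, by positivity, fun s => ?_⟩
  by_cases hs : s ∈ Icc a b
  · have i1 := h1 s hs
    have i2 := h2 s hs
    have i3 := h3 s hs
    have i4 := h4 s hs
    rw [Real.norm_eq_abs] at i1 i3
    exact ⟨by linarith, by linarith, by linarith, by linarith⟩
  · obtain ⟨e1, e2, e3, e4⟩ := hw.outside s hs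
    rw [e1, e2, e3, e4]
    simp only [abs_zero, norm_zero]
    have : 0 ≤ B₁ + B₂ + B₃ + B₄ := by positivity
    exact ⟨this, this, this, this⟩

end Variation.IsAdmissible

/-- A small variation of an orbit of `T_BV ⊗ X_BV` is one again, uniformly sub-luminal. -/
theorem FourOrbit.IsTBVXBV.exists_vary {Q : FourOrbit} (h : Q.IsTBVXBV) {w : Variation}
    (hw : w.IsAdmissible Q.lo Q.hi) : ∃ ε₀ > 0, ∃ c > 0, ∀ ε, |ε| < ε₀ →
      (Q.vary w ε).IsTBVXBV ∧ ∀ s ∈ Icc Q.lo Q.hi,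
        c ≤ (Q.vary w ε).dt s ^ 2 - ‖(Q.vary w ε).dx s‖ ^ 2 := by
  have hle := h.time.lt.le
  obtain ⟨B, hB, hb⟩ := hw.exists_bound hle
  obtain ⟨c, hc, hdt⟩ := h.time.pos
  obtain ⟨κ, hκ0, hκ, hdx, -⟩ := h.exists_timelike
  set κ' := (1 + κ) / 2 with hκ'
  have hκ'1 : κ' < 1 := by rw [hκ']; linarith
  have hκ'0 : 0 ≤ κ' := by rw [hκ']; linarith
  have h1 : 0 < 1 - κ ^ 2 := by nlinarith
  have h1' : 0 < 1 - κ' ^ 2 := by nlinarith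
  -- This bound gives `|ε| B < (1 - κ) c / 4`: then `t'` loses at most half of `c`, and the speed
  -- ratio stays below the midpoint `κ'` of `κ` and `1`.
  refine ⟨(1 - κ) * c / (4 * B), div_pos (mul_pos (by linarith) hc) (by positivity),
    (1 - κ' ^ 2) * (c / 2) ^ 2, by positivity, fun ε hε => ?_⟩
  rw [lt_div_iff₀ (by positivity)] at hε
  have key : ∀ s ∈ Icc Q.lo Q.hi, c / 2 ≤ Q.dt s + ε * w.db0 s ∧
      ‖Q.dx s + ε • w.db s‖ ≤ κ' * (Q.dt s + ε * w.db0 s) := by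
    intro s hs
    obtain ⟨-, -, i3, i4⟩ := hb s
    have e1 : |ε * w.db0 s| ≤ |ε| * B := by rw [abs_mul]; gcongr
    have e2 : ‖ε • w.db s‖ ≤ |ε| * B := by rw [norm_smul, Real.norm_eq_abs]; gcongr
    have e3 := (abs_le.1 e1).1
    have e4 := hdt s hs
    have e5 := hdx s hs
    have e6 := norm_add_le (Q.dx s) (ε • w.db s)
    have e7 : 0 ≤ |ε| * B := by positivity
    refine ⟨by nlinarith, ?_⟩
    have e8 : (1 - κ) * c ≤ (1 - κ) * Q.dt s := by
      apply mul_le_mul_of_nonneg_left e4; linarith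
    have e9 : κ' * (-(|ε| * B)) ≤ κ' * (ε * w.db0 s) := mul_le_mul_of_nonneg_left e3 hκ'0
    have e10 : κ' * (|ε| * B) ≤ |ε| * B := by nlinarith
    have e11 : κ' * Q.dt s = κ * Q.dt s + (1 - κ) * Q.dt s / 2 := by rw [hκ']; ring
    rw [mul_add]
    linarith
  have hdti := h.time.bv.intervalIntegrable_real hle
  have hdb0i := hw.bv0.intervalIntegrable_real hle
  have hdbi := hw.bv.intervalIntegrable_E3 hle
  have hmono : ∀ {s : ℝ}, s ∈ Icc Q.lo Q.hi → uIcc Q.lo s ⊆ uIcc Q.lo Q.hi := fun hs => by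
    rw [uIcc_of_le hs.1, uIcc_of_le hle]; exact Icc_subset_Icc le_rfl hs.2
  refine ⟨⟨⟨h.time.lt, ?_, ?_, ⟨c / 2, by positivity, fun s hs => (key s hs).1⟩⟩, ?_, ?_,
    ⟨κ', hκ'1, fun s hs => (key s hs).2⟩⟩, fun s hs => ?_⟩
  · exact h.time.bv.fun_add ((boundedVariationOn_const ε).fun_mul hw.bv0)
  · intro s hs
    change Q.t s + ε * w.b0 s = Q.t Q.lo + ε * w.b0 Q.lo + ∫ r in Q.lo..s, (Q.dt r + ε * w.db0 r)
    rw [intervalIntegral.integral_add (hdti.mono_set (hmono hs))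
      ((hdb0i.mono_set (hmono hs)).const_mul ε), intervalIntegral.integral_const_mul,
      ← hw.b0_eq s hs, hw.b0_lo hle, h.time.t_eq s hs]
    ring
  · exact h.bv.fun_add ((boundedVariationOn_const ε).fun_smul hw.bv)
  · intro s hs
    change Q.x s + ε • w.b s = Q.x Q.lo + ε • w.b Q.lo + ∫ r in Q.lo..s, (Q.dx r + ε • w.db r)
    rw [intervalIntegral.integral_add (h.intervalIntegrable_dx.mono_set (hmono hs))
      (show IntervalIntegrable (fun r => ε • w.db r) volume Q.lo s from
        (hdbi.mono_set (hmono hs)).smul ε), intervalIntegral.integral_smul,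
      ← hw.b_eq s hs, hw.b_lo hle, h.x_eq s hs, smul_zero, add_zero, add_assoc]
  · obtain ⟨k1, k2⟩ := key s hs
    change _ ≤ (Q.dt s + ε * w.db0 s) ^ 2 - ‖Q.dx s + ε • w.db s‖ ^ 2
    have i1 : ‖Q.dx s + ε • w.db s‖ ^ 2 ≤ (κ' * (Q.dt s + ε * w.db0 s)) ^ 2 :=
      pow_le_pow_left₀ (norm_nonneg _) k2 2
    have i2 : (c / 2) ^ 2 ≤ (Q.dt s + ε * w.db0 s) ^ 2 := pow_le_pow_left₀ (by positivity) k1 2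
    nlinarith

/-- Small variations of a segment in the field of `X` stay in the field of `X`, at distances bounded
below and above. -/
theorem IsConeSeg.exists_vary {X : TimeOrbit} {κ σ : ℝ} {Q : FourOrbit} {a b : ℝ}
    (h : IsConeSeg X κ σ Q a b)
    (hne : ∀ s ∈ Icc Q.lo Q.hi, ∀ τ ∈ Icc X.lo X.hi, (Q.t s, Q.x s) ≠ (τ, X.x τ))
    {w : Variation} (hw : w.IsAdmissible a b) :
    ∃ ε₀ > 0, ∃ r₀ > 0, ∃ R, ∀ ε, |ε| < ε₀ → IsConeSeg X κ σ (Q.vary w ε) a b ∧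
      ∀ s ∈ Icc a b, ∀ τ, X.OnCone σ ((Q.vary w ε).t s) ((Q.vary w ε).x s) τ →
        r₀ ≤ ‖(Q.vary w ε).x s - X.x τ‖ ∧ ‖(Q.vary w ε).x s - X.x τ‖ ≤ R := by
  have hle := h.curve.time.lt.le
  have hwQ := hw.extend h.lt.le h.lo_le h.le_hi
  obtain ⟨B, hB, hb⟩ := hw.exists_bound h.lt.le
  obtain ⟨ε₁, hε₁, c, hc, hvary⟩ := h.curve.exists_vary hwQ
  obtain ⟨K, hK⟩ := h.curve.time.exists_lipschitzOnWith
  obtain ⟨K', hK'⟩ := h.curve.exists_lipschitzOnWith_x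
  have hcont : ContinuousOn (fun p : ℝ × ℝ => |Q.t p.1 - p.2| + ‖Q.x p.1 - X.x p.2‖)
      (Icc Q.lo Q.hi ×ˢ Icc X.lo X.hi) := by
    refine ((hK.continuousOn.comp continuousOn_fst fun p hp => hp.1).sub continuousOn_snd).abs.add
      ((hK'.continuousOn.comp continuousOn_fst fun p hp => hp.1).sub
        (h.orbit.lipschitzOnWith_x.continuousOn.comp continuousOn_snd fun p hp => hp.2)).norm
  have hcpt : IsCompact (Icc Q.lo Q.hi ×ˢ Icc X.lo X.hi) := isCompact_Icc.prod isCompact_Icc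
  have hnon : (Icc Q.lo Q.hi ×ˢ Icc X.lo X.hi).Nonempty :=
    (nonempty_Icc.2 hle).prod (nonempty_Icc.2 h.orbit.isXBV.lt.le)
  -- Without collisions the space-time distance of the two orbits has a positive minimum `δ`; its
  -- maximum `R` bounds the cone distances from above.
  obtain ⟨p, hp, hmin⟩ := hcpt.exists_isMinOn hnon hcont
  obtain ⟨q, hq, hmax⟩ := hcpt.exists_isMaxOn hnon hcont
  set δ := |Q.t p.1 - p.2| + ‖Q.x p.1 - X.x p.2‖ with hδ
  set R := |Q.t q.1 - q.2| + ‖Q.x q.1 - X.x q.2‖ with hR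
  have hδ0 : 0 < δ := by
    refine lt_of_le_of_ne (by positivity) fun h0 => hne p.1 hp.1 p.2 hp.2 ?_
    have h1 := abs_nonneg (Q.t p.1 - p.2)
    have h2 := norm_nonneg (Q.x p.1 - X.x p.2)
    have h3 : |Q.t p.1 - p.2| = 0 := by linarith
    have h4 : ‖Q.x p.1 - X.x p.2‖ = 0 := by linarith
    exact Prod.ext (sub_eq_zero.1 (abs_eq_zero.1 h3)) (sub_eq_zero.1 (norm_eq_zero.1 h4))
  -- Time and position each move by at most `δ / 4`.
  have hest : ∀ ε, |ε| < δ / (4 * B) → ∀ s ∈ Icc Q.lo Q.hi, ∀ τ ∈ Icc X.lo X.hi,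
      δ / 2 ≤ |(Q.vary w ε).t s - τ| + ‖(Q.vary w ε).x s - X.x τ‖ ∧
      ‖(Q.vary w ε).x s - X.x τ‖ ≤ R + δ / 2 := by
    intro ε hε s hs τ hτ
    rw [lt_div_iff₀ (by positivity)] at hε
    obtain ⟨i1, i2, -, -⟩ := hb s
    have e1 : |ε * w.b0 s| ≤ |ε| * B := by rw [abs_mul]; gcongr
    have e2 : ‖ε • w.b s‖ ≤ |ε| * B := by rw [norm_smul, Real.norm_eq_abs]; gcongr
    have e3 : δ ≤ |Q.t s - τ| + ‖Q.x s - X.x τ‖ := hmin (show (s, τ) ∈ _ from ⟨hs, hτ⟩)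
    have e4 : |Q.t s - τ| + ‖Q.x s - X.x τ‖ ≤ R := hmax (show (s, τ) ∈ _ from ⟨hs, hτ⟩)
    have e5 : |Q.t s - τ| ≤ |Q.t s + ε * w.b0 s - τ| + |ε * w.b0 s| := by
      have : Q.t s - τ = (Q.t s + ε * w.b0 s - τ) - ε * w.b0 s := by ring
      rw [this]; exact abs_sub _ _
    have e6 : ‖Q.x s - X.x τ‖ ≤ ‖Q.x s + ε • w.b s - X.x τ‖ + ‖ε • w.b s‖ := by
      have : Q.x s - X.x τ = (Q.x s + ε • w.b s - X.x τ) - ε • w.b s := by abel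
      rw [this]; exact norm_sub_le _ _
    have e7 : ‖Q.x s + ε • w.b s - X.x τ‖ ≤ ‖Q.x s - X.x τ‖ + ‖ε • w.b s‖ := by
      have : Q.x s + ε • w.b s - X.x τ = (Q.x s - X.x τ) + ε • w.b s := by abel
      rw [this]; exact norm_add_le _ _
    have e8 := abs_nonneg (Q.t s - τ)
    change δ / 2 ≤ |Q.t s + ε * w.b0 s - τ| + ‖Q.x s + ε • w.b s - X.x τ‖ ∧
      ‖Q.x s + ε • w.b s - X.x τ‖ ≤ R + δ / 2
    exact ⟨by linarith, by linarith⟩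
  -- On the light cone the time difference equals the distance, so the sum, which is at least `δ /
  -- 2`, is twice the distance; hence `δ / 4`.
  refine ⟨min ε₁ (δ / (4 * B)), lt_min hε₁ (by positivity), δ / 4, by positivity, R + δ / 2,
    fun ε hε => ⟨?_, fun s hs τ hτ => ?_⟩⟩
  · have ha : (Q.vary w ε).t a = Q.t a ∧ (Q.vary w ε).x a = Q.x a := by
      simp [FourOrbit.vary, hw.b0_lo h.lt.le, hw.b_lo h.lt.le]
    have hb' : (Q.vary w ε).t b = Q.t b ∧ (Q.vary w ε).x b = Q.x b := by
      simp [FourOrbit.vary, hw.b0_hi, hw.b_hi]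
    refine IsConeSeg.of_endpoints h.orbit h.sign (hvary ε (lt_of_lt_of_le hε (min_le_left _ _))).1
      h.lt h.lo_le h.le_hi ?_ ?_ fun s hs τ hτ heq => ?_
    · rw [ha.1, ha.2]; exact h.exists_onCone a ⟨le_rfl, h.lt.le⟩
    · rw [hb'.1, hb'.2]; exact h.exists_onCone b ⟨h.lt.le, le_rfl⟩
    · have := (hest ε (lt_of_lt_of_le hε (min_le_right _ _)) s hs τ hτ).1
      rw [Prod.mk.injEq] at heq
      rw [heq.1, heq.2] at this
      simp at this
      linarith
  · obtain ⟨i1, i2⟩ := hest ε (lt_of_lt_of_le hε (min_le_right _ _)) s (h.subset hs) τ hτ.1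
    refine ⟨?_, i2⟩
    rw [abs_sub_comm, ← hτ.abs_sub_eq h.sign] at i1
    linarith

theorem IsReparam.exists_lipschitzOnWith_v {Q : FourOrbit} {X : TimeOrbit} (hR : IsReparam Q X)
    (hQ : Q.IsTBVXBV) {C : ℝ≥0} (h1 : LipschitzOnWith C Q.dt (Icc Q.lo Q.hi))
    (h2 : LipschitzOnWith C Q.dx (Icc Q.lo Q.hi)) :
    ∃ K, LipschitzOnWith K X.v (Icc X.lo X.hi) := by
  obtain ⟨ψ, K, hψ, hmaps, htψ, hmono, hL⟩ := hQ.exists_inverse_time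
  obtain ⟨c, hc, hdt⟩ := hQ.time.pos
  obtain ⟨M, hM0, hM⟩ := hQ.bv.exists_norm_le
  have hv : ∀ s ∈ Icc Q.lo Q.hi, X.v (Q.t s) = (Q.dt s)⁻¹ • Q.dx s := fun s hs => by
    rw [hR.dx_eq s hs, inv_smul_smul₀ (hQ.time.dt_pos hs).ne']
  have hK0 : 0 ≤ (c⁻¹ * C + (c * c)⁻¹ * C * M) * K := by positivity
  refine ⟨Real.toNNReal ((c⁻¹ * C + (c * c)⁻¹ * C * M) * K), LipschitzOnWith.of_dist_le_mul ?_⟩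
  rw [← hR.lo_eq, ← hR.hi_eq]
  intro r hr r' hr'
  have hs := hmaps hr
  have hs' := hmaps hr'
  have e1 : X.v r = (Q.dt (ψ r))⁻¹ • Q.dx (ψ r) := by rw [← hv _ hs, htψ r hr]
  have e2 : X.v r' = (Q.dt (ψ r'))⁻¹ • Q.dx (ψ r') := by rw [← hv _ hs', htψ r' hr']
  have d1 := h1.dist_le_mul _ hs _ hs'
  have d2 := h2.dist_le_mul _ hs _ hs'
  have d3 := hL.dist_le_mul _ hr _ hr'
  rw [Real.dist_eq] at d1
  rw [dist_eq_norm] at d2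
  have p1 := hdt _ hs
  have p2 := hdt _ hs'
  have q1 := hc.trans_le p1
  have q2 := hc.trans_le p2
  have e3 : X.v r - X.v r' = (Q.dt (ψ r))⁻¹ • (Q.dx (ψ r) - Q.dx (ψ r')) +
      ((Q.dt (ψ r))⁻¹ - (Q.dt (ψ r'))⁻¹) • Q.dx (ψ r') := by
    rw [e1, e2, smul_sub, sub_smul]; abel
  have i1 : ‖(Q.dt (ψ r))⁻¹‖ ≤ c⁻¹ := by
    rw [Real.norm_of_nonneg (inv_nonneg.2 q1.le)]; gcongr
  have i2 : ‖(Q.dt (ψ r))⁻¹ - (Q.dt (ψ r'))⁻¹‖ ≤ (c * c)⁻¹ * (C * dist (ψ r) (ψ r')) := by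
    rw [inv_sub_inv q1.ne' q2.ne', Real.norm_eq_abs, abs_div, abs_of_pos (mul_pos q1 q2),
      abs_sub_comm, inv_mul_eq_div]
    gcongr
  rw [Real.coe_toNNReal _ hK0, dist_eq_norm, e3]
  calc _ ≤ ‖(Q.dt (ψ r))⁻¹ • (Q.dx (ψ r) - Q.dx (ψ r'))‖ +
        ‖((Q.dt (ψ r))⁻¹ - (Q.dt (ψ r'))⁻¹) • Q.dx (ψ r')‖ := norm_add_le _ _
    _ ≤ c⁻¹ * (C * dist (ψ r) (ψ r')) + (c * c)⁻¹ * (C * dist (ψ r) (ψ r')) * M := by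
        rw [norm_smul, norm_smul]
        gcongr
        exact hM _ hs'
    _ = (c⁻¹ * C + (c * c)⁻¹ * C * M) * dist (ψ r) (ψ r') := by ring
    _ ≤ (c⁻¹ * C + (c * c)⁻¹ * C * M) * (K * dist r r') := by gcongr
    _ = _ := by ring

end Variations

/-! ### Partial derivatives of the extended Lagrangian along the orbit. -/

section FirstVariation

open Filter
open scoped Topology NNReal ENNReal

/-- The total scalar potential as a function of the event. -/
noncomputable def TimeOrbit.scal (X : TimeOrbit) (e : ℝ × E3) : ℝ := scalPot X e.1 e.2

/-- The total vector potential as a function of the event. -/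
noncomputable def TimeOrbit.vec (X : TimeOrbit) (e : ℝ × E3) : E3 := vecPot X e.1 e.2

/-- Reduces a derivative in a direction varying with `s` to four fixed directions with scalar
coefficients. -/
theorem ContinuousLinearMap.prod_E3_apply {F : Type*} [NormedAddCommGroup F] [NormedSpace ℝ F]
    (L : ℝ × E3 →L[ℝ] F) (d : ℝ × E3) :
    L d = d.1 • L (1, 0) + ∑ k : Fin 3, d.2 k • L (0, EuclideanSpace.single k 1) := by
  have e : d = d.1 • ((1 : ℝ), (0 : E3)) +
      ∑ k : Fin 3, d.2 k • ((0 : ℝ), EuclideanSpace.single k (1 : ℝ)) := by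
    refine Prod.ext ?_ ?_
    · simp [Prod.fst_sum]
    · simp only [Prod.snd_add, Prod.smul_snd, smul_zero, zero_add, Prod.snd_sum]
      exact E3.eq_sum d.2
  conv_lhs => rw [e]
  simp only [map_add, map_sum, map_smul]

namespace IsFieldSeg

variable {X : TimeOrbit} {κ : ℝ} {Q : FourOrbit} {a b : ℝ} (h : IsFieldSeg X κ Q a b)
include h

theorem ae_differentiableAt_pot : ∀ᵐ s, s ∈ Icc a b → ∀ σ, IsSign σ →
    DifferentiableAt ℝ (X.pot σ) (Q.t s, Q.x s) ∧
      DifferentiableAt ℝ (X.vpot σ) (Q.t s, Q.x s) := by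
  filter_upwards [h.past.ae_hasFDerivAt_pot, h.future.ae_hasFDerivAt_pot] with s h1 h2 hs σ hσ
  rcases hσ with rfl | rfl
  · exact ⟨(h2 hs).1, (h2 hs).2.1⟩
  · exact ⟨(h1 hs).1, (h1 hs).2.1⟩

/-- Almost everywhere on the segment the total potentials are differentiable. -/
theorem ae_differentiableAt : ∀ᵐ s, s ∈ Ioo a b →
    DifferentiableAt ℝ X.scal (Q.t s, Q.x s) ∧ DifferentiableAt ℝ X.vec (Q.t s, Q.x s) := by
  filter_upwards [h.ae_differentiableAt_pot] with s hd hs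
  have h1 := hd (Ioo_subset_Icc_self hs) (-1) (Or.inr rfl)
  have h2 := hd (Ioo_subset_Icc_self hs) 1 (Or.inl rfl)
  exact ⟨h1.1.add h2.1, h1.2.add h2.2⟩

theorem intervalIntegrable_fderiv (d : ℝ × E3) :
    IntervalIntegrable (fun s => fderiv ℝ X.scal (Q.t s, Q.x s) d) volume a b ∧
    IntervalIntegrable (fun s => fderiv ℝ X.vec (Q.t s, Q.x s) d) volume a b := by
  have i1 := h.past.intervalIntegrable_fderiv_pot d
  have i2 := h.future.intervalIntegrable_fderiv_pot d
  have hae : ∀ᵐ s ∂(volume.restrict (uIoc a b)), ∀ σ, IsSign σ →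
      DifferentiableAt ℝ (X.pot σ) (Q.t s, Q.x s) ∧
        DifferentiableAt ℝ (X.vpot σ) (Q.t s, Q.x s) := by
    rw [ae_restrict_iff' measurableSet_uIoc]
    filter_upwards [h.ae_differentiableAt_pot] with s hs hsI
    rw [uIoc_of_le h.past.lt.le] at hsI
    exact hs (Ioc_subset_Icc_self hsI)
  refine ⟨(i1.1.add i2.1).congr_ae ?_, (i1.2.add i2.2).congr_ae ?_⟩
  · filter_upwards [hae] with s hs
    have := ((hs (-1) (Or.inr rfl)).1.hasFDerivAt.add
      (hs 1 (Or.inl rfl)).1.hasFDerivAt).fderiv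
    exact (DFunLike.congr_fun this d).symm
  · filter_upwards [hae] with s hs
    have := ((hs (-1) (Or.inr rfl)).2.hasFDerivAt.add
      (hs 1 (Or.inl rfl)).2.hasFDerivAt).fderiv
    exact (DFunLike.congr_fun this d).symm

theorem eventually_exists_onCone {s : ℝ} (hs : s ∈ Ioo a b) :
    ∀ᶠ e : ℝ × E3 in 𝓝 (Q.t s, Q.x s), ∀ σ, IsSign σ → ∃ τ, X.OnCone σ e.1 e.2 τ := by
  have key : ∀ {σ}, IsSign σ → ∀ᶠ e : ℝ × E3 in 𝓝 (Q.t s, Q.x s), ∃ τ, X.OnCone σ e.1 e.2 τ :=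
    fun hσ => (h _ hσ).orbit.eventually_exists_onCone hσ
      ((h _ hσ).onCone (Ioo_subset_Icc_self hs)) ((h _ hσ).coneTime_mem_Ioo hs)
  filter_upwards [key (Or.inr rfl), key (Or.inl rfl)] with e h1 h2 σ hσ
  rcases hσ with rfl | rfl
  · exact h2
  · exact h1

variable (m : ℝ) {Q' : FourOrbit} (hQ' : Q'.IsTBVXBV) (hR' : IsReparam Q' X)
include hQ' hR'

theorem eventually_partialLagExt_eq {s : ℝ} (hs : s ∈ Ioo a b) (τ : ℝ) (u : E3) :
    ∀ᶠ e : ℝ × E3 in 𝓝 (Q.t s, Q.x s), partialLagExt m Q' e.1 e.2 τ u =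
      localLagExt m τ u + τ * X.scal e - inner ℝ u (X.vec e) := by
  filter_upwards [h.eventually_exists_onCone hs] with e he
  exact hR'.partialLagExt_eq hQ' (he _ (Or.inr rfl)) (he _ (Or.inl rfl)) τ u

theorem hasFDerivAt_partialLagExt {s : ℝ} (hs : s ∈ Ioo a b)
    (h1 : DifferentiableAt ℝ X.scal (Q.t s, Q.x s)) (h2 : DifferentiableAt ℝ X.vec (Q.t s, Q.x s))
    (τ : ℝ) (u : E3) :
    HasFDerivAt (fun e : ℝ × E3 => partialLagExt m Q' e.1 e.2 τ u)
      (τ • fderiv ℝ X.scal (Q.t s, Q.x s) -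
        (innerSL ℝ u).comp (fderiv ℝ X.vec (Q.t s, Q.x s))) (Q.t s, Q.x s) :=
  (((h1.hasFDerivAt.const_mul τ).const_add (localLagExt m τ u)).sub
    ((innerSL ℝ u).hasFDerivAt.comp _ h2.hasFDerivAt)).congr_of_eventuallyEq
      (h.eventually_partialLagExt_eq m hQ' hR' hs τ u)

theorem dtLagExt_eq {s : ℝ} (hs : s ∈ Ioo a b)
    (h1 : DifferentiableAt ℝ X.scal (Q.t s, Q.x s))
    (h2 : DifferentiableAt ℝ X.vec (Q.t s, Q.x s)) :
    dtLagExt m Q Q' s = Q.dt s * fderiv ℝ X.scal (Q.t s, Q.x s) (1, 0) -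
      inner ℝ (Q.dx s) (fderiv ℝ X.vec (Q.t s, Q.x s) (1, 0)) := by
  have := (h.hasFDerivAt_partialLagExt m hQ' hR' hs h1 h2 (Q.dt s) (Q.dx s)).comp_hasDerivAt
    (Q.t s) ((hasDerivAt_id (Q.t s)).prodMk (hasDerivAt_const (Q.t s) (Q.x s)))
  exact this.deriv

theorem inner_dxLagExt_eq {s : ℝ} (hs : s ∈ Ioo a b)
    (h1 : DifferentiableAt ℝ X.scal (Q.t s, Q.x s))
    (h2 : DifferentiableAt ℝ X.vec (Q.t s, Q.x s)) (u : E3) :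
    inner ℝ (dxLagExt m Q Q' s) u = Q.dt s * fderiv ℝ X.scal (Q.t s, Q.x s) (0, u) -
      inner ℝ (Q.dx s) (fderiv ℝ X.vec (Q.t s, Q.x s) (0, u)) := by
  have := (h.hasFDerivAt_partialLagExt m hQ' hR' hs h1 h2 (Q.dt s) (Q.dx s)).comp
    (Q.x s) ((hasFDerivAt_const (Q.t s) (Q.x s)).prodMk (hasFDerivAt_id (Q.x s)))
  rw [dxLagExt, inner_gradient_left]
  exact DFunLike.congr_fun this.fderiv u

theorem intervalIntegrable_dtLagExt : IntervalIntegrable (dtLagExt m Q Q') volume a b := by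
  have hab := h.past.lt.le
  obtain ⟨i1, i2⟩ := h.intervalIntegrable_fderiv (1, 0)
  refine (((h.past.curve.time.bv.mono h.past.subset).smul_intervalIntegrable hab i1).sub
    ((h.past.curve.bv.mono h.past.subset).inner_intervalIntegrable hab i2)).congr_ae ?_
  rw [EventuallyEq, ae_restrict_iff' measurableSet_uIoc]
  -- Interval integrals run over the half-open interval; the end point `b` is discarded to reach the
  -- open one, where the feet are interior.
  filter_upwards [h.ae_differentiableAt, measure_eq_zero_iff_ae_notMem.1
    (measure_singleton (μ := volume) b)] with s hd hb hs
  rw [uIoc_of_le hab] at hs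
  have hs' : s ∈ Ioo a b := ⟨hs.1, lt_of_le_of_ne hs.2 hb⟩
  exact (h.dtLagExt_eq m hQ' hR' hs' (hd hs').1 (hd hs').2).symm

theorem intervalIntegrable_dxLagExt : IntervalIntegrable (dxLagExt m Q Q') volume a b := by
  have hab := h.past.lt.le
  refine intervalIntegrable_of_coord fun k => ?_
  obtain ⟨i1, i2⟩ := h.intervalIntegrable_fderiv (0, EuclideanSpace.single k 1)
  refine (((h.past.curve.time.bv.mono h.past.subset).smul_intervalIntegrable hab i1).sub
    ((h.past.curve.bv.mono h.past.subset).inner_intervalIntegrable hab i2)).congr_ae ?_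
  rw [EventuallyEq, ae_restrict_iff' measurableSet_uIoc]
  filter_upwards [h.ae_differentiableAt, measure_eq_zero_iff_ae_notMem.1
    (measure_singleton (μ := volume) b)] with s hd hb hs
  rw [uIoc_of_le hab] at hs
  have hs' : s ∈ Ioo a b := ⟨hs.1, lt_of_le_of_ne hs.2 hb⟩
  have := h.inner_dxLagExt_eq m hQ' hR' hs' (hd hs').1 (hd hs').2 (EuclideanSpace.single k 1)
  rw [EuclideanSpace.inner_single_right] at this
  simp only [smul_eq_mul]
  rw [← this]
  simp

theorem ae_differentiableAt_partialLagExt : ∀ᵐ s ∂(volume.restrict (Icc a b)),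
    DifferentiableAt ℝ (fun p : ℝ × E3 => partialLagExt m Q' p.1 p.2 (Q.dt s) (Q.dx s))
      (Q.t s, Q.x s) := by
  rw [Measure.restrict_congr_set Ioo_ae_eq_Icc.symm, ae_restrict_iff' measurableSet_Ioo]
  filter_upwards [h.ae_differentiableAt] with s hd hs
  exact (h.hasFDerivAt_partialLagExt m hQ' hR' hs (hd hs).1 (hd hs).2 _ _).differentiableAt

end IsFieldSeg

/-! ### Differentiation of the action integrals -/

/-- The derivative of the interaction integrand under the variation `w`. -/
noncomputable def interVar (σ : ℝ) (Q : FourOrbit) (X : TimeOrbit) (w : Variation) (s : ℝ) : ℝ :=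
  (w.db0 s * X.pot σ (Q.t s, Q.x s) +
    Q.dt s * fderiv ℝ (X.pot σ) (Q.t s, Q.x s) (w.b0 s, w.b s)) -
  (inner ℝ (Q.dx s) (fderiv ℝ (X.vpot σ) (Q.t s, Q.x s) (w.b0 s, w.b s)) +
    inner ℝ (w.db s) (X.vpot σ (Q.t s, Q.x s)))

namespace IsConeSeg

variable {X : TimeOrbit} {κ σ : ℝ} {Q : FourOrbit} {a b : ℝ} (h : IsConeSeg X κ σ Q a b)
include h

theorem intervalIntegrable_fderiv_pot_along {d : ℝ → ℝ × E3}
    (h1 : BoundedVariationOn (fun s => (d s).1) (Icc a b))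
    (h2 : BoundedVariationOn (fun s => (d s).2) (Icc a b)) :
    IntervalIntegrable (fun s => fderiv ℝ (X.pot σ) (Q.t s, Q.x s) (d s)) volume a b ∧
    IntervalIntegrable (fun s => fderiv ℝ (X.vpot σ) (Q.t s, Q.x s) (d s)) volume a b := by
  have hab := h.lt.le
  constructor
  · refine ((h1.smul_intervalIntegrable hab (h.intervalIntegrable_fderiv_pot (1, 0)).1).add
      (IntervalIntegrable.sum Finset.univ fun k _ => (h2.coord k).smul_intervalIntegrable hab
        (h.intervalIntegrable_fderiv_pot (0, EuclideanSpace.single k 1)).1)).congr fun s _ => ?_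
    rw [ContinuousLinearMap.prod_E3_apply _ (d s), Finset.sum_apply]
  · refine ((h1.smul_intervalIntegrable hab (h.intervalIntegrable_fderiv_pot (1, 0)).2).add
      (IntervalIntegrable.sum Finset.univ fun k _ => (h2.coord k).smul_intervalIntegrable hab
        (h.intervalIntegrable_fderiv_pot (0, EuclideanSpace.single k 1)).2)).congr fun s _ => ?_
    rw [ContinuousLinearMap.prod_E3_apply _ (d s), Finset.sum_apply]

theorem intervalIntegrable_interVar {w : Variation} (hw : w.IsAdmissible a b) :
    IntervalIntegrable (interVar σ Q X w) volume a b := by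
  have hab := h.lt.le
  obtain ⟨i1, i2⟩ := h.intervalIntegrable_fderiv_pot_along (d := fun s => (w.b0 s, w.b s))
    (hw.boundedVariationOn_b0 hab) (hw.boundedVariationOn_b hab)
  exact (((hw.bv0.fun_mul h.boundedVariationOn_pot).intervalIntegrable_real hab).add
    ((h.curve.time.bv.mono h.subset).smul_intervalIntegrable hab i1)).sub
    (((h.curve.bv.mono h.subset).inner_intervalIntegrable hab i2).add
      ((hw.bv.fun_inner h.boundedVariationOn_vpot).intervalIntegrable_real hab))

end IsConeSeg

theorem TimeOrbit.IsXBVWith.norm_pot_le {X : TimeOrbit} {κ σ : ℝ} (h : X.IsXBVWith κ)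
    (hσ : IsSign σ) {r₀ : ℝ} (hr₀ : 0 < r₀) {e : ℝ × E3} {τ : ℝ} (h1 : X.OnCone σ e.1 e.2 τ)
    (hr : r₀ ≤ ‖e.2 - X.x τ‖) :
    |X.pot σ e| ≤ (2 * (1 - κ) * r₀)⁻¹ ∧ ‖X.vpot σ e‖ ≤ (2 * (1 - κ) * r₀)⁻¹ := by
  have hpos : 0 < 1 - κ := sub_pos.2 h.lt_one
  have hc : 2 * (1 - κ) * r₀ ≤ coneDen σ X e.1 e.2 :=
    le_trans (by gcongr) (h.le_coneDen hσ h1)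
  have hc0 : 0 < 2 * (1 - κ) * r₀ := by positivity
  have hp : |(coneDen σ X e.1 e.2)⁻¹| ≤ (2 * (1 - κ) * r₀)⁻¹ := by
    rw [abs_of_pos (inv_pos.2 (hc0.trans_le hc))]
    gcongr
  refine ⟨hp, ?_⟩
  rw [vpot, norm_smul, Real.norm_eq_abs, h.coneTime_eq hσ h1]
  calc _ ≤ (2 * (1 - κ) * r₀)⁻¹ * 1 := by
        gcongr
        exact (h.bound τ h1.1).trans h.lt_one.le
    _ = _ := mul_one _

theorem abs_inter_sub_le {τ τ' p p' : ℝ} {u u' A A' : E3} {M P C δ : ℝ} (hM : 0 ≤ M)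
    (hP : |p'| ≤ P) (hA : ‖A'‖ ≤ P) (hτ : |τ| ≤ M) (hu : ‖u‖ ≤ M) (hττ : |τ - τ'| ≤ δ)
    (huu : ‖u - u'‖ ≤ δ) (hpp : |p - p'| ≤ C) (hAA : ‖A - A'‖ ≤ C) :
    |(τ * p - inner ℝ u A) - (τ' * p' - inner ℝ u' A')| ≤ 2 * (M * C + δ * P) := by
  have hC := (abs_nonneg _).trans hpp
  have hδ := (abs_nonneg _).trans hττ
  have e : (τ * p - inner ℝ u A) - (τ' * p' - inner ℝ u' A') =
      (τ * (p - p') + (τ - τ') * p') - (inner ℝ u (A - A') + inner ℝ (u - u') A') := by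
    rw [inner_sub_right, inner_sub_left]; ring
  rw [e]
  have i1 : |τ * (p - p')| ≤ M * C := by rw [abs_mul]; gcongr
  have i2 : |(τ - τ') * p'| ≤ δ * P := by rw [abs_mul]; gcongr
  have i3 : |inner ℝ u (A - A')| ≤ M * C := (abs_real_inner_le_norm _ _).trans (by gcongr)
  have i4 : |inner ℝ (u - u') A'| ≤ δ * P := (abs_real_inner_le_norm _ _).trans (by gcongr)
  have j1 := abs_add_le (τ * (p - p')) ((τ - τ') * p')
  have j2 := abs_add_le (inner ℝ u (A - A')) (inner ℝ (u - u') A')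
  have j3 := abs_sub (τ * (p - p') + (τ - τ') * p') (inner ℝ u (A - A') + inner ℝ (u - u') A')
  linarith

end FirstVariation

/-! ### The first variation as derivative of the action. -/

section Gateaux

open Filter
open scoped Topology NNReal ENNReal

theorem hasDerivAt_const_add_mul (x v : ℝ) : HasDerivAt (fun ε : ℝ => x + ε * v) v 0 := by
  simpa using ((hasDerivAt_id (0 : ℝ)).mul_const v).const_add x

theorem hasDerivAt_const_add_smul {E : Type*} [NormedAddCommGroup E] [NormedSpace ℝ E] (x v : E) :
    HasDerivAt (fun ε : ℝ => x + ε • v) v 0 := by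
  simpa using ((hasDerivAt_id (0 : ℝ)).smul_const v).const_add x

/-- Differentiation under the integral sign for integrands that are Lipschitz in the parameter. -/
theorem hasDerivAt_integral_of_lip {F : ℝ → ℝ → ℝ} {F' : ℝ → ℝ} {a b ε₀ L : ℝ} (hab : a ≤ b)
    (hε₀ : 0 < ε₀) (hF : ∀ ε, |ε| < ε₀ → IntervalIntegrable (F ε) volume a b)
    (hF' : IntervalIntegrable F' volume a b)
    (hL : ∀ s ∈ Icc a b, ∀ ε ε', |ε| < ε₀ → |ε'| < ε₀ → |F ε s - F ε' s| ≤ L * |ε - ε'|)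
    (hd : ∀ᵐ s, s ∈ Icc a b → HasDerivAt (fun ε => F ε s) (F' s) 0) :
    HasDerivAt (fun ε => ∫ s in a..b, F ε s) (∫ s in a..b, F' s) 0 := by
  refine (intervalIntegral.hasDerivAt_integral_of_dominated_loc_of_lip (F := F) (F' := F')
    (bound := fun _ => L) (Metric.ball_mem_nhds (0 : ℝ) hε₀) ?_ (hF 0 (by simpa using hε₀))
    hF'.def'.aestronglyMeasurable ?_ intervalIntegrable_const ?_).2
  · filter_upwards [Metric.ball_mem_nhds (0 : ℝ) hε₀] with ε hε
    exact (hF ε (by simpa using hε)).def'.aestronglyMeasurable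
  · refine Eventually.of_forall fun s hs => LipschitzOnWith.of_dist_le_mul fun ε hε ε' hε' => ?_
    rw [uIoc_of_le hab] at hs
    rw [Real.dist_eq, Real.dist_eq, Real.coe_nnabs]
    refine (hL s (Ioc_subset_Icc_self hs) ε ε' (by simpa using hε) (by simpa using hε')).trans ?_
    gcongr
    exact le_abs_self L
  · filter_upwards [hd] with s h1 hs
    rw [uIoc_of_le hab] at hs
    exact h1 (Ioc_subset_Icc_self hs)

/-- The difference of the roots is the difference of the radicands, at most `4 M δ`, over the sum of
the roots, at least `2 √c`. -/
theorem abs_localLagExt_sub_le {m c M δ τ τ' : ℝ} {u u' : E3} (hc : 0 < c)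
    (h1 : c ≤ τ ^ 2 - ‖u‖ ^ 2) (h2 : c ≤ τ' ^ 2 - ‖u'‖ ^ 2) (hτ : |τ| ≤ M) (hτ' : |τ'| ≤ M)
    (hu : ‖u‖ ≤ M) (hu' : ‖u'‖ ≤ M) (hττ : |τ - τ'| ≤ δ) (huu : ‖u - u'‖ ≤ δ) :
    |localLagExt m τ u - localLagExt m τ' u'| ≤
      |m| * (1 + 2 * M / Real.sqrt c) * δ := by
  have hM := (abs_nonneg _).trans hτ
  have hδ := (abs_nonneg _).trans hττ
  have hS := Real.sqrt_pos.2 hc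
  set A := τ ^ 2 - ‖u‖ ^ 2 with hA
  set A' := τ' ^ 2 - ‖u'‖ ^ 2 with hA'
  have s1 := Real.sqrt_le_sqrt h1
  have s2 := Real.sqrt_le_sqrt h2
  have q1 := Real.sq_sqrt (hc.le.trans h1)
  have q2 := Real.sq_sqrt (hc.le.trans h2)
  have hAA : |A - A'| ≤ 4 * M * δ := by
    have e : A - A' = (τ - τ') * (τ + τ') - (‖u‖ - ‖u'‖) * (‖u‖ + ‖u'‖) := by
      rw [hA, hA']; ring
    have i1 : |(τ - τ') * (τ + τ')| ≤ δ * (2 * M) := by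
      rw [abs_mul]
      gcongr
      exact (abs_add_le _ _).trans (by linarith)
    have i2 : |(‖u‖ - ‖u'‖) * (‖u‖ + ‖u'‖)| ≤ δ * (2 * M) := by
      rw [abs_mul]
      refine mul_le_mul ((abs_norm_sub_norm_le _ _).trans huu) ?_ (abs_nonneg _) hδ
      rw [abs_of_nonneg (by positivity)]
      linarith
    rw [e]
    exact (abs_sub _ _).trans (by linarith)
  have hmul : (Real.sqrt A - Real.sqrt A') * (Real.sqrt A + Real.sqrt A') = A - A' := by
    linear_combination q1 - q2
  have hsq : |Real.sqrt A - Real.sqrt A'| ≤ 2 * M / Real.sqrt c * δ := by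
    have i3 : |Real.sqrt A - Real.sqrt A'| * (2 * Real.sqrt c) ≤ 4 * M * δ := by
      refine le_trans ?_ hAA
      rw [← hmul, abs_mul]
      gcongr
      exact le_trans (by linarith) (le_abs_self _)
    rw [div_mul_eq_mul_div, le_div_iff₀ hS]
    linarith
  have e : localLagExt m τ u - localLagExt m τ' u' =
      m * ((τ - τ') - (Real.sqrt A - Real.sqrt A')) := by
    simp only [localLagExt, ← hA, ← hA']; ring
  rw [e, abs_mul, mul_assoc]
  gcongr
  refine (abs_sub _ _).trans ?_
  linarith

/-- A common bound for the derivatives of the varied orbits. -/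
theorem FourOrbit.IsTBVXBV.exists_bound_vary {Q : FourOrbit} (h : Q.IsTBVXBV) {w : Variation}
    {B : ℝ} (hb : ∀ s, |w.b0 s| ≤ B ∧ ‖w.b s‖ ≤ B ∧ |w.db0 s| ≤ B ∧ ‖w.db s‖ ≤ B) (ε₀ : ℝ) :
    ∃ M, 0 ≤ M ∧ ∀ s ∈ Icc Q.lo Q.hi, ∀ ε, |ε| < ε₀ →
      |(Q.vary w ε).dt s| ≤ M ∧ ‖(Q.vary w ε).dx s‖ ≤ M := by
  obtain ⟨C₁, hC₁, h1⟩ := h.time.bv.exists_norm_le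
  obtain ⟨C₂, hC₂, h2⟩ := h.bv.exists_norm_le
  have hB : 0 ≤ B := (abs_nonneg _).trans (hb 0).1
  refine ⟨C₁ + C₂ + |ε₀| * B, by positivity, fun s hs ε hε => ?_⟩
  obtain ⟨-, -, i1, i2⟩ := hb s
  have hε' : |ε| ≤ |ε₀| := hε.le.trans (le_abs_self _)
  have j1 : |ε * w.db0 s| ≤ |ε₀| * B := by rw [abs_mul]; gcongr
  have j2 : ‖ε • w.db s‖ ≤ |ε₀| * B := by rw [norm_smul, Real.norm_eq_abs]; gcongr
  have k1 := h1 s hs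
  have k2 := h2 s hs
  rw [Real.norm_eq_abs] at k1
  exact ⟨(abs_add_le _ _).trans (by linarith), (norm_add_le _ _).trans (by linarith)⟩

theorem FourOrbit.vary_sub (Q : FourOrbit) {w : Variation}
    {B : ℝ} (hb : ∀ s, |w.b0 s| ≤ B ∧ ‖w.b s‖ ≤ B ∧ |w.db0 s| ≤ B ∧ ‖w.db s‖ ≤ B) (s ε ε' : ℝ) :
    |(Q.vary w ε).t s - (Q.vary w ε').t s| ≤ B * |ε - ε'| ∧
    ‖(Q.vary w ε).x s - (Q.vary w ε').x s‖ ≤ B * |ε - ε'| ∧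
    |(Q.vary w ε).dt s - (Q.vary w ε').dt s| ≤ B * |ε - ε'| ∧
    ‖(Q.vary w ε).dx s - (Q.vary w ε').dx s‖ ≤ B * |ε - ε'| := by
  obtain ⟨i1, i2, i3, i4⟩ := hb s
  have key : ∀ x v : ℝ, |v| ≤ B → |(x + ε * v) - (x + ε' * v)| ≤ B * |ε - ε'| := by
    intro x v hv
    rw [add_sub_add_left_eq_sub, ← sub_mul, abs_mul, mul_comm]
    gcongr
  have key' : ∀ x v : E3, ‖v‖ ≤ B → ‖(x + ε • v) - (x + ε' • v)‖ ≤ B * |ε - ε'| := by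
    intro x v hv
    rw [add_sub_add_left_eq_sub, ← sub_smul, norm_smul, mul_comm, Real.norm_eq_abs]
    gcongr
  exact ⟨key _ _ i1, key' _ _ i2, key _ _ i3, key' _ _ i4⟩

/-- The derivative of the local integrand under the variation `w`. -/
noncomputable def localVar (m : ℝ) (Q : FourOrbit) (w : Variation) (s : ℝ) : ℝ :=
  m * (1 - Q.dt s / Real.sqrt (Q.dt s ^ 2 - ‖Q.dx s‖ ^ 2)) * w.db0 s +
    m / Real.sqrt (Q.dt s ^ 2 - ‖Q.dx s‖ ^ 2) * inner ℝ (Q.dx s) (w.db s)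

theorem FourOrbit.IsTBVXBV.boundedVariationOn_localVar {Q : FourOrbit} (h : Q.IsTBVXBV) (m : ℝ)
    {a b : ℝ} (ha : Q.lo ≤ a) (hb : b ≤ Q.hi) {w : Variation} (hw : w.IsAdmissible a b) :
    BoundedVariationOn (localVar m Q w) (Icc a b) := by
  obtain ⟨c, hc, hcb⟩ := h.exists_le_sq_sub
  have hsub := Icc_subset_Icc ha hb
  have hi : BoundedVariationOn (fun s => (Real.sqrt (Q.dt s ^ 2 - ‖Q.dx s‖ ^ 2))⁻¹) (Icc a b) :=
    (h.boundedVariationOn_sqrt.mono hsub).fun_inv (Real.sqrt_pos.2 hc)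
      fun s hs => Real.sqrt_le_sqrt (hcb s (hsub hs))
  have hm := boundedVariationOn_const (s := Icc a b) m
  exact ((hm.fun_mul ((boundedVariationOn_const 1).fun_sub
    ((h.time.bv.mono hsub).fun_mul hi))).fun_mul hw.bv0).fun_add
      ((hm.fun_mul hi).fun_mul ((h.bv.mono hsub).fun_inner hw.bv))

theorem FourOrbit.IsTBVXBV.hasDerivAt_integral_localAlong {Q : FourOrbit} (h : Q.IsTBVXBV) (m : ℝ)
    {a b : ℝ} (ha : Q.lo ≤ a) (hab : a ≤ b) (hb : b ≤ Q.hi) {w : Variation}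
    (hw : w.IsAdmissible a b) :
    HasDerivAt (fun ε => ∫ s in a..b, localAlong m (Q.vary w ε) s)
      (∫ s in a..b, localVar m Q w s) 0 := by
  obtain ⟨ε₀, hε₀, c, hc, hv⟩ := h.exists_vary (hw.extend hab ha hb)
  obtain ⟨B, hB, hbd⟩ := hw.exists_bound hab
  obtain ⟨M, hM, hbM⟩ := h.exists_bound_vary hbd ε₀
  have hsub := Icc_subset_Icc ha hb
  refine hasDerivAt_integral_of_lip (L := |m| * (1 + 2 * M / Real.sqrt c) * B) hab hε₀
    (fun ε hε => (((hv ε hε).1.boundedVariationOn_localAlong m).mono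
      hsub).intervalIntegrable_real hab)
    ((h.boundedVariationOn_localVar m ha hb hw).intervalIntegrable_real hab)
    (fun s hs ε ε' hε hε' => ?_) (Eventually.of_forall fun s hs => ?_)
  · obtain ⟨-, -, d1, d2⟩ := Q.vary_sub hbd s ε ε'
    have m1 := hbM s (hsub hs) ε hε
    have m2 := hbM s (hsub hs) ε' hε'
    rw [mul_assoc _ B]
    exact abs_localLagExt_sub_le hc ((hv ε hε).2 s (hsub hs)) ((hv ε' hε').2 s (hsub hs)) m1.1 m2.1
      m1.2 m2.2 d1 d2
  · have e : (Q.dt s + 0 * w.db0 s, Q.dx s + (0 : ℝ) • w.db s) = (Q.dt s, Q.dx s) := by simp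
    have hF := hasFDerivAt_localLagExt m (h.sq_sub_pos (hsub hs))
    have hc : HasDerivAt (fun ε : ℝ => (Q.dt s + ε * w.db0 s, Q.dx s + ε • w.db s))
        (w.db0 s, w.db s) 0 :=
      (hasDerivAt_const_add_mul _ _).prodMk (hasDerivAt_const_add_smul _ _)
    rw [← e] at hF
    refine (hF.comp_hasDerivAt 0 hc).congr_deriv ?_
    simp [localVar]

/-- The derivative of the integrand exists almost everywhere by `ae_hasFDerivAt_pot` alone. The
Lipschitz velocity of the other particle supplies the uniform bound for differentiating under the
integral. -/
theorem IsConeSeg.hasDerivAt_integral_interAlong {X : TimeOrbit} {κ σ : ℝ} {Q Q' : FourOrbit}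
    {a b : ℝ} (h : IsConeSeg X κ σ Q a b) (hQ' : Q'.IsTBVXBV) (hR' : IsReparam Q' X)
    (hne : ∀ s ∈ Icc Q.lo Q.hi, ∀ τ ∈ Icc X.lo X.hi, (Q.t s, Q.x s) ≠ (τ, X.x τ)) {K : ℝ≥0}
    (hK : LipschitzOnWith K X.v (Icc X.lo X.hi)) {w : Variation} (hw : w.IsAdmissible a b) :
    HasDerivAt (fun ε => ∫ s in a..b, interAlong σ (Q.vary w ε) Q' s)
      (∫ s in a..b, interVar σ Q X w s) 0 := by
  have hab := h.lt.le
  obtain ⟨ε₀, hε₀, r₀, hr₀, R, hv⟩ := h.exists_vary hne hw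
  obtain ⟨B, hB, hbd⟩ := hw.exists_bound hab
  obtain ⟨M, hM, hbM⟩ := h.curve.exists_bound_vary hbd ε₀
  obtain ⟨C, hC, hlip⟩ := h.orbit.exists_lipschitz_pot h.sign hK (R := R) hr₀
  set P := (2 * (1 - κ) * r₀)⁻¹ with hP
  have hform : ∀ ε, |ε| < ε₀ → ∀ s ∈ Icc a b, interAlong σ (Q.vary w ε) Q' s =
      (Q.vary w ε).dt s * X.pot σ ((Q.vary w ε).t s, (Q.vary w ε).x s) -
        inner ℝ ((Q.vary w ε).dx s) (X.vpot σ ((Q.vary w ε).t s, (Q.vary w ε).x s)) :=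
    fun ε hε s hs => hR'.interLagExt_eq hQ' h.sign ((hv ε hε).1.exists_onCone s hs) _ _
  refine hasDerivAt_integral_of_lip (L := 2 * (M * (C * (B + B)) + B * P)) hab hε₀
    (fun ε hε => ((hv ε hε).1.boundedVariationOn_interAlong hQ' hR').intervalIntegrable_real hab)
    (h.intervalIntegrable_interVar hw) (fun s hs ε ε' hε hε' => ?_) ?_
  · obtain ⟨d1, d2, d3, d4⟩ := Q.vary_sub hbd s ε ε'
    have m1 := hbM s (h.subset hs) ε hε
    obtain ⟨τ, hτ⟩ := (hv ε hε).1.exists_onCone s hs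
    obtain ⟨τ', hτ'⟩ := (hv ε' hε').1.exists_onCone s hs
    have k1 := (hv ε hε).2 s hs τ hτ
    have k2 := (hv ε' hε').2 s hs τ' hτ'
    obtain ⟨l1, l2⟩ := hlip ((Q.vary w ε).t s, (Q.vary w ε).x s)
      ((Q.vary w ε').t s, (Q.vary w ε').x s) τ τ' hτ hτ' k1.1 k2.1 k2.2
    obtain ⟨p1, p2⟩ := h.orbit.norm_pot_le h.sign hr₀
      (e := ((Q.vary w ε').t s, (Q.vary w ε').x s)) hτ' k2.1
    have hCd : C * (|(Q.vary w ε).t s - (Q.vary w ε').t s| +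
        ‖(Q.vary w ε).x s - (Q.vary w ε').x s‖) ≤ C * (B + B) * |ε - ε'| := by
      rw [mul_assoc, add_mul]; gcongr
    rw [hform ε hε s hs, hform ε' hε' s hs]
    refine (abs_inter_sub_le hM p1 p2 m1.1 m1.2 d3 d4 (l1.trans hCd) (l2.trans hCd)).trans_eq ?_
    ring
  · filter_upwards [h.ae_hasFDerivAt_pot] with s hd hs
    obtain ⟨hd1, hd2, -⟩ := hd hs
    have e : Q.t s + 0 * w.b0 s = Q.t s ∧ Q.x s + (0 : ℝ) • w.b s = Q.x s := by simp
    have hc : HasDerivAt (fun ε : ℝ => (Q.t s + ε * w.b0 s, Q.x s + ε • w.b s))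
        (w.b0 s, w.b s) 0 :=
      (hasDerivAt_const_add_mul _ _).prodMk (hasDerivAt_const_add_smul _ _)
    have f1 : HasFDerivAt (X.pot σ) (fderiv ℝ (X.pot σ) (Q.t s, Q.x s))
        (Q.t s + 0 * w.b0 s, Q.x s + (0 : ℝ) • w.b s) := by rw [e.1, e.2]; exact hd1.hasFDerivAt
    have f2 : HasFDerivAt (X.vpot σ) (fderiv ℝ (X.vpot σ) (Q.t s, Q.x s))
        (Q.t s + 0 * w.b0 s, Q.x s + (0 : ℝ) • w.b s) := by rw [e.1, e.2]; exact hd2.hasFDerivAt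
    have g := ((hasDerivAt_const_add_mul (Q.dt s) (w.db0 s)).mul (f1.comp_hasDerivAt 0 hc)).sub
      ((hasDerivAt_const_add_smul (Q.dx s) (w.db s)).inner ℝ (f2.comp_hasDerivAt 0 hc))
    refine (g.congr_of_eventuallyEq ?_).congr_deriv ?_
    · filter_upwards [Metric.ball_mem_nhds (0 : ℝ) hε₀] with ε hε
      exact hform ε (by simpa using hε) s hs
    · simp [interVar]

/-- The full-orbit interaction integral only feels the variation on the free segment. -/
theorem integral_interVar_eq {X : TimeOrbit} {σ : ℝ} {Q : FourOrbit} {a b : ℝ} (ha : Q.lo ≤ a)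
    (hab : a ≤ b) (hb : b ≤ Q.hi) {w : Variation} (hw : w.IsAdmissible a b) :
    ∫ s in Q.lo..Q.hi, interVar σ Q X w s = ∫ s in a..b, interVar σ Q X w s := by
  refine intervalIntegral_eq_of_eq_zero_outside ha hab hb fun s hs => ?_
  obtain ⟨h1, h2, h3, h4⟩ := hw.outside s hs
  rw [interVar, h1, h2, h3, h4, Prod.mk_zero_zero, map_zero, map_zero]
  simp

/-- Regroups the integrand into the local term and the two cones, as the action is composed; the sum
over the cones is symmetric, so `σ` may be either sign. -/
theorem IsFieldSeg.firstVariation_eq {X : TimeOrbit} {κ : ℝ} {Q Q' : FourOrbit} {a b : ℝ}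
    (h : IsFieldSeg X κ Q a b) (m : ℝ) (hQ' : Q'.IsTBVXBV) (hR' : IsReparam Q' X)
    {w : Variation} (hw : w.IsAdmissible a b) {σ : ℝ} (hσ : IsSign σ) :
    firstVariation m Q Q' a b w = (∫ s in a..b, localVar m Q w s) +
      (∫ s in a..b, interVar σ Q X w s) + ∫ s in a..b, interVar (-σ) Q X w s := by
  have hab := h.past.lt.le
  have i1 := (h.past.curve.boundedVariationOn_localVar m h.past.lo_le h.past.le_hi
    hw).intervalIntegrable_real hab
  have i2 := (h σ hσ).intervalIntegrable_interVar hw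
  have i3 := (h (-σ) hσ.neg).intervalIntegrable_interVar hw
  rw [← intervalIntegral.integral_add i1 i2, ← intervalIntegral.integral_add (i1.add i2) i3,
    firstVariation]
  refine intervalIntegral.integral_congr_ae ?_
  filter_upwards [h.ae_differentiableAt_pot, measure_eq_zero_iff_ae_notMem.1
    (measure_singleton (μ := volume) b)] with s hd hb hs
  rw [uIoc_of_le hab] at hs
  have hs' : s ∈ Ioo a b := ⟨hs.1, lt_of_le_of_ne hs.2 hb⟩
  have hsI := Ioc_subset_Icc_self hs
  have d1 := hd hsI (-1) (Or.inr rfl)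
  have d2 := hd hsI 1 (Or.inl rfl)
  have f1 : HasFDerivAt X.scal _ (Q.t s, Q.x s) := d1.1.hasFDerivAt.add d2.1.hasFDerivAt
  have f2 : HasFDerivAt X.vec _ (Q.t s, Q.x s) := d1.2.hasFDerivAt.add d2.2.hasFDerivAt
  have e3 := h.dtLagExt_eq m hQ' hR' hs' f1.differentiableAt f2.differentiableAt
  have e4 := h.inner_dxLagExt_eq m hQ' hR' hs' f1.differentiableAt f2.differentiableAt (w.b s)
  have hsum : interVar σ Q X w s + interVar (-σ) Q X w s =
      interVar (-1) Q X w s + interVar 1 Q X w s := by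
    rcases hσ with rfl | rfl
    · ring
    · rw [neg_neg]
  have hdir : ((w.b0 s, w.b s) : ℝ × E3) = w.b0 s • ((1 : ℝ), (0 : E3)) + (0, w.b s) := by simp
  rw [e3, e4, h.momentumExt0_eq m hQ' hR' hsI, h.momentumExt_eq m hQ' hR' hsI, f1.fderiv,
    f2.fderiv, add_assoc (localVar m Q w s), hsum, scalPot_eq, vecPot_eq, localVar, interVar,
    interVar, hdir]
  simp only [map_add, map_smul, add_apply, inner_add_right,
    inner_add_left, inner_sub_left, real_inner_smul_left, real_inner_smul_right, smul_eq_mul]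
  rw [real_inner_comm (w.db s) (X.vpot (-1) _), real_inner_comm (w.db s) (X.vpot 1 _)]
  ring

theorem IsBoundaryPair.hasDerivAt_actionExt {Q : Fin 2 → FourOrbit} {k : Fin 2 → ℝ}
    (h : IsBoundaryPair Q k) {X : Fin 2 → TimeOrbit} (hR : ∀ i, IsReparam (Q i) (X i))
    (m : Fin 2 → ℝ) (i : Fin 2) {C : ℝ≥0}
    (h1 : LipschitzOnWith C (Q (1 - i)).dt (Icc (Q (1 - i)).lo (Q (1 - i)).hi))
    (h2 : LipschitzOnWith C (Q (1 - i)).dx (Icc (Q (1 - i)).lo (Q (1 - i)).hi))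
    {w : Variation} (hw : w.IsAdmissible (parLo Q k i) (parHi Q k i)) :
    HasDerivAt (fun ε => actionExt i m (Function.update Q i ((Q i).vary w ε)) k)
      (firstVariation (m i) (Q i) (Q (1 - i)) (parLo Q k i) (parHi Q k i) w) 0 := by
  obtain ⟨K, hK⟩ := (hR (1 - i)).exists_lipschitzOnWith_v (h.mem (1 - i)) h1 h2
  obtain ⟨κ, c1, c2⟩ := h.exists_isConeSeg hR i
  obtain ⟨κ', hF⟩ := h.exists_isFieldSeg hR i
  have ha := h.lo_le_parLo i
  have hab := (h.parLo_lt_parHi i).le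
  have hb := h.parHi_le_hi i
  have hne := h.ne_time hR i
  have d1 := (h.mem i).hasDerivAt_integral_localAlong (m i) ha hab hb hw
  -- The outer integral is differentiated over the whole orbit, with the variation extended by zero,
  -- and then restricted to the free segment.
  have d2 := c1.hasDerivAt_integral_interAlong (h.mem (1 - i)) (hR (1 - i)) hne hK
    (hw.extend hab ha hb)
  have d3 := c2.hasDerivAt_integral_interAlong (h.mem (1 - i)) (hR (1 - i)) hne hK hw
  rw [integral_interVar_eq ha hab hb hw] at d2
  rw [hF.firstVariation_eq (m i) (h.mem (1 - i)) (hR (1 - i)) hw (outerSign_isSign i)]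
  have hpar : ∀ ε j, parLo (Function.update Q i ((Q i).vary w ε)) k j = parLo Q k j ∧
      parHi (Function.update Q i ((Q i).vary w ε)) k j = parHi Q k j := by
    intro ε j
    have e : ∀ l, (Function.update Q i ((Q i).vary w ε) l).lo = (Q l).lo ∧
        (Function.update Q i ((Q i).vary w ε) l).hi = (Q l).hi := fun l => by
      rcases eq_or_ne l i with rfl | hl
      · rw [Function.update_self]; exact ⟨rfl, rfl⟩
      · rw [Function.update_of_ne hl]; exact ⟨rfl, rfl⟩
    rw [parLo, parLo, parHi, parHi, funext fun l => (e l).1, funext fun l => (e l).2]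
    exact ⟨rfl, rfl⟩
  refine ((((d1.const_add (∫ s in (parLo Q k (1 - i))..(parHi Q k (1 - i)),
    localAlong (m (1 - i)) (Q (1 - i)) s)).add d2).add d3)).congr_of_eventuallyEq
      (Eventually.of_forall fun ε => ?_)
  simp only [actionExt, (hpar ε _).1, (hpar ε _).2, Function.update_self,
    Function.update_of_ne (Fin.one_sub_ne i)]
  rfl

end Gateaux

/-! ### Critical orbits: absolute continuity and Euler–Lagrange equations. -/

section Critical

open Filter
open scoped Topology NNReal ENNReal

theorem IntervalIntegrable.absolutelyContinuousOnInterval_const_add {f : ℝ → ℝ} {a b : ℝ}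
    (hf : IntervalIntegrable f volume a b) (c : ℝ) :
    AbsolutelyContinuousOnInterval (fun s => c + ∫ r in a..s, f r) a b :=
  (LipschitzWith.const (α := ℝ) c).lipschitzOnWith.absolutelyContinuousOnInterval.add
    (hf.absolutelyContinuousOnInterval_intervalIntegral left_mem_uIcc)

theorem intervalIntegral_coord {f : ℝ → E3} {a b : ℝ} (hf : IntervalIntegrable f volume a b)
    (k : Fin 3) : (∫ r in a..b, f r) k = ∫ r in a..b, f r k :=
  ((EuclideanSpace.proj k : E3 →L[ℝ] ℝ).intervalIntegral_comp_comm hf).symm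

theorem IntervalIntegrable.coord {f : ℝ → E3} {a b : ℝ} (hf : IntervalIntegrable f volume a b)
    (k : Fin 3) : IntervalIntegrable (fun s => f s k) volume a b :=
  ⟨(EuclideanSpace.proj k : E3 →L[ℝ] ℝ).integrable_comp hf.1,
    (EuclideanSpace.proj k : E3 →L[ℝ] ℝ).integrable_comp hf.2⟩

theorem IntervalIntegrable.absolutelyContinuousOnInterval_const_add_E3 {f : ℝ → E3} {a b : ℝ}
    (hf : IntervalIntegrable f volume a b) (c : E3) :
    AbsolutelyContinuousOnInterval (fun s => c + ∫ r in a..s, f r) a b := by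
  refine AbsolutelyContinuousOnInterval.of_coord fun k => ?_
  have h1 := (hf.coord k).absolutelyContinuousOnInterval_const_add (c k)
  rw [absolutelyContinuousOnInterval_iff] at h1 ⊢
  intro ε hε
  obtain ⟨δ, hδ, H⟩ := h1 ε hε
  refine ⟨δ, hδ, fun E hE hlen => lt_of_eq_of_lt ?_ (H E hE hlen)⟩
  have e : ∀ s ∈ uIcc a b, (c + ∫ r in a..s, f r) k = c k + ∫ r in a..s, f r k := fun s hs => by
    rw [PiLp.add_apply, intervalIntegral_coord (hf.mono_set (uIcc_subset_uIcc_left hs))]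
  refine Finset.sum_congr rfl fun i hi => ?_
  rw [e _ (hE.1 i hi).1, e _ (hE.1 i hi).2]

/-- A function of bounded variation that agrees with a primitive off a countable set has, almost
everywhere, the integrand as its derivative. -/
theorem BoundedVariationOn.ae_hasDerivAt_of_eq_primitive {V : Type*} [NormedAddCommGroup V]
    [NormedSpace ℝ V] [FiniteDimensional ℝ V] {p f : ℝ → V} {c : V} {a b : ℝ} {N : Set ℝ}
    (hab : a ≤ b) (hp : BoundedVariationOn p (Icc a b)) (hf : IntervalIntegrable f volume a b)
    (hN : N.Countable) (h : ∀ s ∈ Icc a b \ N, p s = c + ∫ r in a..s, f r) :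
    ∀ᵐ s, s ∈ Ioo a b → HasDerivAt p (f s) s := by
  have := FiniteDimensional.complete ℝ V
  filter_upwards [hp.ae_differentiableAt_Icc hab, hf.ae_hasDerivAt_integral] with s h1 h2 hs
  have hsI := Ioo_subset_Icc_self hs
  have h3 := (h1 hsI).hasDerivAt
  -- Almost everywhere both `p` and the primitive are differentiable, and agreement off a countable
  -- set identifies the two derivatives.
  have h4 := (h2 (by rwa [uIcc_of_le hab]) a left_mem_uIcc).const_add c
  have h5 := deriv_eq_of_eqOn_compl_countable hN hs h h3 h4
  rwa [h5] at h3

theorem IsACUpToCountable.comp_inverse {F : Type*} [PseudoMetricSpace F] {p q : ℝ → F}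
    {t ψ : ℝ → ℝ} {a b : ℝ} {K : ℝ≥0} (h : IsACUpToCountable p a b) (hab : a ≤ b)
    (htab : t a ≤ t b) (hψ : ∀ s ∈ Icc a b, ψ (t s) = s)
    (hmaps : MapsTo ψ (Icc (t a) (t b)) (Icc a b)) (htψ : ∀ r ∈ Icc (t a) (t b), t (ψ r) = r)
    (hmono : MonotoneOn ψ (Icc (t a) (t b))) (hL : LipschitzOnWith K ψ (Icc (t a) (t b)))
    (hq : ∀ s ∈ Icc a b, p s = q (t s)) : IsACUpToCountable q (t a) (t b) := by
  obtain ⟨g, hg, N, hN, hpg⟩ := h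
  refine ⟨fun r => g (ψ r), ?_, t '' N, hN.image t, fun r hr => ?_⟩
  · refine AbsolutelyContinuousOnInterval.comp_monotoneOn htab ?_ hmono hL
    rwa [hψ a ⟨le_rfl, hab⟩, hψ b ⟨hab, le_rfl⟩]
  · have h1 := hmaps hr.1
    change q r = g (ψ r)
    rw [← hpg (ψ r) ⟨h1, fun hN' => hr.2 ⟨ψ r, hN', htψ r hr.1⟩⟩, hq _ h1, htψ r hr.1]

namespace IsFieldSeg

variable {X : TimeOrbit} {κ : ℝ} {Q : FourOrbit} {a b : ℝ} (h : IsFieldSeg X κ Q a b)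
  (m : ℝ) {Q' : FourOrbit} (hQ' : Q'.IsTBVXBV) (hR' : IsReparam Q' X)
include h hQ' hR'

section

variable (hcrit : ∀ w : Variation, w.IsAdmissible a b → firstVariation m Q Q' a b w = 0)
include hcrit

/-- Criticality is tested on variations of the time alone. -/
theorem exists_momentumExt0_eq_primitive : ∃ c : ℝ, ∃ N : Set ℝ, N.Countable ∧
    ∀ s ∈ Icc a b \ N, momentumExt0 m Q Q' s = c + ∫ r in a..s, dtLagExt m Q Q' r := by
  refine eq_const_add_primitive_of_forall_variation h.past.lt
    (h.intervalIntegrable_dtLagExt m hQ' hR') (h.boundedVariationOn_momentumExt0 m hQ' hR')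
    fun β dβ h1 h2 h3 h4 => ?_
  have := hcrit ⟨β, fun _ => 0, dβ, fun _ => 0⟩
    ⟨h1, boundedVariationOn_const 0, h2, fun s _ => by simp, h3, rfl,
      fun s hs => ⟨(h4 s hs).1, rfl, (h4 s hs).2, rfl⟩⟩
  simpa [firstVariation] using this

/-- Criticality is tested on variations along one coordinate axis of space. -/
theorem exists_momentumExt_coord_eq_primitive (k : Fin 3) : ∃ c : ℝ, ∃ N : Set ℝ, N.Countable ∧
    ∀ s ∈ Icc a b \ N, momentumExt m Q Q' s k = c + ∫ r in a..s, dxLagExt m Q Q' r k := by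
  refine eq_const_add_primitive_of_forall_variation h.past.lt
    ((h.intervalIntegrable_dxLagExt m hQ' hR').coord k)
    ((h.boundedVariationOn_momentumExt m hQ' hR').coord k) fun β dβ h1 h2 h3 h4 => ?_
  have := hcrit ⟨fun _ => 0, fun s => β s • EuclideanSpace.single k 1, fun _ => 0,
      fun s => dβ s • EuclideanSpace.single k 1⟩
    ⟨boundedVariationOn_const 0, h1.fun_smul (boundedVariationOn_const _), fun s _ => by simp,
      fun s hs => by
        rw [intervalIntegral.integral_smul_const, ← h2 s hs], rfl, by simp [h3],
      fun s hs => ⟨rfl, by simp [(h4 s hs).1], rfl, by simp [(h4 s hs).2]⟩⟩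
  rw [← this, firstVariation]
  refine intervalIntegral.integral_congr fun s _ => ?_
  simp only [real_inner_smul_right, EuclideanSpace.inner_single_right]
  simp
  ring

theorem exists_momentumExt_eq_primitive : ∃ c : E3, ∃ N : Set ℝ, N.Countable ∧
    ∀ s ∈ Icc a b \ N, momentumExt m Q Q' s = c + ∫ r in a..s, dxLagExt m Q Q' r := by
  choose c N hN hp using h.exists_momentumExt_coord_eq_primitive m hQ' hR' hcrit
  refine ⟨WithLp.toLp 2 c, ⋃ k, N k, countable_iUnion hN, fun s hs => ?_⟩
  ext k
  have hi := (h.intervalIntegrable_dxLagExt m hQ' hR').mono_set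
    (uIcc_subset_uIcc_left (by rw [uIcc_of_le h.past.lt.le]; exact hs.1) :
      uIcc a s ⊆ uIcc a b)
  rw [hp k s ⟨hs.1, fun hk => hs.2 (mem_iUnion.2 ⟨k, hk⟩)⟩, PiLp.add_apply,
    intervalIntegral_coord hi]

theorem isACUpToCountable_momentumExt0 : IsACUpToCountable (momentumExt0 m Q Q') a b := by
  obtain ⟨c, N, hN, hp⟩ := h.exists_momentumExt0_eq_primitive m hQ' hR' hcrit
  exact ⟨_, (h.intervalIntegrable_dtLagExt m hQ' hR').absolutelyContinuousOnInterval_const_add c,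
    N, hN, hp⟩

theorem isACUpToCountable_momentumExt : IsACUpToCountable (momentumExt m Q Q') a b := by
  obtain ⟨c, N, hN, hp⟩ := h.exists_momentumExt_eq_primitive m hQ' hR' hcrit
  exact ⟨_, (h.intervalIntegrable_dxLagExt m hQ' hR').absolutelyContinuousOnInterval_const_add_E3
    c, N, hN, hp⟩

/-- The derivative is that of the momenta themselves, not of an absolutely continuous
representative; bounded variation makes them differentiable almost everywhere. -/
theorem ae_eulerLagrangeExt : ∀ᵐ s ∂(volume.restrict (Icc a b)),
    EulerLagrangeExtTimeAt m Q Q' s ∧ EulerLagrangeExtSpaceAt m Q Q' s := by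
  obtain ⟨c, N, hN, hp⟩ := h.exists_momentumExt0_eq_primitive m hQ' hR' hcrit
  obtain ⟨c', N', hN', hp'⟩ := h.exists_momentumExt_eq_primitive m hQ' hR' hcrit
  rw [Measure.restrict_congr_set Ioo_ae_eq_Icc.symm, ae_restrict_iff' measurableSet_Ioo]
  filter_upwards [(h.boundedVariationOn_momentumExt0 m hQ' hR').ae_hasDerivAt_of_eq_primitive
    h.past.lt.le (h.intervalIntegrable_dtLagExt m hQ' hR') hN hp,
    (h.boundedVariationOn_momentumExt m hQ' hR').ae_hasDerivAt_of_eq_primitive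
    h.past.lt.le (h.intervalIntegrable_dxLagExt m hQ' hR') hN' hp'] with s h1 h2 hs
  exact ⟨h1 hs, h2 hs⟩

end

variable {Xi : TimeOrbit} (hR : IsReparam Q Xi)
include hR

theorem isACUpToCountable_legendre (hp : IsACUpToCountable (momentumExt0 m Q Q') a b) :
    IsACUpToCountable (legendre m Xi X) (Q.t a) (Q.t b) := by
  obtain ⟨ψ, K, h1, h2, h3, h4, h5⟩ := h.exists_inverse_time
  obtain ⟨c, hc⟩ := h.past.curve.time.exists_isExpanding
  have hle := (hc.mono h.past.lt.le h.past.lo_le h.past.le_hi).strictMonoOn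
    ⟨le_rfl, h.past.lt.le⟩ ⟨h.past.lt.le, le_rfl⟩ h.past.lt
  obtain ⟨g, hg, N, hN, hpg⟩ := hp.comp_inverse (q := fun t => -legendre m Xi X t) h.past.lt.le
    hle.le h1 h2 h3 h4 h5 fun s hs => h.momentumExt0_eq_neg_legendre m hQ' hR' hR hs
  refine ⟨-g, hg.neg, N, hN, fun r hr => ?_⟩
  rw [Pi.neg_apply, ← hpg r hr, neg_neg]

theorem isACUpToCountable_momentum (hp : IsACUpToCountable (momentumExt m Q Q') a b) :
    IsACUpToCountable (momentum m Xi X) (Q.t a) (Q.t b) := by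
  obtain ⟨ψ, K, h1, h2, h3, h4, h5⟩ := h.exists_inverse_time
  obtain ⟨c, hc⟩ := h.past.curve.time.exists_isExpanding
  have hle := (hc.mono h.past.lt.le h.past.lo_le h.past.le_hi).strictMonoOn
    ⟨le_rfl, h.past.lt.le⟩ ⟨h.past.lt.le, le_rfl⟩ h.past.lt
  exact hp.comp_inverse h.past.lt.le hle.le h1 h2 h3 h4 h5
    fun s hs => h.momentumExt_eq_momentum m hQ' hR' hR hs

end IsFieldSeg

end Critical

/-! ### Redundancy of the time component. -/

section TimeComponent

open Filter
open scoped Topology NNReal ENNReal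

theorem inner_dxLag_eq (m : ℝ) {Xi X : TimeOrbit} {t : ℝ}
    (h1 : DifferentiableAt ℝ X.scal (t, Xi.x t)) (h2 : DifferentiableAt ℝ X.vec (t, Xi.x t))
    (u : E3) : inner ℝ (dxLag m Xi X t) u = fderiv ℝ X.scal (t, Xi.x t) (0, u) -
      inner ℝ (Xi.v t) (fderiv ℝ X.vec (t, Xi.x t) (0, u)) := by
  have hF : HasFDerivAt (fun e : ℝ × E3 => localLag m (Xi.v t) + X.scal e -
      inner ℝ (Xi.v t) (X.vec e)) (fderiv ℝ X.scal (t, Xi.x t) -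
        (innerSL ℝ (Xi.v t)).comp (fderiv ℝ X.vec (t, Xi.x t))) (t, Xi.x t) :=
    (h1.hasFDerivAt.const_add _).sub ((innerSL ℝ (Xi.v t)).hasFDerivAt.comp _ h2.hasFDerivAt)
  have := (hF.comp (Xi.x t) ((hasFDerivAt_const t (Xi.x t)).prodMk
    (hasFDerivAt_id (Xi.x t)))).congr_of_eventuallyEq (f₁ := fun y => partialLag m X y (Xi.v t) t)
      (Eventually.of_forall fun y => partialLag_eq m X y (Xi.v t) t)
  rw [dxLag, inner_gradient_left]
  exact DFunLike.congr_fun this.fderiv u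

/-- The kinetic momentum is orthogonal to its derivative in the Minkowski metric. -/
theorem mul_deriv_eq_inner_deriv {m : ℝ} (hm : m ≠ 0) {τ : ℝ → ℝ} {u : ℝ → E3} {s : ℝ}
    (hτ : DifferentiableAt ℝ τ s) (hu : DifferentiableAt ℝ u s)
    (hpos : ∀ᶠ r in 𝓝 s, 0 < τ r ^ 2 - ‖u r‖ ^ 2) :
    ∃ p0' p', HasDerivAt (fun r => m * τ r / Real.sqrt (τ r ^ 2 - ‖u r‖ ^ 2)) p0' s ∧
      HasDerivAt (fun r => (m / Real.sqrt (τ r ^ 2 - ‖u r‖ ^ 2)) • u r) p' s ∧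
      τ s * p0' = inner ℝ (u s) p' := by
  have h0 := hpos.self_of_nhds
  have hS : DifferentiableAt ℝ (fun r => Real.sqrt (τ r ^ 2 - ‖u r‖ ^ 2)) s :=
    ((hτ.pow 2).fun_sub (hu.norm_sq ℝ)).sqrt h0.ne'
  have hS0 := Real.sqrt_pos.2 h0
  have d1 := ((hτ.const_mul m).fun_div hS hS0.ne').hasDerivAt
  have d2 := (((differentiableAt_const m).fun_div hS hS0.ne').fun_smul hu).hasDerivAt
  refine ⟨_, _, d1, d2, ?_⟩
  generalize deriv (fun r => m * τ r / Real.sqrt (τ r ^ 2 - ‖u r‖ ^ 2)) s = p0' at d1 ⊢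
  generalize deriv (fun r => (m / Real.sqrt (τ r ^ 2 - ‖u r‖ ^ 2)) • u r) s = p' at d2 ⊢
  -- The Minkowski square of the kinetic four-momentum is constantly `m ^ 2`; differentiating it
  -- gives the orthogonality.
  have hconst : (fun r => m * τ r / Real.sqrt (τ r ^ 2 - ‖u r‖ ^ 2) *
      (m * τ r / Real.sqrt (τ r ^ 2 - ‖u r‖ ^ 2)) -
      inner ℝ ((m / Real.sqrt (τ r ^ 2 - ‖u r‖ ^ 2)) • u r)
        ((m / Real.sqrt (τ r ^ 2 - ‖u r‖ ^ 2)) • u r)) =ᶠ[𝓝 s] fun _ => m ^ 2 := by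
    filter_upwards [hpos] with r hr
    have hS := Real.sqrt_pos.2 hr
    have hsq := Real.sq_sqrt hr.le
    rw [real_inner_smul_left, real_inner_smul_right, real_inner_self_eq_norm_sq]
    set S := Real.sqrt (τ r ^ 2 - ‖u r‖ ^ 2)
    field_simp
    linear_combination -hsq
  have d4 := ((d1.mul d1).sub (d2.inner ℝ d2)).unique
    ((hasDerivAt_const s (m ^ 2)).congr_of_eventuallyEq hconst)
  rw [real_inner_smul_right, real_inner_smul_left, real_inner_comm (u s)] at d4
  -- The four-momentum is `m / √(τ² - ‖u‖²)` times `(τ, u)`; cancelling this factor is where `m ≠ 0`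
  -- enters.
  have hk : 2 * (m / Real.sqrt (τ s ^ 2 - ‖u s‖ ^ 2)) ≠ 0 :=
    mul_ne_zero two_ne_zero (div_ne_zero hm hS0.ne')
  apply mul_left_cancel₀ hk
  linear_combination d4

namespace IsFieldSeg

variable {X : TimeOrbit} {κ : ℝ} {Q : FourOrbit} {a b : ℝ} (h : IsFieldSeg X κ Q a b)
include h

theorem hasDerivAt_inverse_time {ψ : ℝ → ℝ} {K : ℝ≥0} (hψ : ∀ s ∈ Icc a b, ψ (Q.t s) = s)
    (htψ : ∀ r ∈ Icc (Q.t a) (Q.t b), Q.t (ψ r) = r)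
    (hL : LipschitzOnWith K ψ (Icc (Q.t a) (Q.t b))) {s : ℝ} (hs : s ∈ Ioo a b)
    (hc : ContinuousAt Q.dt s) :
    Icc (Q.t a) (Q.t b) ∈ 𝓝 (Q.t s) ∧ HasDerivAt ψ (Q.dt s)⁻¹ (Q.t s) := by
  obtain ⟨c, hexp⟩ := h.past.curve.time.exists_isExpanding
  have hts := (hexp.mono h.past.lt.le h.past.lo_le h.past.le_hi).mapsTo_Ioo hs
  have hnhds := Icc_mem_nhds hts.1 hts.2
  have hsI := Ioo_subset_Icc_self hs
  refine ⟨hnhds, HasDerivAt.of_local_left_inverse (f := Q.t) (hL.continuousOn.continuousAt hnhds) ?_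
    (h.past.curve.time.dt_pos (h.past.subset hsI)).ne' ?_⟩
  · rw [hψ s hsI]
    exact h.past.curve.time.hasDerivAt (h.past.subset_Ioo hs) hc
  · filter_upwards [hnhds] with r hr using htψ r hr

variable (m : ℝ) {Q' : FourOrbit} (hQ' : Q'.IsTBVXBV) (hR' : IsReparam Q' X)
include hQ' hR'

/-- Both sides of the equation acquire the factor `t'`: the left by the chain rule for the momentum,
the right by linearity of the extended Lagrangian. The converse uses the differentiable inverse of
the time function. -/
theorem eulerLagrangeExtSpaceAt_iff {Xi : TimeOrbit} (hR : IsReparam Q Xi) {s : ℝ}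
    (hs : s ∈ Ioo a b) (hc : ContinuousAt Q.dt s)
    (h1 : DifferentiableAt ℝ X.scal (Q.t s, Q.x s))
    (h2 : DifferentiableAt ℝ X.vec (Q.t s, Q.x s)) :
    EulerLagrangeExtSpaceAt m Q Q' s ↔ EulerLagrangeAt m Xi X (Q.t s) := by
  obtain ⟨ψ, K, hψ, hmaps, htψ, hmono, hL⟩ := h.exists_inverse_time
  obtain ⟨hnhds, hdψ⟩ := h.hasDerivAt_inverse_time hψ htψ hL hs hc
  have hsI := Ioo_subset_Icc_self hs
  have hsQ := h.past.subset hsI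
  have hdt := h.past.curve.time.dt_pos hsQ
  have ht := h.past.curve.time.hasDerivAt (h.past.subset_Ioo hs) hc
  have hx := hR.x_eq s hsQ
  have hlag : dxLagExt m Q Q' s = Q.dt s • dxLag m Xi X (Q.t s) := by
    refine ext_inner_right ℝ fun u => ?_
    have e1 := h.inner_dxLagExt_eq m hQ' hR' hs h1 h2 u
    rw [hx] at h1 h2
    rw [e1, real_inner_smul_left, inner_dxLag_eq m h1 h2, hx, hR.dx_eq s hsQ,
      real_inner_smul_left]
    ring
  rw [EulerLagrangeExtSpaceAt, EulerLagrangeAt, hlag]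
  constructor
  · intro hp
    have hp' : HasDerivAt (momentumExt m Q Q') (Q.dt s • dxLag m Xi X (Q.t s)) (ψ (Q.t s)) := by
      rwa [hψ s hsI]
    refine ((hp'.scomp (Q.t s) hdψ).congr_of_eventuallyEq ?_).congr_deriv
      (inv_smul_smul₀ hdt.ne' _)
    filter_upwards [hnhds] with r hr
    rw [Function.comp_apply, h.momentumExt_eq_momentum m hQ' hR' hR (hmaps hr), htψ r hr]
  · intro hp
    refine (hp.scomp s ht).congr_of_eventuallyEq ?_
    filter_upwards [Icc_mem_nhds hs.1 hs.2] with r hr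
    exact h.momentumExt_eq_momentum m hQ' hR' hR hr

/-- Contracting the spatial equations with `x'`, the kinetic part becomes `t'` times that of the
time equation. The terms with spatial derivatives of the vector potential cancel, and division by
`t' > 0` leaves the time equation. -/
theorem eulerLagrangeExtTimeAt_of_space (hm : m ≠ 0) {s : ℝ} (hs : s ∈ Ioo a b)
    (hdt : DifferentiableAt ℝ Q.dt s) (hdx : DifferentiableAt ℝ Q.dx s)
    (h1 : DifferentiableAt ℝ X.scal (Q.t s, Q.x s))
    (h2 : DifferentiableAt ℝ X.vec (Q.t s, Q.x s)) (hEL : EulerLagrangeExtSpaceAt m Q Q' s) :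
    EulerLagrangeExtTimeAt m Q Q' s := by
  have hsI := Ioo_subset_Icc_self hs
  have hnhds := Icc_mem_nhds hs.1 hs.2
  have hpos := h.past.curve.time.dt_pos (h.past.subset hsI)
  obtain ⟨p0', p', hp0, hp, hpp⟩ := mul_deriv_eq_inner_deriv hm hdt hdx
    (by filter_upwards [hnhds] with r hr using h.past.curve.sq_sub_pos (h.past.subset hr))
  have ht := h.past.curve.time.hasDerivAt (h.past.subset_Ioo hs) hdt.continuousAt
  have hx := h.past.curve.hasDerivAt_x (h.past.subset_Ioo hs) hdx.continuousAt
  have hs1 := h1.hasFDerivAt.comp_hasDerivAt s (ht.prodMk hx)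
  have hv1 := h2.hasFDerivAt.comp_hasDerivAt s (ht.prodMk hx)
  have hP : HasDerivAt (momentumExt m Q Q')
      (p' - fderiv ℝ X.vec (Q.t s, Q.x s) (Q.dt s, Q.dx s)) s := by
    refine (hp.sub hv1).congr_of_eventuallyEq ?_
    filter_upwards [hnhds] with r hr
    exact h.momentumExt_eq m hQ' hR' hr
  have hP0 : HasDerivAt (momentumExt0 m Q Q')
      (-p0' + fderiv ℝ X.scal (Q.t s, Q.x s) (Q.dt s, Q.dx s)) s := by
    refine ((hp0.const_sub m).add hs1).congr_of_eventuallyEq ?_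
    filter_upwards [hnhds] with r hr
    rw [h.momentumExt0_eq m hQ' hR' hr]
    simp only [Pi.add_apply, Function.comp_apply, TimeOrbit.scal]
    ring
  have hEq := hP.unique hEL
  have e3 := h.dtLagExt_eq m hQ' hR' hs h1 h2
  have e4 := h.inner_dxLagExt_eq m hQ' hR' hs h1 h2 (Q.dx s)
  -- Splits the derivative of the potentials along the orbit into the partial derivatives that occur
  -- in the Lagrangian.
  have hdir : ((Q.dt s, Q.dx s) : ℝ × E3) = Q.dt s • ((1 : ℝ), (0 : E3)) + (0, Q.dx s) := by simp
  have hEq' := congrArg (fun v => inner ℝ v (Q.dx s)) hEq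
  beta_reduce at hEq'
  rw [e4, hdir, map_add, map_smul, inner_sub_left, inner_add_left, real_inner_smul_left,
    real_inner_comm _ p', ← hpp, real_inner_comm _ (fderiv ℝ X.vec _ _),
    real_inner_comm _ (fderiv ℝ X.vec _ (0, _))] at hEq'
  rw [EulerLagrangeExtTimeAt]
  refine hP0.congr_deriv ?_
  rw [e3, hdir, map_add, map_smul, smul_eq_mul]
  apply mul_left_cancel₀ hpos.ne'
  linarith

theorem ae_eulerLagrange (hm : m ≠ 0) {Xi : TimeOrbit} (hR : IsReparam Q Xi) :
    ∀ᵐ s ∂(volume.restrict (Icc a b)),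
      (EulerLagrangeExtSpaceAt m Q Q' s ↔ EulerLagrangeAt m Xi X (Q.t s)) ∧
      (EulerLagrangeExtSpaceAt m Q Q' s → EulerLagrangeExtTimeAt m Q Q' s) := by
  rw [Measure.restrict_congr_set Ioo_ae_eq_Icc.symm, ae_restrict_iff' measurableSet_Ioo]
  filter_upwards [h.ae_differentiableAt,
    h.past.curve.time.bv.ae_differentiableAt_Icc h.past.curve.time.lt.le,
    h.past.curve.bv.ae_differentiableAt_Icc h.past.curve.time.lt.le] with s hd h1 h2 hs
  have hsQ := h.past.subset (Ioo_subset_Icc_self hs)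
  exact ⟨h.eulerLagrangeExtSpaceAt_iff m hQ' hR' hR hs (h1 hsQ).continuousAt (hd hs).1 (hd hs).2,
    h.eulerLagrangeExtTimeAt_of_space m hQ' hR' hm hs (h1 hsQ) (h2 hsQ) (hd hs).1 (hd hs).2⟩

end IsFieldSeg

end TimeComponent

/-! ### The theorem. -/

theorem mainTheorem2 :
    -- every increasing time function of `T_BV` turns an orbit of `X_BV` into one of `T_BV ⊗ X_BV`
    (∀ (X : TimeOrbit), X.IsXBV → ∀ (lo hi : ℝ) (t dt : ℝ → ℝ), IsTBV lo hi t dt →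
      t lo = X.lo → t hi = X.hi →
        (X.reparam lo hi t dt).IsTBVXBV ∧ IsReparam (X.reparam lo hi t dt) X) ∧
    -- the choice `t(s) = s` embeds `X_BV`
    (∀ (X : TimeOrbit), X.IsXBV →
      (X.reparam X.lo X.hi id 1).IsTBVXBV ∧ IsReparam (X.reparam X.lo X.hi id 1) X) ∧
    -- every orbit of `T_BV ⊗ X_BV` arises by reparametrisation
    (∀ (Q : FourOrbit), Q.IsTBVXBV → ∃ X : TimeOrbit, X.IsXBV ∧ IsReparam Q X) ∧
    ∀ (m : Fin 2 → ℝ) (_ : ∀ i, 0 < m i) (Q : Fin 2 → FourOrbit) (k : Fin 2 → ℝ)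
      (_ : IsBoundaryPair Q k) (X : Fin 2 → TimeOrbit) (_ : ∀ i, IsReparam (Q i) (X i)),
      -- the extended action is well defined, its two forms agree, and it extends the action
      (∀ i, (∀ s ∈ Icc (Q i).lo (Q i).hi, ∃! s',
          (Q (1 - i)).OnCone (outerSign i) ((Q i).t s) ((Q i).x s) s') ∧
        (∀ s ∈ Icc (parLo Q k i) (parHi Q k i), ∃! s',
          (Q (1 - i)).OnCone (-outerSign i) ((Q i).t s) ((Q i).x s) s') ∧
        IntervalIntegrable (localAlong (m i) (Q i)) volume (parLo Q k i) (parHi Q k i) ∧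
        IntervalIntegrable (interAlong (outerSign i) (Q i) (Q (1 - i))) volume
          (Q i).lo (Q i).hi ∧
        IntervalIntegrable (interAlong (-outerSign i) (Q i) (Q (1 - i))) volume
          (parLo Q k i) (parHi Q k i) ∧
        actionExt i m Q k = actionExt (1 - i) m Q k ∧
        actionExt i m Q k = action i m X (fun j => (Q j).t (k j))) ∧
      ∀ i,
        -- extended Lagrangian, extended momentum and Legendre transform along the orbit
        (∀ s ∈ Icc (parLo Q k i) (parHi Q k i),
          partialLagExt (m i) (Q (1 - i)) ((Q i).t s) ((Q i).x s) ((Q i).dt s) ((Q i).dx s) =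
            (Q i).dt s * partialLag (m i) (X (1 - i)) ((X i).x ((Q i).t s))
              ((X i).v ((Q i).t s)) ((Q i).t s) ∧
          HasDerivAt (fun τ => partialLagExt (m i) (Q (1 - i)) ((Q i).t s) ((Q i).x s) τ
            ((Q i).dx s)) (momentumExt0 (m i) (Q i) (Q (1 - i)) s) ((Q i).dt s) ∧
          HasGradientAt (fun u => partialLagExt (m i) (Q (1 - i)) ((Q i).t s) ((Q i).x s)
            ((Q i).dt s) u) (momentumExt (m i) (Q i) (Q (1 - i)) s) ((Q i).dx s) ∧
          momentumExt0 (m i) (Q i) (Q (1 - i)) s =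
            -legendre (m i) (X i) (X (1 - i)) ((Q i).t s) ∧
          momentumExt (m i) (Q i) (Q (1 - i)) s =
            momentum (m i) (X i) (X (1 - i)) ((Q i).t s)) ∧
        (∀ t ∈ Icc ((Q i).t (parLo Q k i)) ((Q i).t (parHi Q k i)),
          HasGradientAt (fun v => partialLag (m i) (X (1 - i)) ((X i).x t) v t)
            (momentum (m i) (X i) (X (1 - i)) t) ((X i).v t) ∧
          momentum (m i) (X i) (X (1 - i)) t =
            (m i / Real.sqrt (1 - ‖(X i).v t‖ ^ 2)) • (X i).v t -
              vecPot (X (1 - i)) t ((X i).x t) ∧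
          legendre (m i) (X i) (X (1 - i)) t =
            m i / Real.sqrt (1 - ‖(X i).v t‖ ^ 2) - m i - scalPot (X (1 - i)) t ((X i).x t)) ∧
        -- bounded variation, as functions of `s` and of `t`
        BoundedVariationOn (momentumExt0 (m i) (Q i) (Q (1 - i)))
          (Icc (parLo Q k i) (parHi Q k i)) ∧
        BoundedVariationOn (momentumExt (m i) (Q i) (Q (1 - i)))
          (Icc (parLo Q k i) (parHi Q k i)) ∧
        BoundedVariationOn (legendre (m i) (X i) (X (1 - i)))
          (Icc ((Q i).t (parLo Q k i)) ((Q i).t (parHi Q k i))) ∧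
        BoundedVariationOn (momentum (m i) (X i) (X (1 - i)))
          (Icc ((Q i).t (parLo Q k i)) ((Q i).t (parHi Q k i))) ∧
        -- the first variation is well defined
        (∀ᵐ s ∂(volume.restrict (Icc (parLo Q k i) (parHi Q k i))),
          DifferentiableAt ℝ (fun p : ℝ × E3 => partialLagExt (m i) (Q (1 - i)) p.1 p.2
            ((Q i).dt s) ((Q i).dx s)) ((Q i).t s, (Q i).x s)) ∧
        IntervalIntegrable (dtLagExt (m i) (Q i) (Q (1 - i))) volume
          (parLo Q k i) (parHi Q k i) ∧
        IntervalIntegrable (dxLagExt (m i) (Q i) (Q (1 - i))) volume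
          (parLo Q k i) (parHi Q k i) ∧
        -- it is the Gateaux derivative of the extended action when `Q_j'` is Lipschitz
        ((∃ C, LipschitzOnWith C (Q (1 - i)).dt (Icc (Q (1 - i)).lo (Q (1 - i)).hi) ∧
            LipschitzOnWith C (Q (1 - i)).dx (Icc (Q (1 - i)).lo (Q (1 - i)).hi)) →
          ∀ w : Variation, w.IsAdmissible (parLo Q k i) (parHi Q k i) →
            HasDerivAt (fun ε => actionExt i m (Function.update Q i ((Q i).vary w ε)) k)
              (firstVariation (m i) (Q i) (Q (1 - i)) (parLo Q k i) (parHi Q k i) w) 0) ∧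
        -- critical orbits: absolute continuity and the extended Euler–Lagrange equations
        (IsCriticalFor m Q k i →
          IsACUpToCountable (momentumExt0 (m i) (Q i) (Q (1 - i)))
            (parLo Q k i) (parHi Q k i) ∧
          IsACUpToCountable (momentumExt (m i) (Q i) (Q (1 - i)))
            (parLo Q k i) (parHi Q k i) ∧
          IsACUpToCountable (legendre (m i) (X i) (X (1 - i)))
            ((Q i).t (parLo Q k i)) ((Q i).t (parHi Q k i)) ∧
          IsACUpToCountable (momentum (m i) (X i) (X (1 - i)))
            ((Q i).t (parLo Q k i)) ((Q i).t (parHi Q k i)) ∧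
          ∀ᵐ s ∂(volume.restrict (Icc (parLo Q k i) (parHi Q k i))),
            EulerLagrangeExtTimeAt (m i) (Q i) (Q (1 - i)) s ∧
            EulerLagrangeExtSpaceAt (m i) (Q i) (Q (1 - i)) s) ∧
        -- the time component of the extended Euler–Lagrange equations is not a new condition
        (∀ᵐ s ∂(volume.restrict (Icc (parLo Q k i) (parHi Q k i))),
          (EulerLagrangeExtSpaceAt (m i) (Q i) (Q (1 - i)) s ↔
            EulerLagrangeAt (m i) (X i) (X (1 - i)) ((Q i).t s)) ∧
          (EulerLagrangeExtSpaceAt (m i) (Q i) (Q (1 - i)) s →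
            EulerLagrangeExtTimeAt (m i) (Q i) (Q (1 - i)) s)) := by
  refine ⟨fun X hX lo hi t dt h hlo hhi => hX.reparam_isTBVXBV h hlo hhi,
    fun X hX => hX.reparam_isTBVXBV hX.isTBV_id rfl rfl, fun Q hQ => hQ.exists_isReparam, ?_⟩
  intro m hm Q k hB X hR
  refine ⟨fun i => ?_, fun i => ?_⟩
  · obtain ⟨κ, c1, c2⟩ := hB.exists_isConeSeg hR i
    have hQ' := hB.mem (1 - i)
    have hR' := hR (1 - i)
    refine ⟨fun s hs => hR'.existsUnique_onCone hQ' c1.sign (c1.exists_onCone s hs),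
      fun s hs => hR'.existsUnique_onCone hQ' c2.sign (c2.exists_onCone s hs), ?_,
      (c1.boundedVariationOn_interAlong hQ' hR').intervalIntegrable_real c1.lt.le,
      (c2.boundedVariationOn_interAlong hQ' hR').intervalIntegrable_real c2.lt.le, ?_,
      hB.actionExt_eq_action hR i m⟩
    · exact (((hB.mem i).boundedVariationOn_localAlong (m i)).mono
        c2.subset).intervalIntegrable_real c2.lt.le
    -- Both forms of the extended action equal the action over `X_BV` taken along particle `1 - i`.
    · rw [hB.actionExt_eq_action_other hR i m, hB.actionExt_eq_action hR (1 - i) m]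
  · obtain ⟨κ, hF⟩ := hB.exists_isFieldSeg hR i
    have hQ := hB.mem i
    have hQ' := hB.mem (1 - i)
    have hR' := hR (1 - i)
    have hsub := hF.past.subset
    refine ⟨fun s hs => ⟨hF.partialLagExt_eq_mul (m i) hQ' hR' (hR i) hs, ?_, ?_,
        hF.momentumExt0_eq_neg_legendre (m i) hQ' hR' (hR i) hs,
        hF.momentumExt_eq_momentum (m i) hQ' hR' (hR i) hs⟩, fun t ht => ?_,
      hF.boundedVariationOn_momentumExt0 (m i) hQ' hR',
      hF.boundedVariationOn_momentumExt (m i) hQ' hR',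
      hF.boundedVariationOn_legendre (m i) hQ' hR' (hR i),
      hF.boundedVariationOn_momentum (m i) hQ' hR' (hR i),
      hF.ae_differentiableAt_partialLagExt (m i) hQ' hR',
      hF.intervalIntegrable_dtLagExt (m i) hQ' hR', hF.intervalIntegrable_dxLagExt (m i) hQ' hR',
      fun ⟨C, h1, h2⟩ w hw => hB.hasDerivAt_actionExt hR m i h1 h2 hw, fun hcrit => ?_,
      hF.ae_eulerLagrange (m i) hQ' hR' (hm i).ne' (hR i)⟩
    · rw [hF.momentumExt0_eq (m i) hQ' hR' hs]
      exact hasDerivAt_partialLagExt (m i) hR' hQ' (hQ.sq_sub_pos (hsub hs)) (hF.exists_onCone hs)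
    · rw [hF.momentumExt_eq (m i) hQ' hR' hs]
      exact hasGradientAt_partialLagExt (m i) hR' hQ' (hQ.sq_sub_pos (hsub hs))
        (hF.exists_onCone hs)
    · obtain ⟨ψ, K, -, hmaps, htψ, -, -⟩ := hF.exists_inverse_time
      have hv : ‖(X i).v t‖ < 1 := htψ t ht ▸ hF.norm_v_lt_one (hR i) (hmaps ht)
      refine ⟨?_, momentum_eq (m i) _ hv, legendre_eq (m i) _ hv⟩
      rw [momentum_eq (m i) _ hv]
      exact hasGradientAt_partialLag (m i) _ hv
    · have p0 := hF.isACUpToCountable_momentumExt0 (m i) hQ' hR' hcrit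
      have p := hF.isACUpToCountable_momentumExt (m i) hQ' hR' hcrit
      exact ⟨p0, p, hF.isACUpToCountable_legendre (m i) hQ' hR' (hR i) p0,
        hF.isACUpToCountable_momentum (m i) hQ' hR' (hR i) p,
        hF.ae_eulerLagrangeExt (m i) hQ' hR' hcrit⟩
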